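/- An instance of \textsc{Weighted Gerrymandering} (\textsc{W-GM}) consists of a graph $G$ on a set of $n$ voters, a set $\mathcal C$ of $m$ candidates, weight functions $w_v\colon \mathcal C\to\mathbb Z_{\ge 0}$ for the voters $v\in V(G)$, a distinguished candidate $p\in\mathcal C$, and a positive integer $k$. A district is a nonempty connected set of vertices. A tie-breaking rule $\eta$ declares, for every district $U\subseteq V(G)$, one candidate in $\arg\max_{q\in\mathcal C}\sum_{v\in U}w_v(q)$ to be the winner of $U$. The instance is a yes-instance under $\eta$ if $V(G)$ can be partitioned into $k$ districts such that $p$ wins more of these districts than any other candidate. \textbf{Theorem.} There is a randomized algorithm that, given an instance of \textsc{W-GM} in which $G$ is a path $(u_1,\dots,u_n)$, together with a tie-breaking rule $\eta$, decides in time $2^k(n+m)^{O(1)}$ whether it is a yes-instance under $\eta$, with no false positives and with false negatives with probability at most $1/3$: on a no-instance it always answers "no", and on a yes-instance it answers "no" with probability at most $1/3$. Here an algorithm is a program of a random access machine with unit-cost arithmetic ($+$, $-$, $\times$, integer division) and fair coin flips; the rule $\eta$ is given by the table of the winners of all subpaths of $G$, and the time bound holds for every outcome of the coin flips. The words of the machine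 have $O(k+\log(n+m)+\log(W+1))+O(1)$ bits, where $W$ is the largest weight. -/

import Mathlib

/-! ## Weighted gerrymandering -/

/-- An instance of weighted gerrymandering: `n` voters, who are the vertices of the graph `G`,
`m` candidates, the weight `w v q` that voter `v` gives to candidate `q`, the distinguished
candidate `p`, and the number `k ≥ 1` of districts. -/
structure WGM where
  n : ℕ
  m : ℕ
  G : SimpleGraph (Fin n)
  w : Fin n → Fin m → ℕ
  p : Fin m
  k : ℕ
  k_pos : 0 < k

namespace WGM

/-- A district is a (nonempty) connected set of vertices. -/
def IsDistrict (I : WGM) (U : Finset (Fin I.n)) : Prop :=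
  (I.G.induce (U : Set (Fin I.n))).Connected

/-- A tie-breaking rule selects, for every district `U`, a winner among the candidates of maximum
total weight in `U` (its values on other sets are irrelevant). -/
def IsTieBreaking (I : WGM) (η : Finset (Fin I.n) → Fin I.m) : Prop :=
  ∀ U, I.IsDistrict U → ∀ q, ∑ v ∈ U, I.w v q ≤ ∑ v ∈ U, I.w v (η U)

/-- The number of parts of `P` that candidate `q` wins under `η`. -/
def wins (I : WGM) (η : Finset (Fin I.n) → Fin I.m)
    (P : Finpartition (Finset.univ : Finset (Fin I.n))) (q : Fin I.m) : ℕ :=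
  (P.parts.filter fun U => η U = q).card

/-- Yes-instance under `η`: the vertex set can be partitioned into `k` districts such that `p` wins
more districts than any other candidate. -/
def IsYes (I : WGM) (η : Finset (Fin I.n) → Fin I.m) : Prop :=
  ∃ P : Finpartition (Finset.univ : Finset (Fin I.n)),
    P.parts.card = I.k ∧ (∀ U ∈ P.parts, I.IsDistrict U) ∧
      ∀ q, q ≠ I.p → I.wins η P q < I.wins η P I.p

/-- The largest weight of the instance (`0` if there are no voters). -/
def maxWeight (I : WGM) : ℕ :=
  Finset.univ.sup fun v => Finset.univ.sup fun q => I.w v q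

/-- The input that describes an instance on the path `0, 1, …, n - 1` with a tie-breaking rule:
the numbers `n, m, k, p`, the `n × m` matrix of the weights, row by row, and the `n × n` matrix,
row by row, whose entry at `(i, j)` is the winner under `η` of the subpath with end vertices
`i` and `j`. -/
def encodePath (I : WGM) (η : Finset (Fin I.n) → Fin I.m) : List ℕ :=
  [I.n, I.m, I.k, (I.p : ℕ)] ++
    List.ofFn (fun x : Fin (I.n * I.m) => I.w x.divNat x.modNat) ++
    List.ofFn (fun x : Fin (I.n * I.n) => (η (Finset.uIcc x.divNat x.modNat) : ℕ))

end WGM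

/-! ## Randomized random access machines -/

namespace RAM

/-- Instructions of a randomized random access machine. Registers `r 0, r 1, …` hold natural
numbers and the input is a read-only array with random access. -/
inductive Instr
  /-- `r d := v` -/
  | const (d v : ℕ)
  /-- `r d := r a + r b` -/
  | add (d a b : ℕ)
  /-- `r d := r a - r b`, truncated at `0` -/
  | sub (d a b : ℕ)
  /-- `r d := r a * r b` -/
  | mul (d a b : ℕ)
  /-- `r d := ⌊r a / r b⌋`, and `0` if `r b = 0` -/
  | div (d a b : ℕ)
  /-- `r d := r (r a)` -/
  | load (d a : ℕ)
  /-- `r (r d) := r a` -/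
  | store (d a : ℕ)
  /-- `r d :=` entry number `r a` of the input, and `0` past its end -/
  | read (d a : ℕ)
  /-- `r d :=` a fresh fair random bit -/
  | flip (d : ℕ)
  /-- continue at program line `l` if `r a = 0` -/
  | jumpZero (a l : ℕ)
  /-- stop with the answer `ans` -/
  | halt (ans : Bool)

/-- A program is a finite list of instructions. -/
abbrev Program := List Instr

/-- A configuration: program counter, registers, number of random bits used so far, and the answer
if the machine has stopped. -/
structure Cfg where
  pc : ℕ
  reg : ℕ → ℕ
  used : ℕ
  answer : Option Bool

/-- The initial configuration. -/
def init : Cfg := ⟨0, fun _ => 0, 0, none⟩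

/-- Write `v` to register `d` and proceed to the next line. -/
def Cfg.write (s : Cfg) (d v : ℕ) : Cfg :=
  { s with pc := s.pc + 1, reg := Function.update s.reg d v }

/-- Execution of one instruction on the input `x`; `ω` is the sequence of random bits. -/
def exec (x : List ℕ) (ω : ℕ → Bool) (s : Cfg) : Instr → Cfg
  | .const d v => s.write d v
  | .add d a b => s.write d (s.reg a + s.reg b)
  | .sub d a b => s.write d (s.reg a - s.reg b)
  | .mul d a b => s.write d (s.reg a * s.reg b)
  | .div d a b => s.write d (s.reg a / s.reg b)
  | .load d a => s.write d (s.reg (s.reg a))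
  | .store d a => s.write (s.reg d) (s.reg a)
  | .read d a => s.write d (x.getD (s.reg a) 0)
  | .flip d => { s.write d (ω s.used).toNat with used := s.used + 1 }
  | .jumpZero a l => { s with pc := if s.reg a = 0 then l else s.pc + 1 }
  | .halt ans => { s with answer := some ans }

/-- One step. A machine that has stopped stays as it is; so does one that has left its program,
which then never answers. -/
def step (M : Program) (x : List ℕ) (ω : ℕ → Bool) (s : Cfg) : Cfg :=
  match s.answer, M[s.pc]? with
  | none, some i => exec x ω s i
  | _, _ => s

/-- The configuration after `t` steps. -/
def run (M : Program) (x : List ℕ) (ω : ℕ → Bool) (t : ℕ) : Cfg :=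
  (step M x ω)^[t] init

/-- On input `x` and random bits `ω`, the machine stops with the answer `ans`. -/
def Answers (M : Program) (x : List ℕ) (ω : ℕ → Bool) (ans : Bool) : Prop :=
  ∃ t, (run M x ω t).answer = some ans

/-- Whatever the random bits are, the machine stops on input `x` within `T` steps, and no register
ever holds a number above `B`. -/
def RunsWithin (M : Program) (x : List ℕ) (T B : ℕ) : Prop :=
  ∀ ω : ℕ → Bool, (run M x ω T).answer.isSome ∧ ∀ t i, (run M x ω t).reg i ≤ B

/-- The law of an infinite sequence of independent fair random bits. -/
noncomputable def coins : MeasureTheory.Measure (ℕ → Bool) :=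
  MeasureTheory.Measure.infinitePi fun _ => (PMF.uniformOfFintype Bool).toMeasure

end RAM

/-!
The districts of a path are its intervals, so a partition into `k` districts is a segmentation of
`{0, …, n - 1}` into `k` intervals. Let `t + 1` be the number of intervals that `p` is to win, so
that every other candidate may win at most `t`; the algorithm tries all `t < k`.

The conditions on the numbers of wins are expressed by linear independence. Every candidate `c ≠ p`
gets `t` random vectors in a space of dimension `k` whose first `t + 1` coordinates vanish, and `p`
gets `t + 1` random vectors in which only these coordinates may be nonzero. An interval gets a
random combination of the vectors of its winner (`coef`). If the vectors of the intervals of a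
segmentation have a nonzero top exterior product, then there are `k` of them and they are linearly
independent, so that each `c ≠ p` wins at most `t` intervals, at most `k - (t + 1)` intervals are
won by others than `p`, and `p` wins at most, hence exactly, `t + 1` of them. The dynamic program
`dp` computes the sum of these exterior products over all segmentations, in the exterior algebra of
dimension `2 ^ k`. A nonzero top coefficient therefore proves a yes-instance
(`exists_segmentation_of_dp_ne_zero`, `WGM.isYes_of_segmentation`). Conversely, for a good
segmentation the random numbers can be chosen such that its intervals get distinct basis vectors and
all other intervals the zero vector, and then no other segmentation contributes
(`WGM.exists_dp_ne_zero`). The top coefficient is thus a nonzero polynomial of degree at most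
`2 * n` in the random numbers, and the lemma of Schwartz and Zippel bounds the probability that it
vanishes at random arguments below `Q ≥ 6 * n`, modulo a prime number `r > Q`
(`three_mul_card_testValue_eq_zero_le`, `coins_randomNumbers_mem_le`).

The machine program is compiled from a small structured language with variables, one array,
conditionals and bounded loops. `Run.toProgram` translates the semantics of the language, which
counts steps and bounds the assigned numbers, into a statement about the machine. The rules `Spec.*`
then allow one to verify each part of `algorithm` with its running time, up to `algorithm_spec`; the
constants in the time bounds are generous. `Q` is a power of two, so that uniform numbers below `Q`
come from blocks of random bits, and the prime number is found by trial division between `Q` and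
`2 * Q`, which takes time polynomial in `n`.
-/

/-! ### Exterior products on bit masks -/

theorem testBit_sub_two_pow {S l : ℕ} (h : S.testBit l = true) (i : ℕ) :
    (S - 2 ^ l).testBit i = (S.testBit i && decide (i ≠ l)) := by
  have hle := Nat.ge_two_pow_of_testBit h
  obtain ⟨T, rfl⟩ : ∃ T, S = 2 ^ l + T := ⟨S - 2 ^ l, by omega⟩
  rw [Nat.add_sub_cancel_left]
  rw [Nat.testBit_two_pow_add_eq] at h
  rcases lt_trichotomy i l with hi | rfl | hi
  · rw [Nat.testBit_two_pow_add_gt hi]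
    simp [hi.ne]
  · simpa using h
  · obtain ⟨d, rfl⟩ : ∃ d, i = d + 1 + l := ⟨i - l - 1, by omega⟩
    rw [Nat.testBit_add T (d + 1) l, Nat.testBit_add _ (d + 1) l, Nat.add_comm (2 ^ l) T,
      Nat.add_div_right _ (Nat.two_pow_pos l), Nat.testBit_add_one, Nat.testBit_add_one]
    have h' : ¬ T / 2 ^ l % 2 = 1 := by
      simpa [Nat.testBit_eq_decide_div_mod_eq] using h
    have : (T / 2 ^ l).succ / 2 = T / 2 ^ l / 2 := by omega
    simp [this]

section Wedge

variable {R : Type*} [CommRing R]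

/-- The exterior product `u ∧ A` of a vector `u` with an element `A` of the exterior algebra of
`R ^ L`. An element of the exterior algebra is given by its coefficients, which are indexed by
the sets of basis vectors, encoded as bit masks `S`. The sign of the term of `l ∈ S` is determined
by the number of elements of `S` above `l`. -/
def wedge (u A : ℕ → R) : ℕ → ℕ → R
  | 0, _ => 0
  | L + 1, S => if S.testBit L then u L * A (S - 2 ^ L) - wedge u A L S else wedge u A L S

theorem wedge_congr {u u' A A' : ℕ → R} {L S : ℕ} (hu : ∀ l < L, u l = u' l)
    (hA : ∀ l < L, S.testBit l = true → A (S - 2 ^ l) = A' (S - 2 ^ l)) :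
    wedge u A L S = wedge u' A' L S := by
  induction L with
  | zero => rfl
  | succ L ih =>
    simp only [wedge]
    rw [ih (fun l hl => hu l (by omega)) (fun l hl => hA l (by omega)), hu L (by omega)]
    split_ifs with h
    · rw [hA L (by omega) h]
    · rfl

theorem wedge_linear_right (u A A' : ℕ → R) (a b : R) (L S : ℕ) :
    wedge u (fun T => a * A T + b * A' T) L S = a * wedge u A L S + b * wedge u A' L S := by
  induction L with
  | zero => simp [wedge]
  | succ L ih =>
    simp only [wedge, ih]
    split_ifs <;> ring

theorem wedge_linear_left (u u' A : ℕ → R) (a b : R) (L S : ℕ) :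
    wedge (fun l => a * u l + b * u' l) A L S = a * wedge u A L S + b * wedge u' A L S := by
  induction L with
  | zero => simp [wedge]
  | succ L ih =>
    simp only [wedge, ih]
    split_ifs <;> ring

theorem wedge_zero_left {u : ℕ → R} {L : ℕ} (hu : ∀ l < L, u l = 0) (A : ℕ → R) (S : ℕ) :
    wedge u A L S = 0 := by
  have h := wedge_linear_left u u A 0 0 L S
  rw [← wedge_congr (u := fun l => 0 * u l + 0 * u l) (u' := u) (A := A) (L := L) (S := S)
    (by intro l hl; simp [hu l hl]) (fun _ _ _ => rfl), h]
  ring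

/-- A vector squares to zero in the exterior algebra. -/
theorem wedge_wedge (u A : ℕ → R) (L S : ℕ) : wedge u (wedge u A L) L S = 0 := by
  induction L generalizing S with
  | zero => rfl
  | succ L ih =>
    -- The masks `S - 2 ^ l` with `l < L` agree with `S` in bit `L`.
    have key : ∀ l < L, S.testBit l = true → (S - 2 ^ l).testBit L = S.testBit L := by
      intro l hl h
      rw [testBit_sub_two_pow h]
      simp [show L ≠ l by omega]
    by_cases h : S.testBit L = true
    · have h1 : (S - 2 ^ L).testBit L = false := by simp [testBit_sub_two_pow h]
      have h2 : wedge u (wedge u A (L + 1)) L S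
          = wedge u (fun T => u L * A (T - 2 ^ L) + (-1) * wedge u A L T) L S := by
        refine wedge_congr (fun _ _ => rfl) fun l hl hb => ?_
        simp only [wedge, key l hl hb, h, if_true]
        ring
      have h3 : wedge u (fun T => A (T - 2 ^ L)) L S = wedge u A L (S - 2 ^ L) := by
        clear ih h2
        have : ∀ L' ≤ L, wedge u (fun T => A (T - 2 ^ L)) L' S = wedge u A L' (S - 2 ^ L) := by
          intro L' hL'
          induction L' with
          | zero => rfl
          | succ l ih =>
            have : (S - 2 ^ L).testBit l = S.testBit l := by
              rw [testBit_sub_two_pow h]; simp [show l ≠ L by omega]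
            simp only [wedge, this, ih (by omega), Nat.sub_right_comm S]
        exact this L le_rfl
      rw [wedge, if_pos h, h2, wedge_linear_right u (fun T => A (T - 2 ^ L)) (wedge u A L), ih, h3]
      simp [wedge, h1]
    · have h2 : wedge u (wedge u A (L + 1)) L S = wedge u (wedge u A L) L S := by
        refine wedge_congr (fun _ _ => rfl) fun l hl hb => ?_
        simp [wedge, key l hl hb, h]
      rw [wedge, if_neg h, h2, ih]

theorem map_wedge {R' : Type*} [CommRing R'] (φ : R →+* R') (u A : ℕ → R) (L S : ℕ) :
    φ (wedge u A L S) = wedge (fun l => φ (u l)) (fun T => φ (A T)) L S := by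
  induction L with
  | zero => simp [wedge]
  | succ L ih =>
    simp only [wedge, apply_ite φ, map_sub, map_mul, ih]

/-- The product with a basis vector does not cancel. -/
theorem wedge_single_ne_zero {u : ℕ → R} {L l₀ : ℕ} (hl₀ : l₀ < L)
    (hu : ∀ l < L, u l = if l = l₀ then 1 else 0) (A : ℕ → R) (S : ℕ) :
    wedge u A L S ≠ 0 ↔ S.testBit l₀ = true ∧ A (S - 2 ^ l₀) ≠ 0 := by
  induction L with
  | zero => omega
  | succ L ih =>
    rcases Nat.lt_succ_iff_lt_or_eq.mp hl₀ with h | h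
    · have := ih h (fun l hl => hu l (by omega))
      simp only [wedge, hu L (by omega), show L ≠ l₀ by omega, if_false, zero_mul, zero_sub]
      split_ifs
      · rw [neg_ne_zero, this]
      · exact this
    · subst h
      have h0 : wedge u A l₀ S = 0 :=
        wedge_zero_left (fun l hl => by rw [hu l (by omega), if_neg (by omega)]) A S
      simp only [wedge, h0, hu l₀ (by omega), if_true, one_mul, sub_zero]
      split_ifs with hb
      · simp [hb]
      · simp [hb]

/-- The number of elements of the subset of `{0, …, L - 1}` with mask `S`. -/
def maskCard (L S : ℕ) : ℕ := ((Finset.range L).filter fun l => S.testBit l = true).card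

theorem maskCard_sub_two_pow {L S l : ℕ} (hl : l < L) (h : S.testBit l = true) :
    maskCard L S = maskCard L (S - 2 ^ l) + 1 := by
  have : ((Finset.range L).filter fun i => (S - 2 ^ l).testBit i = true)
      = ((Finset.range L).filter fun i => S.testBit i = true).erase l := by
    ext i
    simp only [Finset.mem_filter, Finset.mem_erase, testBit_sub_two_pow h, Bool.and_eq_true,
      decide_eq_true_eq]
    tauto
  rw [maskCard, maskCard, this, Finset.card_erase_add_one]
  simp [hl, h]

/-- The exterior product raises the degree by one. -/
theorem exists_of_wedge_ne_zero {u A : ℕ → R} {L S : ℕ} (h : wedge u A L S ≠ 0) :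
    ∃ l < L, S.testBit l = true ∧ A (S - 2 ^ l) ≠ 0 := by
  by_contra! hc
  apply h
  rw [wedge_congr (A' := fun T => 0 * A T + 0 * A T) (fun _ _ => rfl)
    (fun l hl hb => by simp [hc l hl hb]), wedge_linear_right]
  ring

end Wedge

section Chains

variable {F : Type*} [Field F]

/-- A vector with coordinates in `{0, …, L - 1}` as a sequence that vanishes from `L` on. -/
def extendVec {L : ℕ} (v : Fin L → F) (l : ℕ) : F := if h : l < L then v ⟨l, h⟩ else 0

/-- The exterior product with a vector as a linear map that depends linearly on the vector. -/
def wedgeHom (F : Type*) [Field F] (L : ℕ) : (Fin L → F) →ₗ[F] Module.End F (ℕ → F) :=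
  LinearMap.mk₂ F (fun v A => wedge (extendVec v) A L)
    (fun v v' A => by
      funext S
      have := wedge_linear_left (extendVec v) (extendVec v') A 1 1 L S
      simp only [one_mul] at this
      rw [Pi.add_apply, ← this]
      congr 1
      funext l; simp only [extendVec]; split_ifs <;> simp)
    (fun a v A => by
      funext S
      have := wedge_linear_left (extendVec v) (extendVec v) A a 0 L S
      simp only [zero_mul, add_zero] at this
      rw [Pi.smul_apply, smul_eq_mul, ← this]
      congr 1
      funext l; simp only [extendVec]; split_ifs <;> simp)
    (fun v A A' => by
      funext S
      have := wedge_linear_right (extendVec v) A A' 1 1 L S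
      simp only [one_mul] at this
      rw [Pi.add_apply, ← this]; rfl)
    (fun a v A => by
      funext S
      have := wedge_linear_right (extendVec v) A A a 0 L S
      simp only [zero_mul, add_zero] at this
      rw [Pi.smul_apply, smul_eq_mul, ← this]; rfl)

theorem wedgeHom_apply (L : ℕ) (v : Fin L → F) (A : ℕ → F) :
    wedgeHom F L v A = wedge (extendVec v) A L := rfl

theorem wedgeHom_mul_self (L : ℕ) (v : Fin L → F) : wedgeHom F L v * wedgeHom F L v = 0 := by
  ext A S : 2
  exact wedge_wedge _ _ _ _

/-- If a product of vectors in the exterior algebra is nonzero, then they are linearly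
independent. -/
theorem linearIndependent_of_prod_ne_zero {L t : ℕ} (v : Fin t → Fin L → F) (A : ℕ → F)
    (h : (List.ofFn fun i => wedgeHom F L (v i)).prod A ≠ 0) : LinearIndependent F v := by
  by_contra hv
  have h0 := (ExteriorAlgebra.ιMulti F t).map_linearDependent v hv
  rw [ExteriorAlgebra.ιMulti_apply] at h0
  have h1 := congrArg (ExteriorAlgebra.lift F ⟨wedgeHom F L, wedgeHom_mul_self L⟩) h0
  rw [map_list_prod, List.map_ofFn, map_zero] at h1
  apply h
  have h2 : (ExteriorAlgebra.lift F ⟨wedgeHom F L, wedgeHom_mul_self L⟩ ∘ fun i =>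
      ExteriorAlgebra.ι F (v i)) = fun i => wedgeHom F L (v i) := by
    funext i; simp
  rw [h2] at h1
  rw [h1]; rfl

/-- Among linearly independent vectors, at most `d` lie in the span of `d` vectors. -/
theorem card_le_of_linearIndependent_of_mem_span {V ι : Type*} [AddCommGroup V] [Module F V]
    {v : ι → V} (hv : LinearIndependent F v) (s : Finset ι) {d : ℕ} (w : Fin d → V)
    (hs : ∀ i ∈ s, v i ∈ Submodule.span F (Set.range w)) : s.card ≤ d := by
  have h1 : LinearIndependent F (fun i : s => v i) := hv.comp _ Subtype.val_injective
  let v' : s → Submodule.span F (Set.range w) := fun i => ⟨v i, hs i i.2⟩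
  have h2 : LinearIndependent F v' := by
    apply LinearIndependent.of_comp (Submodule.subtype _)
    exact h1
  have : FiniteDimensional F (Submodule.span F (Set.range w)) :=
    FiniteDimensional.span_of_finite F (Set.finite_range w)
  have h3 := h2.fintype_card_le_finrank
  rw [Fintype.card_coe] at h3
  exact h3.trans ((finrank_range_le_card w).trans (by simp))

end Chains

/-! ### The dynamic program over segmentations of a path -/

section DP

variable {R : Type*} [CommRing R]

/-- `dp u k i` is the sum, over all segmentations of `{0, …, i - 1}` into intervals, of the exterior
products in `Λ (R ^ k)` of the vectors `u a b` of their intervals `{a, …, b}`. It is computed by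
recursion on the last interval. -/
def dp (u : ℕ → ℕ → ℕ → R) (k : ℕ) : ℕ → ℕ → R
  | 0 => fun S => if S = 0 then 1 else 0
  | i + 1 => fun S => ∑ j : Fin (i + 1), wedge (u j i) (dp u k j) k S
  termination_by i => i
  decreasing_by exact j.2

theorem dp_zero (u : ℕ → ℕ → ℕ → R) (k S : ℕ) : dp u k 0 S = if S = 0 then 1 else 0 := by
  rw [dp]

theorem dp_succ (u : ℕ → ℕ → ℕ → R) (k i S : ℕ) :
    dp u k (i + 1) S = ∑ j ∈ Finset.range (i + 1), wedge (u j i) (dp u k j) k S := by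
  rw [dp, Finset.sum_range]

theorem map_dp {R' : Type*} [CommRing R'] (φ : R →+* R') (u : ℕ → ℕ → ℕ → R) (k i S : ℕ) :
    φ (dp u k i S) = dp (fun a b l => φ (u a b l)) k i S := by
  induction i using Nat.strong_induction_on generalizing S with
  | _ i ih =>
    cases i with
    | zero => simp [dp_zero, apply_ite φ]
    | succ i =>
      rw [dp_succ, dp_succ, map_sum]
      refine Finset.sum_congr rfl fun j hj => ?_
      rw [map_wedge]
      exact wedge_congr (fun _ _ => rfl) fun l _ _ => ih j (Finset.mem_range.mp hj) _

/-- The `l`-th coordinate of the vector of the interval `{a, …, b}`, where `p` is to win `t + 1`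
intervals. If a candidate `c ≠ p` wins the interval, the vector is a combination of `t` vectors
`ρ 1 c x` that belong to `c`, with coefficients `ρ 0 a b x`, and its coordinates `l ≤ t` are set to
zero. If `p` wins, the vector is a combination of `t + 1` vectors, and its coordinates `l > t` are
set to zero. -/
def coef (ρ : ℕ → ℕ → ℕ → ℕ → R) (q : ℕ → ℕ → ℕ) (p t a b l : ℕ) : R :=
  if l ≤ t ↔ q a b = p then
    ∑ x ∈ Finset.range (t + if q a b = p then 1 else 0), ρ 0 a b x * ρ 1 (q a b) x l
  else 0

theorem map_coef {R' : Type*} [CommRing R'] (φ : R →+* R') (ρ : ℕ → ℕ → ℕ → ℕ → R)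
    (q : ℕ → ℕ → ℕ) (p t a b l : ℕ) :
    φ (coef ρ q p t a b l) = coef (fun y a b c => φ (ρ y a b c)) q p t a b l := by
  unfold coef
  split_ifs <;> simp

end DP

/-! ### A nonzero top coefficient gives a good segmentation -/

/-- `IsSegmentation i C`: the list `C` consists of the pairs of end points of the intervals of a
segmentation of `{0, …, i - 1}`, the last interval first. -/
inductive IsSegmentation : ℕ → List (ℕ × ℕ) → Prop
  | nil : IsSegmentation 0 []
  | cons {a b : ℕ} {C : List (ℕ × ℕ)} : IsSegmentation a C → a ≤ b →
      IsSegmentation (b + 1) ((a, b) :: C)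

section Soundness

variable {F : Type*} [Field F]

/-- The exterior product of the vectors of a list of intervals. -/
def segProd (u : ℕ → ℕ → ℕ → F) (k : ℕ) : List (ℕ × ℕ) → ℕ → F
  | [] => fun S => if S = 0 then 1 else 0
  | e :: C => wedge (u e.1 e.2) (segProd u k C) k

theorem dp_mem_span (u : ℕ → ℕ → ℕ → F) (k i : ℕ) :
    dp u k i ∈ Submodule.span F {A | ∃ C, IsSegmentation i C ∧ A = segProd u k C} := by
  induction i using Nat.strong_induction_on with
  | _ i ih =>
    cases i with
    | zero =>
      refine Submodule.subset_span ⟨[], .nil, ?_⟩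
      funext S; simp [dp_zero, segProd]
    | succ i =>
      have h : dp u k (i + 1) = ∑ j ∈ Finset.range (i + 1),
          wedgeHom F k (fun l => u j i l) (dp u k j) := by
        funext S
        rw [dp_succ, Finset.sum_apply]
        refine Finset.sum_congr rfl fun j _ => ?_
        rw [wedgeHom_apply]
        exact wedge_congr (fun l hl => by simp [extendVec, hl]) fun _ _ _ => rfl
      rw [h]
      refine Submodule.sum_mem _ fun j hj => ?_
      have hj' := Finset.mem_range.mp hj
      have hm := Submodule.mem_map_of_mem (f := wedgeHom F k (fun l => u j i l)) (ih j hj')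
      rw [Submodule.map_span] at hm
      refine Submodule.span_mono ?_ hm
      rintro _ ⟨_, ⟨C, hC, rfl⟩, rfl⟩
      refine ⟨(j, i) :: C, .cons hC (by omega), ?_⟩
      funext S
      rw [wedgeHom_apply, segProd]
      exact wedge_congr (fun l hl => by simp [extendVec, hl]) fun _ _ _ => rfl

theorem exists_segProd_ne_zero {u : ℕ → ℕ → ℕ → F} {k i S : ℕ} (h : dp u k i S ≠ 0) :
    ∃ C, IsSegmentation i C ∧ segProd u k C S ≠ 0 := by
  by_contra! hc
  apply h
  have hle : Submodule.span F {A | ∃ C, IsSegmentation i C ∧ A = segProd u k C}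
      ≤ LinearMap.ker (LinearMap.proj (R := F) (φ := fun _ : ℕ => F) S) := by
    rw [Submodule.span_le]
    rintro _ ⟨C, hC, rfl⟩
    exact hc C hC
  exact hle (dp_mem_span u k i)

theorem length_eq_maskCard_of_segProd_ne_zero {u : ℕ → ℕ → ℕ → F} {k S : ℕ} {C : List (ℕ × ℕ)}
    (h : segProd u k C S ≠ 0) : C.length = maskCard k S := by
  induction C generalizing S with
  | nil =>
    have : S = 0 := by simpa [segProd] using h
    simp [this, maskCard]
  | cons e C ih =>
    obtain ⟨l, hl, hb, h'⟩ := exists_of_wedge_ne_zero h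
    rw [maskCard_sub_two_pow hl hb, List.length_cons, ih h']

theorem segProd_eq_prod (u : ℕ → ℕ → ℕ → F) (k : ℕ) (C : List (ℕ × ℕ)) :
    segProd u k C = (C.map fun e => wedgeHom F k (fun l => u e.1 e.2 l)).prod
      (fun S => if S = 0 then 1 else 0) := by
  induction C with
  | nil => rfl
  | cons e C ih =>
    funext S
    rw [List.map_cons, List.prod_cons, Module.End.mul_apply, ← ih, wedgeHom_apply, segProd]
    exact wedge_congr (fun l hl => by simp [extendVec, hl]) fun _ _ _ => rfl

theorem linearIndependent_of_segProd_ne_zero {u : ℕ → ℕ → ℕ → F} {k S : ℕ} {C : List (ℕ × ℕ)}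
    (h : segProd u k C S ≠ 0) :
    LinearIndependent F fun (x : Fin C.length) (l : Fin k) => u C[x].1 C[x].2 l := by
  apply linearIndependent_of_prod_ne_zero (A := fun S => if S = 0 then 1 else 0)
  intro h0
  apply h
  have hC : C.map (fun e => wedgeHom F k (fun l => u e.1 e.2 l))
      = List.ofFn fun x : Fin C.length => wedgeHom F k (fun l => u C[x].1 C[x].2 l) := by
    conv_lhs => rw [← List.ofFn_getElem (xs := C), List.map_ofFn]
    rfl
  rw [segProd_eq_prod, hC]
  exact congrFun h0 S

theorem countP_eq_card_filter {α : Type*} (C : List α) (P : α → Prop) [DecidablePred P] :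
    C.countP (fun a => decide (P a))
      = (Finset.univ.filter fun x : Fin C.length => P C[x]).card := by
  have h : C = (List.finRange C.length).map fun x => C[x] := by
    rw [← List.ofFn_eq_map]; exact (List.ofFn_getElem (xs := C)).symm
  conv_lhs => rw [h]
  rw [List.countP_map, List.countP_eq_length_filter]
  rfl

/-- Soundness of the algebraic test: a nonzero top coefficient comes from a segmentation into `k`
intervals, of which `p` wins `t + 1`, and every other candidate wins at most `t`. -/
theorem exists_segmentation_of_dp_ne_zero {ρ : ℕ → ℕ → ℕ → ℕ → F} {q : ℕ → ℕ → ℕ} {p t k n : ℕ}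
    (ht : t < k) (h : dp (coef ρ q p t) k n (2 ^ k - 1) ≠ 0) :
    ∃ C, IsSegmentation n C ∧ C.length = k ∧
      C.countP (fun e => decide (q e.1 e.2 = p)) = t + 1 ∧
      ∀ c ≠ p, C.countP (fun e => decide (q e.1 e.2 = c)) ≤ t := by
  obtain ⟨C, hC, hne⟩ := exists_segProd_ne_zero h
  have hlen : C.length = k := by
    rw [length_eq_maskCard_of_segProd_ne_zero hne, maskCard]
    rw [Finset.filter_true_of_mem, Finset.card_range]
    intro l hl
    simpa [Nat.testBit_two_pow_sub_one] using hl
  have hli := linearIndependent_of_segProd_ne_zero hne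
  -- The vectors of the intervals won by `c` lie in the span of the vectors that belong to `c`.
  have hcap : ∀ c, C.countP (fun e => decide (q e.1 e.2 = c)) ≤ t + if c = p then 1 else 0 := by
    intro c
    rw [countP_eq_card_filter]
    refine card_le_of_linearIndependent_of_mem_span hli _
      (fun (x : Fin (t + if c = p then 1 else 0)) (l : Fin k) =>
        if (l : ℕ) ≤ t ↔ c = p then ρ 1 c x l else 0) ?_
    intro x hx
    have hx' : q C[x].1 C[x].2 = c := (Finset.mem_filter.mp hx).2
    have : (fun l : Fin k => coef ρ q p t C[x].1 C[x].2 l)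
        = ∑ y : Fin (t + if c = p then 1 else 0), ρ 0 C[x].1 C[x].2 y •
          (fun l : Fin k => if (l : ℕ) ≤ t ↔ c = p then ρ 1 c y l else 0) := by
      funext l
      rw [Finset.sum_apply, coef, hx', Finset.sum_range]
      by_cases hl : (l : ℕ) ≤ t ↔ c = p <;> simp [hl]
    rw [this]
    exact Submodule.sum_mem _ fun y _ =>
      Submodule.smul_mem _ _ (Submodule.subset_span ⟨y, rfl⟩)
  -- The vectors of the other intervals vanish in the coordinates `l ≤ t`.
  have hother : C.countP (fun e => decide (¬ q e.1 e.2 = p)) ≤ k - (t + 1) := by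
    rw [countP_eq_card_filter]
    refine card_le_of_linearIndependent_of_mem_span hli _
      (fun (y : Fin (k - (t + 1))) => Pi.single (⟨t + 1 + y, by omega⟩ : Fin k) (1 : F)) ?_
    intro x hx
    have hx' : ¬ q C[x].1 C[x].2 = p := (Finset.mem_filter.mp hx).2
    have : (fun l : Fin k => coef ρ q p t C[x].1 C[x].2 l)
        = ∑ y : Fin (k - (t + 1)), coef ρ q p t C[x].1 C[x].2 (t + 1 + y) •
          (Pi.single (⟨t + 1 + y, by omega⟩ : Fin k) (1 : F) : Fin k → F) := by
      funext l
      rw [Finset.sum_apply]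
      by_cases hl : (l : ℕ) ≤ t
      · rw [Finset.sum_eq_zero]
        · exact if_neg (by tauto)
        · intro y _
          rw [Pi.smul_apply, Pi.single_eq_of_ne, smul_zero]
          intro h; rw [h] at hl; simp at hl; omega
      · rw [Finset.sum_eq_single ⟨l - (t + 1), by omega⟩]
        · have : t + 1 + ((l : ℕ) - (t + 1)) = l := by omega
          have h2 : (⟨t + 1 + ((l : ℕ) - (t + 1)), by omega⟩ : Fin k) = l := Fin.ext this
          simp only [Pi.smul_apply, Pi.single_eq_same, this, smul_eq_mul, mul_one]
        · intro y _ hy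
          rw [Pi.smul_apply, Pi.single_eq_of_ne, smul_zero]
          intro h; apply hy; apply Fin.ext; have := congrArg Fin.val h; simp only at this ⊢; omega
        · simp
    rw [this]
    exact Submodule.sum_mem _ fun y _ =>
      Submodule.smul_mem _ _ (Submodule.subset_span ⟨y, rfl⟩)
  refine ⟨C, hC, hlen, ?_, fun c hc => by simpa [hc] using hcap c⟩
  have h1 := hcap p
  have h2 := List.length_eq_countP_add_countP (fun e : ℕ × ℕ => decide (q e.1 e.2 = p)) (l := C)
  simp only [if_true] at h1
  have h3 : C.countP (fun a => decide ¬ (decide (q a.1 a.2 = p) = true))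
      = C.countP (fun e => decide (¬ q e.1 e.2 = p)) := by simp
  omega

end Soundness

/-! ### Districts of a path -/

/-- The interval `{a, …, b}` of vertices of the path. -/
def vertexInterval (n a b : ℕ) : Finset (Fin n) :=
  Finset.univ.filter fun x => a ≤ (x : ℕ) ∧ (x : ℕ) ≤ b

theorem mem_vertexInterval {n a b : ℕ} {x : Fin n} :
    x ∈ vertexInterval n a b ↔ a ≤ (x : ℕ) ∧ (x : ℕ) ≤ b := by
  simp [vertexInterval]

theorem vertexInterval_left_mem {n a b : ℕ} (hab : a ≤ b) (hb : b < n) :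
    (⟨a, by omega⟩ : Fin n) ∈ vertexInterval n a b := by
  simp [mem_vertexInterval, hab]

theorem vertexInterval_right_mem {n a b : ℕ} (hab : a ≤ b) (hb : b < n) :
    (⟨b, hb⟩ : Fin n) ∈ vertexInterval n a b := by
  simp [mem_vertexInterval, hab]

theorem induce_vertexInterval_connected {n a b : ℕ} (hab : a ≤ b) (hb : b < n) :
    ((SimpleGraph.pathGraph n).induce (vertexInterval n a b : Set (Fin n))).Connected := by
  let r : (vertexInterval n a b : Set (Fin n)) :=
    ⟨⟨a, by omega⟩, by exact_mod_cast vertexInterval_left_mem hab hb⟩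
  have h : ∀ d, ∀ (x : Fin n) (hx : x ∈ (vertexInterval n a b : Set (Fin n))), (x : ℕ) = a + d →
      ((SimpleGraph.pathGraph n).induce (vertexInterval n a b : Set (Fin n))).Reachable r
        ⟨x, hx⟩ := by
    intro d
    induction d with
    | zero =>
      intro x hx h
      have : (⟨x, hx⟩ : (vertexInterval n a b : Set (Fin n))) = r :=
        Subtype.ext (Fin.ext (by simpa using h))
      rw [this]
    | succ d ih =>
      intro x hx h
      have hx' := mem_vertexInterval.mp (Finset.mem_coe.mp hx)
      have hy : (⟨a + d, by omega⟩ : Fin n) ∈ (vertexInterval n a b : Set (Fin n)) := by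
        rw [Finset.mem_coe, mem_vertexInterval]; simp only; omega
      refine (ih _ hy rfl).trans (SimpleGraph.Adj.reachable ?_)
      simp only [SimpleGraph.comap_adj, Function.Embedding.subtype_apply,
        SimpleGraph.pathGraph_adj]
      omega
  rw [SimpleGraph.connected_iff_exists_forall_reachable]
  refine ⟨r, fun ⟨x, hx⟩ => h (x - a) x hx ?_⟩
  have hx' := mem_vertexInterval.mp (Finset.mem_coe.mp hx)
  omega

theorem eq_vertexInterval_of_connected {n : ℕ} {U : Finset (Fin n)}
    (hU : ((SimpleGraph.pathGraph n).induce (U : Set (Fin n))).Connected) :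
    ∃ a b, a ≤ b ∧ b < n ∧ U = vertexInterval n a b := by
  obtain ⟨⟨z, hz⟩⟩ := hU.nonempty
  have hne : U.Nonempty := ⟨z, Finset.mem_coe.mp hz⟩
  refine ⟨U.min' hne, U.max' hne, Fin.le_def.mp (U.min'_le _ (U.max'_mem hne)), Fin.is_lt _, ?_⟩
  ext c
  rw [mem_vertexInterval]
  refine ⟨fun hc => ⟨Fin.le_def.mp (U.min'_le _ hc), Fin.le_def.mp (U.le_max' _ hc)⟩, fun hc => ?_⟩
  by_contra hcU
  have hr := hU.preconnected ⟨U.min' hne, U.min'_mem hne⟩ ⟨U.max' hne, U.max'_mem hne⟩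
  rw [SimpleGraph.reachable_iff_reflTransGen] at hr
  -- No edge of the path joins the two sides of the missing vertex `c`.
  have hlt : ∀ w, Relation.ReflTransGen
      ((SimpleGraph.pathGraph n).induce (U : Set (Fin n))).Adj ⟨U.min' hne, U.min'_mem hne⟩ w →
      (w : Fin n) < c := by
    intro w hw
    induction hw with
    | refl =>
      refine lt_of_le_of_ne (Fin.le_def.mpr hc.1) fun h => hcU ?_
      rw [← h]; exact U.min'_mem hne
    | @tail v w _ hadj ih =>
      have hwc : (w : Fin n) ≠ c := fun h => hcU (by rw [← h]; exact w.2)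
      simp only [SimpleGraph.comap_adj, Function.Embedding.subtype_apply,
        SimpleGraph.pathGraph_adj] at hadj
      have : ((w : Fin n) : ℕ) ≠ c := fun h => hwc (Fin.ext h)
      rw [Fin.lt_def] at ih ⊢
      omega
  have := Fin.lt_def.mp (hlt _ hr)
  simp only at this
  omega

namespace WGM

/-- The winner of the interval with end vertices `a` and `b`; `0` if they are not vertices. -/
def intervalWinner (I : WGM) (η : Finset (Fin I.n) → Fin I.m) (a b : ℕ) : ℕ :=
  if h : a < I.n ∧ b < I.n then η (Finset.uIcc ⟨a, h.1⟩ ⟨b, h.2⟩) else 0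

theorem intervalWinner_eq (I : WGM) (η : Finset (Fin I.n) → Fin I.m) {a b : ℕ} (hab : a ≤ b)
    (hb : b < I.n) : I.intervalWinner η a b = η (vertexInterval I.n a b) := by
  rw [intervalWinner, dif_pos ⟨by omega, hb⟩]
  congr 2
  ext x
  rw [Finset.uIcc_of_le (Fin.le_def.mpr hab), Finset.mem_Icc, mem_vertexInterval, Fin.le_def,
    Fin.le_def]

theorem intervalWinner_lt (I : WGM) (η : Finset (Fin I.n) → Fin I.m) (a b : ℕ) :
    I.intervalWinner η a b < I.m := by
  unfold intervalWinner
  split_ifs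
  · exact Fin.is_lt _
  · exact lt_of_le_of_lt (Nat.zero_le _) I.p.2

end WGM

namespace IsSegmentation

theorem le_and_lt {i : ℕ} {C : List (ℕ × ℕ)} (h : IsSegmentation i C) :
    ∀ e ∈ C, e.1 ≤ e.2 ∧ e.2 < i := by
  induction h with
  | nil => simp
  | cons _ hab ih =>
    intro e he
    rcases List.mem_cons.mp he with rfl | he
    · exact ⟨hab, by simp⟩
    · have := ih e he
      omega

theorem exists_mem {i : ℕ} {C : List (ℕ × ℕ)} (h : IsSegmentation i C) :
    ∀ x < i, ∃ e ∈ C, e.1 ≤ x ∧ x ≤ e.2 := by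
  induction h with
  | nil => simp
  | @cons a b C _ hab ih =>
    intro x hx
    by_cases hxa : x < a
    · obtain ⟨e, he, h⟩ := ih x hxa
      exact ⟨e, List.mem_cons_of_mem _ he, h⟩
    · exact ⟨(a, b), List.mem_cons_self, by simp only; omega⟩

theorem pairwise {i : ℕ} {C : List (ℕ × ℕ)} (h : IsSegmentation i C) :
    C.Pairwise fun e e' => e'.2 < e.1 := by
  induction h with
  | nil => simp
  | cons hC _ ih => exact List.pairwise_cons.mpr ⟨fun e he => (hC.le_and_lt e he).2, ih⟩

end IsSegmentation

/-- A segmentation with the right numbers of intervals won by each candidate proves a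
yes-instance. -/
theorem WGM.isYes_of_segmentation (I : WGM) (η : Finset (Fin I.n) → Fin I.m)
    (hG : I.G = SimpleGraph.pathGraph I.n) {C : List (ℕ × ℕ)} {t : ℕ}
    (hC : IsSegmentation I.n C) (hlen : C.length = I.k)
    (hp : C.countP (fun e => decide (I.intervalWinner η e.1 e.2 = I.p)) = t + 1)
    (hother : ∀ c ≠ (I.p : ℕ), C.countP (fun e => decide (I.intervalWinner η e.1 e.2 = c)) ≤ t) :
    I.IsYes η := by
  let f : ℕ × ℕ → Finset (Fin I.n) := fun e => vertexInterval I.n e.1 e.2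
  have hnodup : (C.map f).Nodup := by
    rw [List.Nodup, List.pairwise_map]
    refine hC.pairwise.imp_of_mem fun {e e'} he he' h heq => ?_
    have h1 := hC.le_and_lt e he
    have h2 := vertexInterval_left_mem h1.1 h1.2
    have h3 := (Finset.ext_iff.mp heq _).mp h2
    have := mem_vertexInterval.mp h3
    simp only at this
    omega
  have huniq : ∀ e ∈ C, ∀ e' ∈ C, ∀ x, (e.1 ≤ x ∧ x ≤ e.2) → (e'.1 ≤ x ∧ x ≤ e'.2) → e = e' := by
    intro e he e' he' x hx hx'
    by_contra hne
    have := hC.pairwise.imp (S := fun e e' : ℕ × ℕ => e'.2 < e.1 ∨ e.2 < e'.1)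
      (fun h => Or.inl h)
    have hsymm : Std.Symm fun e e' : ℕ × ℕ => e'.2 < e.1 ∨ e.2 < e'.1 := ⟨fun _ _ h => h.symm⟩
    have := this.forall he he' hne
    omega
  let P : Finpartition (Finset.univ : Finset (Fin I.n)) :=
    Finpartition.ofExistsUnique (C.map f).toFinset (fun _ _ => Finset.subset_univ _)
      (by
        intro x _
        obtain ⟨e, he, hx⟩ := hC.exists_mem x x.2
        refine ⟨f e, ⟨by simpa using ⟨e.1, e.2, he, rfl⟩, mem_vertexInterval.mpr hx⟩, ?_⟩
        rintro _ ⟨hU, hxU⟩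
        rw [List.mem_toFinset] at hU
        obtain ⟨e', he', rfl⟩ := List.mem_map.mp hU
        rw [huniq e he e' he' x hx (mem_vertexInterval.mp hxU)])
      (by
        intro h
        rw [List.mem_toFinset] at h
        obtain ⟨e, he, h⟩ := List.mem_map.mp h
        have h1 := hC.le_and_lt e he
        have h2 := vertexInterval_left_mem h1.1 h1.2
        rw [show vertexInterval I.n e.1 e.2 = ∅ from h] at h2
        simp at h2)
  have hparts : P.parts = (C.map f).toFinset := rfl
  have hwins : ∀ c : Fin I.m, I.wins η P c
      = C.countP (fun e => decide (I.intervalWinner η e.1 e.2 = c)) := by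
    intro c
    have : (P.parts.filter fun U => η U = c) = ((C.map f).filter fun U => η U = c).toFinset := by
      rw [hparts]; ext; simp
    rw [wins, this, List.toFinset_card_of_nodup (hnodup.filter _), ← List.countP_eq_length_filter,
      List.countP_map]
    refine List.countP_congr fun e he => ?_
    have h1 := hC.le_and_lt e he
    simp only [Function.comp_apply, decide_eq_true_eq, I.intervalWinner_eq η h1.1 h1.2, f,
      Fin.ext_iff]
  refine ⟨P, ?_, ?_, ?_⟩
  · rw [hparts, List.toFinset_card_of_nodup hnodup, List.length_map, hlen]
  · intro U hU
    rw [hparts, List.mem_toFinset] at hU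
    obtain ⟨e, he, rfl⟩ := List.mem_map.mp hU
    have h1 := hC.le_and_lt e he
    rw [IsDistrict, hG]
    exact induce_vertexInterval_connected h1.1 h1.2
  · intro c hc
    rw [hwins, hwins, hp]
    have := hother c (fun h => hc (Fin.ext h))
    omega

/-! ### A good partition makes the top coefficient nonzero -/

theorem exists_injOn_lt_card {α : Type*} (s : Finset α) :
    ∃ f : α → ℕ, Set.InjOn f s ∧ ∀ a ∈ s, f a < s.card := by
  classical
  refine ⟨fun a => if h : a ∈ s then s.equivFin ⟨a, h⟩ else 0, ?_, ?_⟩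
  · intro a ha b hb hab
    rw [Finset.mem_coe] at ha hb
    simp only [ha, hb, dif_pos] at hab
    exact congrArg Subtype.val (s.equivFin.injective (Fin.ext hab))
  · intro a ha
    simp [ha]

/-- If the vector of each part is the basis vector of its label, and the vectors of all other
intervals vanish, then the only term of the dynamic program is that of the partition. -/
theorem dp_ne_zero_of_partition {F : Type*} [Field F] {n k : ℕ}
    (P : Finpartition (Finset.univ : Finset (Fin n)))
    (hP : ∀ U ∈ P.parts, ∃ a b, a ≤ b ∧ b < n ∧ U = vertexInterval n a b)
    (lab : Finset (Fin n) → ℕ) (hinj : Set.InjOn lab P.parts) (hlab : ∀ U ∈ P.parts, lab U < k)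
    (hk : P.parts.card = k) (u : ℕ → ℕ → ℕ → F)
    (hu : ∀ a b, a ≤ b → b < n → vertexInterval n a b ∈ P.parts → ∀ l < k,
      u a b l = if l = lab (vertexInterval n a b) then 1 else 0)
    (hu0 : ∀ a b, vertexInterval n a b ∉ P.parts → ∀ l < k, u a b l = 0) :
    dp u k n (2 ^ k - 1) ≠ 0 := by
  -- At a position `i` between two parts, the only nonzero coefficient is that of the set of labels
  -- of the parts before `i`.
  have key : ∀ i ≤ n, (∀ U ∈ P.parts, (∀ x ∈ U, (x : ℕ) < i) ∨ (∀ x ∈ U, i ≤ (x : ℕ))) → ∀ S,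
      dp u k i S ≠ 0 ↔
        ∀ l, S.testBit l = true ↔ ∃ U ∈ P.parts, (∀ x ∈ U, (x : ℕ) < i) ∧ lab U = l := by
    intro i
    induction i using Nat.strong_induction_on with
    | _ i ih =>
      intro hin hbreak S
      cases i with
      | zero =>
        have hno : ∀ l, ¬ ∃ U ∈ P.parts, (∀ x ∈ U, (x : ℕ) < 0) ∧ lab U = l := by
          rintro l ⟨U, hU, h, _⟩
          obtain ⟨x, hx⟩ := P.nonempty_of_mem_parts hU
          exact absurd (h x hx) (by omega)
        simp only [hno, iff_false, dp_zero]
        constructor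
        · intro h l
          have : S = 0 := by by_contra h0; simp [h0] at h
          simp [this]
        · intro h
          have : S = 0 := Nat.zero_of_testBit_eq_false fun l => by simpa using h l
          simp [this]
      | succ i =>
        -- The part of the vertex `i` ends there, and gives the only nonzero term of the sum.
        have hmem : (⟨i, by omega⟩ : Fin n) ∈ P.part ⟨i, by omega⟩ :=
          P.mem_part (Finset.mem_univ _)
        have hUp : P.part (⟨i, by omega⟩ : Fin n) ∈ P.parts :=
          P.part_mem.mpr (Finset.mem_univ _)
        obtain ⟨a, b, hab, hbn, hUab⟩ := hP _ hUp
        rw [hUab] at hmem hUp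
        have hai := (mem_vertexInterval.mp hmem)
        simp only at hai
        have hbi : b = i := by
          rcases hbreak _ hUp with h | h
          · have := h _ (vertexInterval_right_mem hab hbn)
            simp only at this
            omega
          · have := h _ hmem
            simp only at this
            omega
        subst hbi
        have huniq : ∀ W ∈ P.parts, ∀ x, x ∈ W → x ∈ vertexInterval n a b →
            W = vertexInterval n a b := fun W hW x hxW hx => P.eq_of_mem_parts hW hUp hxW hx
        have hsplit : ∀ W ∈ P.parts, W ≠ vertexInterval n a b →
            (∀ x ∈ W, (x : ℕ) < a) ∨ (∀ x ∈ W, b + 1 ≤ (x : ℕ)) := by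
          intro W hW hne
          rcases hbreak W hW with h | h
          · left
            intro x hx
            by_contra hc
            refine hne (huniq W hW x hx (mem_vertexInterval.mpr ?_))
            have := h x hx
            omega
          · exact Or.inr h
        rw [dp_succ, Finset.sum_eq_single a]
        · rw [wedge_single_ne_zero (hlab _ hUp) (hu a b hab hbn hUp), ih a (by omega) (by omega)]
          · have hset : ∀ W ∈ P.parts, (∀ x ∈ W, (x : ℕ) < b + 1) ↔
                W = vertexInterval n a b ∨ ∀ x ∈ W, (x : ℕ) < a := by
              intro W hW
              constructor
              · intro h
                by_contra! hc
                rcases hsplit W hW hc.1 with h' | h'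
                · obtain ⟨x, hx, hx'⟩ := hc.2
                  have := h' x hx
                  omega
                · obtain ⟨x, hx⟩ := P.nonempty_of_mem_parts hW
                  have := h x hx
                  have := h' x hx
                  omega
              · rintro (rfl | h) x hx
                · have := mem_vertexInterval.mp hx
                  omega
                · have := h x hx
                  omega
            have hUa : ¬ ∀ x ∈ vertexInterval n a b, (x : ℕ) < a := by
              intro h
              have := h _ hmem
              simp only at this
              omega
            constructor
            · rintro ⟨hb, h⟩ l
              have hl := h l
              rw [testBit_sub_two_pow hb] at hl
              by_cases hll : l = lab (vertexInterval n a b)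
              · subst hll
                exact ⟨fun _ => ⟨_, hUp, (hset _ hUp).mpr (Or.inl rfl), rfl⟩, fun _ => hb⟩
              · simp only [hll, ne_eq, not_false_eq_true, decide_true, Bool.and_true] at hl
                rw [hl]
                constructor
                · rintro ⟨W, hW, h, rfl⟩
                  exact ⟨W, hW, (hset W hW).mpr (Or.inr h), rfl⟩
                · rintro ⟨W, hW, h, rfl⟩
                  rcases (hset W hW).mp h with rfl | h
                  · exact absurd rfl hll
                  · exact ⟨W, hW, h, rfl⟩
            · intro h
              have hb : S.testBit (lab (vertexInterval n a b)) = true :=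
                (h _).mpr ⟨_, hUp, (hset _ hUp).mpr (Or.inl rfl), rfl⟩
              refine ⟨hb, fun l => ?_⟩
              rw [testBit_sub_two_pow hb, Bool.and_eq_true, h l, decide_eq_true_eq]
              constructor
              · rintro ⟨⟨W, hW, h, rfl⟩, hne⟩
                rcases (hset W hW).mp h with rfl | h
                · exact absurd rfl hne
                · exact ⟨W, hW, h, rfl⟩
              · rintro ⟨W, hW, h, rfl⟩
                refine ⟨⟨W, hW, (hset W hW).mpr (Or.inr h), rfl⟩, fun heq => ?_⟩
                rw [hinj hW hUp heq] at h
                exact hUa h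
          · intro W hW
            by_cases hWU : W = vertexInterval n a b
            · right
              intro x hx
              rw [hWU] at hx
              exact (mem_vertexInterval.mp hx).1
            · rcases hsplit W hW hWU with h | h
              · exact Or.inl h
              · exact Or.inr fun x hx => by have := h x hx; omega
        · intro j hj hja
          refine wedge_zero_left (hu0 j b fun hmem' => hja ?_) _ _
          have hj' := Finset.mem_range.mp hj
          have h1 := huniq _ hmem' _ (vertexInterval_right_mem (by omega) hbn) hmem
          have h2 := vertexInterval_left_mem (n := n) (a := j) (b := b) (by omega) hbn
          have h3 := vertexInterval_left_mem hab hbn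
          rw [h1] at h2
          rw [← h1] at h3
          have h2 := (mem_vertexInterval.mp h2).1
          have h3 := (mem_vertexInterval.mp h3).1
          simp only at h2 h3
          omega
        · intro h
          exact absurd (Finset.mem_range.mpr (by omega)) h
  rw [key n le_rfl fun U _ => Or.inl fun x _ => x.2]
  intro l
  have himage : P.parts.image lab = Finset.range k := by
    apply Finset.eq_of_subset_of_card_le
    · intro l hl
      obtain ⟨U, hU, rfl⟩ := Finset.mem_image.mp hl
      exact Finset.mem_range.mpr (hlab U hU)
    · rw [Finset.card_image_of_injOn hinj, hk, Finset.card_range]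
  rw [Nat.testBit_two_pow_sub_one, decide_eq_true_eq, ← Finset.mem_range, ← himage,
    Finset.mem_image]
  exact ⟨fun ⟨U, hU, h⟩ => ⟨U, hU, fun x _ => x.2, h⟩, fun ⟨U, hU, _, h⟩ => ⟨U, hU, h⟩⟩

/-- Completeness of the algebraic test: for a yes-instance, some values of the variables make the
top coefficient nonzero. -/
theorem WGM.exists_dp_ne_zero (F : Type*) [Field F] (I : WGM) (η : Finset (Fin I.n) → Fin I.m)
    (hG : I.G = SimpleGraph.pathGraph I.n) (h : I.IsYes η) :
    ∃ t < I.k, ∃ ρ : ℕ → ℕ → ℕ → ℕ → F,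
      dp (coef ρ (I.intervalWinner η) I.p t) I.k I.n (2 ^ I.k - 1) ≠ 0 := by
  classical
  obtain ⟨P, hk, hdist, hwins⟩ := h
  have hP : ∀ U ∈ P.parts, ∃ a b, a ≤ b ∧ b < I.n ∧ U = vertexInterval I.n a b := by
    intro U hU
    have := hdist U hU
    rw [IsDistrict, hG] at this
    exact eq_vertexInterval_of_connected this
  have hpos : 0 < I.wins η P I.p := by
    obtain ⟨U, hU⟩ := Finset.card_pos.mp (hk ▸ I.k_pos)
    by_cases hUp : η U = I.p
    · exact Finset.card_pos.mpr ⟨U, Finset.mem_filter.mpr ⟨hU, hUp⟩⟩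
    · exact lt_of_le_of_lt (Nat.zero_le _) (hwins _ hUp)
  -- `f c` numbers the districts won by `c`, and `g` numbers those not won by `p`. The labels
  -- `0, …, t` go to the districts won by `p`, and `t + 1, …, k - 1` to the others.
  choose f hf hflt using fun c => exists_injOn_lt_card (P.parts.filter fun U => η U = c)
  obtain ⟨g, hg, hglt⟩ := exists_injOn_lt_card (P.parts.filter fun U => ¬ η U = I.p)
  have hsum := Finset.card_filter_add_card_filter_not (s := P.parts) (fun U => η U = I.p)
  set t := I.wins η P I.p - 1 with ht
  have ht1 : (P.parts.filter fun U => η U = I.p).card = t + 1 := by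
    have : (P.parts.filter fun U => η U = I.p).card = I.wins η P I.p := rfl
    omega
  let lab : Finset (Fin I.n) → ℕ := fun U => if η U = I.p then f I.p U else t + 1 + g U
  have hlab_iff : ∀ U ∈ P.parts, lab U ≤ t ↔ η U = I.p := by
    intro U hU
    by_cases hUp : η U = I.p
    · have := hflt I.p U (Finset.mem_filter.mpr ⟨hU, hUp⟩)
      simp only [lab, hUp, if_true, iff_true]
      omega
    · simp only [lab, hUp, if_false, iff_false]
      omega
  have hlab : ∀ U ∈ P.parts, lab U < I.k := by
    intro U hU
    by_cases hUp : η U = I.p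
    · have := hflt I.p U (Finset.mem_filter.mpr ⟨hU, hUp⟩)
      simp only [lab, hUp, if_true]
      omega
    · have := hglt U (Finset.mem_filter.mpr ⟨hU, hUp⟩)
      simp only [lab, hUp, if_false]
      omega
  have hinj : Set.InjOn lab P.parts := by
    intro U hU W hW hUW
    have h1 := hlab_iff U hU
    have h2 := hlab_iff W hW
    rw [hUW] at h1
    by_cases hUp : η U = I.p
    · have hWp := h2.mp (h1.mpr hUp)
      simp only [lab, hUp, hWp, if_true] at hUW
      exact hf I.p (by simpa using ⟨hU, hUp⟩) (by simpa using ⟨hW, hWp⟩) hUW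
    · have hWp : ¬ η W = I.p := fun h => hUp (h1.mp (h2.mpr h))
      simp only [lab, hUp, hWp, if_false] at hUW
      exact hg (by simpa using ⟨hU, hUp⟩) (by simpa using ⟨hW, hWp⟩) (by omega)
  -- The vectors that belong to `c` are the basis vectors of the labels of the districts won by `c`;
  -- each district selects its own one, and all other intervals select nothing.
  refine ⟨t, by have := hsum; omega, fun y a b c => if y = 0 then
    (if vertexInterval I.n a b ∈ P.parts ∧
      c = f (η (vertexInterval I.n a b)) (vertexInterval I.n a b) then 1 else 0)
    else if ∃ U ∈ P.parts, (η U : ℕ) = a ∧ f (η U) U = b ∧ lab U = c then 1 else 0, ?_⟩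
  refine dp_ne_zero_of_partition P hP lab hinj hlab hk _ ?_ ?_
  · intro a b hab hb hU l hl
    rw [coef, I.intervalWinner_eq η hab hb]
    set U := vertexInterval I.n a b with hUdef
    have hlt : f (η U) U < t + if (η U : ℕ) = I.p then 1 else 0 := by
      have h1 := hflt (η U) U (Finset.mem_filter.mpr ⟨hU, rfl⟩)
      by_cases hUp : η U = I.p
      · rw [hUp, if_pos rfl]
        rw [hUp] at h1
        omega
      · have h2 := hwins _ hUp
        have h3 : (P.parts.filter fun W => η W = η U).card = I.wins η P (η U) := rfl
        omega
    have hex : (∃ W ∈ P.parts, (η W : ℕ) = η U ∧ f (η W) W = f (η U) U ∧ lab W = l)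
        ↔ l = lab U := by
      constructor
      · rintro ⟨W, hW, h1, h2, rfl⟩
        have h1 := Fin.ext h1
        rw [h1] at h2
        rw [hf (η U) (by simpa using ⟨hW, h1⟩) (by simpa using hU) h2]
      · rintro rfl
        exact ⟨U, hU, rfl, rfl, rfl⟩
    have hflag : l = lab U → (l ≤ t ↔ (η U : ℕ) = I.p) := by
      rintro rfl
      rw [hlab_iff U hU, Fin.ext_iff]
    by_cases hl' : l = lab U
    · rw [if_pos (hflag hl'), if_pos hl', Finset.sum_eq_single (f (η U) U)]
      · simp [hU, hex.mpr hl']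
      · intro x _ hx
        simp [hx]
      · intro h
        exact absurd (Finset.mem_range.mpr hlt) h
    · rw [if_neg hl']
      by_cases hfl : l ≤ t ↔ (η U : ℕ) = I.p
      · rw [if_pos hfl]
        refine Finset.sum_eq_zero fun x _ => ?_
        rw [if_pos rfl, if_neg one_ne_zero]
        by_cases hx : x = f (η U) U
        · rw [hx, if_neg (mt hex.mp hl'), mul_zero]
        · rw [if_neg (fun h => hx h.2), zero_mul]
      · rw [if_neg hfl]
  · intro a b hU l _
    rw [coef]
    simp [hU]

/-! ### Random values of the variables -/

section Polynomial

/-- The value of the variable `ρ y a b c` is stored at the address with the digits `y, a, b, c` in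
base `N`. -/
def digitAddr (N y a b c : ℕ) : ℕ := ((y * N + a) * N + b) * N + c

theorem digitAddr_lt {N y a b c : ℕ} (hy : y < 2) (ha : a < N) (hb : b < N) (hc : c < N) :
    digitAddr N y a b c < 2 * N ^ 3 := by
  have h1 : y * N + a + 1 ≤ 2 * N := by nlinarith
  have h2 : (y * N + a) * N + b + 1 ≤ 2 * N * N := by nlinarith
  have h3 : ((y * N + a) * N + b) * N + c + 1 ≤ 2 * N * N * N := by nlinarith
  have : 2 * N ^ 3 = 2 * N * N * N := by ring
  unfold digitAddr
  omega

theorem digitAddr_div_mod {N a b c : ℕ} (y : ℕ) (ha : a < N) (hb : b < N) (hc : c < N) :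
    digitAddr N y a b c / N / N / N = y ∧ digitAddr N y a b c / N / N % N = a ∧
      digitAddr N y a b c / N % N = b ∧ digitAddr N y a b c % N = c := by
  have hN : 0 < N := by omega
  have key : ∀ d e, e < N → (d * N + e) / N = d ∧ (d * N + e) % N = e := fun d e he => by
    rw [Nat.add_comm, Nat.add_mul_div_right _ _ hN, Nat.add_mul_mod_self_right,
      Nat.div_eq_of_lt he, Nat.mod_eq_of_lt he]
    simp
  unfold digitAddr
  rw [(key _ c hc).1, (key _ c hc).2, (key _ b hb).1, (key _ b hb).2, (key _ a ha).1,
    (key _ a ha).2]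
  simp

variable {R : Type*} [CommRing R]

theorem dp_congr {u u' : ℕ → ℕ → ℕ → R} {k n : ℕ}
    (h : ∀ a b, a ≤ b → b < n → ∀ l < k, u a b l = u' a b l) (i : ℕ) (hi : i ≤ n) (S : ℕ) :
    dp u k i S = dp u' k i S := by
  induction i using Nat.strong_induction_on generalizing S with
  | _ i ih =>
    cases i with
    | zero => simp [dp_zero]
    | succ i =>
      rw [dp_succ, dp_succ]
      refine Finset.sum_congr rfl fun j hj => ?_
      have hj' := Finset.mem_range.mp hj
      exact wedge_congr (fun l hl => h j i (by omega) (by omega) l hl)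
        fun l _ _ => ih j hj' (by omega) _

theorem coef_congr {ρ ρ' : ℕ → ℕ → ℕ → ℕ → R} {q : ℕ → ℕ → ℕ} {p t a b l N : ℕ}
    (h : ∀ y < 2, ∀ a < N, ∀ b < N, ∀ c < N, ρ y a b c = ρ' y a b c) (ht : t < N) (ha : a < N)
    (hb : b < N) (hl : l < N) (hq : q a b < N) : coef ρ q p t a b l = coef ρ' q p t a b l := by
  unfold coef
  split_ifs with h1 h2
  all_goals
    try rfl
    try
      refine Finset.sum_congr rfl fun x hx => ?_
      have hx' := Finset.mem_range.mp hx
      rw [h 0 (by omega) a ha b hb x (by omega), h 1 (by omega) _ hq x (by omega) l hl]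

theorem totalDegree_wedge_le {σ : Type*} {u A : ℕ → MvPolynomial σ R} {L d e : ℕ}
    (hu : ∀ l, (u l).totalDegree ≤ d) (hA : ∀ S, (A S).totalDegree ≤ e) (S : ℕ) :
    (wedge u A L S).totalDegree ≤ d + e := by
  induction L with
  | zero => simp [wedge]
  | succ L ih =>
    rw [wedge]
    split_ifs
    · refine (MvPolynomial.totalDegree_sub _ _).trans (max_le ?_ ih)
      exact (MvPolynomial.totalDegree_mul _ _).trans (Nat.add_le_add (hu _) (hA _))
    · exact ih

theorem totalDegree_dp_le {σ : Type*} {u : ℕ → ℕ → ℕ → MvPolynomial σ R} {d : ℕ} (k : ℕ)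
    (hu : ∀ a b l, (u a b l).totalDegree ≤ d) (i S : ℕ) :
    (dp u k i S).totalDegree ≤ d * i := by
  induction i using Nat.strong_induction_on generalizing S with
  | _ i ih =>
    cases i with
    | zero =>
      rw [dp_zero]
      split_ifs <;> simp
    | succ i =>
      rw [dp_succ]
      refine MvPolynomial.totalDegree_finsetSum_le fun j hj => ?_
      have hj' := Finset.mem_range.mp hj
      refine (totalDegree_wedge_le (hu j i) (ih j hj') S).trans ?_
      have : d * j ≤ d * i := Nat.mul_le_mul_left _ (by omega)
      rw [Nat.mul_succ]
      omega

theorem totalDegree_coef_le {σ : Type*} {ρ : ℕ → ℕ → ℕ → ℕ → MvPolynomial σ R}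
    (hρ : ∀ y a b c, (ρ y a b c).totalDegree ≤ 1) (q : ℕ → ℕ → ℕ) (p t a b l : ℕ) :
    (coef ρ q p t a b l).totalDegree ≤ 2 := by
  rw [coef]
  split_ifs
  · exact MvPolynomial.totalDegree_finsetSum_le fun x _ =>
      (MvPolynomial.totalDegree_mul _ _).trans (Nat.add_le_add (hρ _ _ _ _) (hρ _ _ _ _))
  · exact MvPolynomial.totalDegree_finsetSum_le fun x _ =>
      (MvPolynomial.totalDegree_mul _ _).trans (Nat.add_le_add (hρ _ _ _ _) (hρ _ _ _ _))
  · simp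

/-- The test value for `p` winning `t + 1` intervals, where the variables have the values `f`. -/
def testValue (q : ℕ → ℕ → ℕ) (p k n N t : ℕ) (f : ℕ → R) : R :=
  dp (coef (fun y a b c => f (digitAddr N y a b c)) q p t) k n (2 ^ k - 1)

theorem map_testValue {R' : Type*} [CommRing R'] (φ : R →+* R') (q : ℕ → ℕ → ℕ)
    (p k n N t : ℕ) (f : ℕ → R) :
    φ (testValue q p k n N t f) = testValue q p k n N t fun x => φ (f x) := by
  rw [testValue, map_dp]
  simp only [map_coef]
  rfl

/-- If some values of the variables in `ZMod r` make the test value nonzero, then it vanishes for at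
most a third of the values in `{0, …, Q - 1}`. -/
theorem three_mul_card_testValue_eq_zero_le {r : ℕ} [Fact r.Prime] {q : ℕ → ℕ → ℕ}
    {p k n N t Q : ℕ} (hQr : Q ≤ r) (hQ : 6 * n ≤ Q) (hQ0 : 0 < Q) (hn : n ≤ N) (hk : k ≤ N)
    (ht : t < k) (hq : ∀ a b, q a b < N) {ρ : ℕ → ℕ → ℕ → ℕ → ZMod r}
    (hρ : dp (coef ρ q p t) k n (2 ^ k - 1) ≠ 0) :
    3 * (Finset.univ.filter fun f : Fin (2 * N ^ 3) → Fin Q =>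
      testValue q p k n N t
        (fun x => if h : x < 2 * N ^ 3 then ((f ⟨x, h⟩ : ℕ) : ZMod r) else 0) = 0).card
      ≤ Q ^ (2 * N ^ 3) := by
  classical
  set V := 2 * N ^ 3 with hV
  -- The test value as a polynomial of degree at most `2 * n`; the lemma of Schwartz and Zippel
  -- bounds the proportion of its zeros by `2 * n / Q ≤ 1 / 3`.
  let P : MvPolynomial (Fin V) (ZMod r) :=
    testValue q p k n N t fun x => if h : x < V then MvPolynomial.X ⟨x, h⟩ else 0
  have heval : ∀ g : Fin V → ZMod r, MvPolynomial.eval g P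
      = testValue q p k n N t fun x => if h : x < V then g ⟨x, h⟩ else 0 := by
    intro g
    simp only [P]
    rw [map_testValue]
    congr 1
    funext x
    split_ifs <;> simp
  have hP0 : P ≠ 0 := by
    intro h0
    have h := heval fun x => ρ (x / N / N / N) (x / N / N % N) (x / N % N) (x % N)
    rw [h0, map_zero, testValue] at h
    apply hρ
    rw [h]
    refine dp_congr (fun a b hab hb l hl => ?_) n le_rfl _
    refine coef_congr (N := N) (fun y hy a ha b hb c hc => ?_) (by omega) (by omega) (by omega)
      (by omega) (hq a b)
    have hd := digitAddr_div_mod y ha hb hc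
    rw [dif_pos (digitAddr_lt hy ha hb hc)]
    simp only [hd]
  have hdeg : P.totalDegree ≤ 2 * n := by
    refine totalDegree_dp_le k (fun a b l => totalDegree_coef_le (fun y a b c => ?_) _ _ _ _ _ _)
      n _
    dsimp only
    split_ifs
    · simp [MvPolynomial.totalDegree_X]
    · simp
  have hinj : Function.Injective fun x : Fin Q => ((x : ℕ) : ZMod r) := by
    intro x y hxy
    have := (ZMod.natCast_eq_natCast_iff _ _ _).mp hxy
    rw [Nat.ModEq, Nat.mod_eq_of_lt (by omega), Nat.mod_eq_of_lt (by omega)] at this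
    exact Fin.ext this
  let T : Finset (ZMod r) := Finset.univ.image fun x : Fin Q => ((x : ℕ) : ZMod r)
  have hT : T.card = Q := by
    rw [Finset.card_image_of_injective _ hinj, Finset.card_univ, Fintype.card_fin]
  have hsz := MvPolynomial.schwartz_zippel_totalDegree hP0 T
  rw [hT] at hsz
  have hle : (Finset.univ.filter fun f : Fin V → Fin Q => testValue q p k n N t
        (fun x => if h : x < V then ((f ⟨x, h⟩ : ℕ) : ZMod r) else 0) = 0).card
      ≤ ((Fintype.piFinset fun _ : Fin V => T).filter fun g => MvPolynomial.eval g P = 0).card := by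
    refine Finset.card_le_card_of_injOn (fun f x => ((f x : ℕ) : ZMod r)) ?_ ?_
    · intro f hf
      simp only [Finset.coe_filter, Finset.mem_univ, true_and, Set.mem_ofPred_eq] at hf
      simp only [Finset.coe_filter, Fintype.mem_piFinset, Set.mem_ofPred_eq]
      exact ⟨fun x => Finset.mem_image_of_mem _ (Finset.mem_univ _), by rw [heval]; exact hf⟩
    · intro f _ g _ hfg
      funext x
      exact hinj (congrFun hfg x)
  have hQ' : (0 : ℚ≥0) < Q := by exact_mod_cast hQ0
  rw [div_le_div_iff₀ (by positivity) hQ'] at hsz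
  have hsz' : ((Fintype.piFinset fun _ : Fin V => T).filter fun g =>
      MvPolynomial.eval g P = 0).card * Q ≤ P.totalDegree * Q ^ V := by exact_mod_cast hsz
  set A := ((Fintype.piFinset fun _ : Fin V => T).filter fun g =>
      MvPolynomial.eval g P = 0).card
  have h1 : (3 * A) * Q ≤ Q ^ V * Q := by
    calc (3 * A) * Q = 3 * (A * Q) := by ring
      _ ≤ 3 * (P.totalDegree * Q ^ V) := by gcongr
      _ = (3 * P.totalDegree) * Q ^ V := by ring
      _ ≤ Q * Q ^ V := by gcongr; omega
      _ = Q ^ V * Q := by ring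
  have h2 := Nat.le_of_mul_le_mul_right h1 hQ0
  omega

end Polynomial

section Coins

/-- The number with the `s` binary digits `ω i, …, ω (i + s - 1)`, the most significant one
first. -/
def bitsValue (ω : ℕ → Bool) (i : ℕ) : ℕ → ℕ
  | 0 => 0
  | s + 1 => 2 * bitsValue ω i s + (ω (i + s)).toNat

theorem bitsValue_lt (ω : ℕ → Bool) (i s : ℕ) : bitsValue ω i s < 2 ^ s := by
  induction s with
  | zero => simp [bitsValue]
  | succ s ih =>
    have := Bool.toNat_le (ω (i + s))
    rw [bitsValue, pow_succ]
    omega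

theorem eq_of_bitsValue_eq {ω ω' : ℕ → Bool} {i s : ℕ}
    (h : bitsValue ω i s = bitsValue ω' i s) : ∀ b < s, ω (i + b) = ω' (i + b) := by
  induction s with
  | zero => simp
  | succ s ih =>
    have h1 := Bool.toNat_le (ω (i + s))
    have h2 := Bool.toNat_le (ω' (i + s))
    rw [bitsValue, bitsValue] at h
    intro b hb
    rcases Nat.lt_succ_iff_lt_or_eq.mp hb with hb | rfl
    · exact ih (by omega) b hb
    · cases h3 : ω (i + b) <;> cases h4 : ω' (i + b) <;> simp_all <;> omega

/-- The `V` random numbers below `2 ^ s` obtained from consecutive blocks of `s` random bits. -/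
def randomNumbers (V s : ℕ) (ω : ℕ → Bool) (x : Fin V) : Fin (2 ^ s) :=
  ⟨bitsValue ω (x * s) s, bitsValue_lt _ _ _⟩

theorem coins_randomNumbers_eq_le (V s : ℕ) (f : Fin V → Fin (2 ^ s)) :
    RAM.coins {ω | randomNumbers V s ω = f} ≤ ((2 : ENNReal) ^ (V * s))⁻¹ := by
  by_cases hne : ∃ ω₀, randomNumbers V s ω₀ = f
  · obtain ⟨ω₀, rfl⟩ := hne
    have hsub : {ω | randomNumbers V s ω = randomNumbers V s ω₀}
        ⊆ Set.pi (Finset.range (V * s) : Set ℕ) fun i => {ω₀ i} := by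
      intro ω hω i hi
      have hi' : i < V * s := by simpa using hi
      have hs : 0 < s := Nat.pos_of_ne_zero (by rintro rfl; simp at hi')
      have hx : i / s < V := Nat.div_lt_of_lt_mul (by rwa [Nat.mul_comm])
      have h1 := congrArg Fin.val (congrFun hω ⟨i / s, hx⟩)
      have h2 := eq_of_bitsValue_eq h1 (i % s) (Nat.mod_lt _ hs)
      simp only [Nat.mul_comm (i / s) s, Nat.div_add_mod] at h2
      exact h2
    refine (MeasureTheory.measure_mono hsub).trans ?_
    rw [RAM.coins, MeasureTheory.Measure.infinitePi_pi]
    · simp only [PMF.toMeasure_apply_singleton _ _ (MeasurableSet.singleton _),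
        PMF.uniformOfFintype_apply, Fintype.card_bool, Finset.prod_const, Finset.card_range]
      rw [ENNReal.inv_pow]
      rfl
    · intro i _
      exact MeasurableSet.singleton _
  · have : {ω | randomNumbers V s ω = f} = ∅ := by
      ext ω
      simpa using fun h => hne ⟨ω, h⟩
    simp [this]

theorem coins_randomNumbers_mem_le {V s : ℕ} (A : Finset (Fin V → Fin (2 ^ s)))
    (hA : 3 * A.card ≤ (2 ^ s) ^ V) : RAM.coins {ω | randomNumbers V s ω ∈ A} ≤ 1 / 3 := by
  have hU : {ω | randomNumbers V s ω ∈ A} = ⋃ f ∈ A, {ω | randomNumbers V s ω = f} := by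
    ext ω; simp
  rw [hU]
  refine (MeasureTheory.measure_biUnion_finset_le A _).trans ?_
  refine (Finset.sum_le_sum fun f _ => coins_randomNumbers_eq_le V s f).trans ?_
  rw [Finset.sum_const, nsmul_eq_mul, ← div_eq_mul_inv]
  have h : (3 : ENNReal) * A.card ≤ 2 ^ (V * s) := by
    rw [← pow_mul, Nat.mul_comm s V] at hA
    exact_mod_cast hA
  refine ENNReal.div_le_of_le_mul ?_
  calc (A.card : ENNReal) = 3⁻¹ * (3 * A.card) := by
        rw [← mul_assoc, ENNReal.inv_mul_cancel (by simp) (by simp), one_mul]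
    _ ≤ 1 / 3 * 2 ^ (V * s) := by rw [one_div]; gcongr

end Coins

/-! ### A structured programming language -/

/-- Arithmetic operations of the machine. -/
inductive Op
  | add
  | sub
  | mul
  | div

namespace Op

/-- The value of an operation. -/
def eval : Op → ℕ → ℕ → ℕ
  | add, a, b => a + b
  | sub, a, b => a - b
  | mul, a, b => a * b
  | div, a, b => a / b

/-- The machine instruction of an operation. -/
def instr : Op → ℕ → ℕ → ℕ → RAM.Instr
  | add => .add
  | sub => .sub
  | mul => .mul
  | div => .div

theorem exec_instr (x : List ℕ) (ω : ℕ → Bool) (s : RAM.Cfg) (o : Op) (d a b : ℕ) :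
    RAM.exec x ω s (o.instr d a b) = s.write d (o.eval (s.reg a) (s.reg b)) := by
  cases o <;> rfl

end Op

/-- The memory of a structured program with variables in `ν`: the values of the variables, the
cells of one unbounded array, and the number of random bits used so far. -/
structure Store (ν : Type) where
  v : ν → ℕ
  mem : ℕ → ℕ
  used : ℕ

/-- Expressions: variables, literals, operations, cells of the array, entries of the input. -/
inductive Expr (ν : Type)
  | var (v : ν)
  | lit (c : ℕ)
  | op (o : Op) (a b : Expr ν)
  | mem (e : Expr ν)
  | inp (e : Expr ν)

/-- Statements: assignment to a variable, assignment to a cell of the array, random bit, no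
operation, sequence, conditional (`ite e s r` runs `s` if `e ≠ 0`), and bounded loop (`loop v e s`
runs `s` for `v = 0, …, e - 1`, where `e` is evaluated once). -/
inductive Stmt (ν : Type)
  | set (v : ν) (e : Expr ν)
  | put (a e : Expr ν)
  | flip (v : ν)
  | skip
  | seq (s r : Stmt ν)
  | ite (e : Expr ν) (s r : Stmt ν)
  | loop (v : ν) (e : Expr ν) (s : Stmt ν)

section Language

variable {ν : Type}

namespace Store

/-- Every variable and every cell holds a number at most `V`. -/
def Bdd (V : ℕ) (σ : Store ν) : Prop := (∀ v, σ.v v ≤ V) ∧ ∀ a, σ.mem a ≤ V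

/-- Assignment to a variable. -/
def set [DecidableEq ν] (σ : Store ν) (v : ν) (y : ℕ) : Store ν :=
  { σ with v := Function.update σ.v v y }

/-- Assignment to a cell of the array. -/
def put (σ : Store ν) (a y : ℕ) : Store ν :=
  { σ with mem := Function.update σ.mem a y }

theorem put_mem (σ : Store ν) (a b y : ℕ) :
    (σ.put a y).mem b = if b = a then y else σ.mem b := by
  simp [put, Function.update_apply]

@[simp] theorem put_v (σ : Store ν) (a y : ℕ) : (σ.put a y).v = σ.v := rfl

@[simp] theorem put_used (σ : Store ν) (a y : ℕ) : (σ.put a y).used = σ.used := rfl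

theorem Bdd.put {V : ℕ} {σ : Store ν} (h : σ.Bdd V) (a : ℕ) {y : ℕ} (hy : y ≤ V) :
    (σ.put a y).Bdd V := by
  refine ⟨h.1, fun b => ?_⟩
  rw [put_mem]
  split_ifs
  · exact hy
  · exact h.2 b

variable [DecidableEq ν]

theorem set_v (σ : Store ν) (v w : ν) (y : ℕ) :
    (σ.set v y).v w = if w = v then y else σ.v w := by
  simp [set, Function.update_apply]

@[simp] theorem set_mem (σ : Store ν) (v : ν) (y : ℕ) : (σ.set v y).mem = σ.mem := rfl

@[simp] theorem set_used (σ : Store ν) (v : ν) (y : ℕ) : (σ.set v y).used = σ.used := rfl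

theorem Bdd.set {V : ℕ} {σ : Store ν} (h : σ.Bdd V) (v : ν) {y : ℕ} (hy : y ≤ V) :
    (σ.set v y).Bdd V := by
  refine ⟨fun w => ?_, h.2⟩
  rw [set_v]
  split_ifs
  · exact hy
  · exact h.1 w

end Store

namespace Expr

/-- The value of an expression. -/
def eval (x : List ℕ) (σ : Store ν) : Expr ν → ℕ
  | var v => σ.v v
  | lit c => c
  | op o a b => o.eval (a.eval x σ) (b.eval x σ)
  | mem e => σ.mem (e.eval x σ)
  | inp e => x.getD (e.eval x σ) 0

/-- If all variables, cells and inputs are at most `V ≥ 5`, then the machine that evaluates an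
expression of size `d` meets only numbers up to `V ^ d`. -/
def size : Expr ν → ℕ
  | var _ => 1
  | lit c => c
  | op _ a b => a.size + b.size + 1
  | mem e => e.size + 1
  | inp e => e.size + 1

theorem eval_le {x : List ℕ} {σ : Store ν} {V : ℕ} (hV : 5 ≤ V) (hx : ∀ y ∈ x, y ≤ V)
    (hσ : σ.Bdd V) (e : Expr ν) : e.eval x σ ≤ V ^ e.size := by
  have h1 : ∀ d, V ≤ V ^ (d + 1) := fun d => Nat.le_self_pow (by omega) V
  induction e with
  | var v => exact (hσ.1 v).trans (h1 0)
  | lit c => exact (Nat.lt_pow_self (by omega)).le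
  | op o a b iha ihb =>
    have ha : V ^ a.size ≤ V ^ (a.size + b.size) := Nat.pow_le_pow_right (by omega) (by omega)
    have hb : V ^ b.size ≤ V ^ (a.size + b.size) := Nat.pow_le_pow_right (by omega) (by omega)
    have h2 : V ^ (a.size + b.size + 1) = V ^ (a.size + b.size) * V := pow_succ _ _
    have h3 : V ^ (a.size + b.size) * 2 ≤ V ^ (a.size + b.size) * V := by gcongr; omega
    have h4 : a.eval x σ ≤ V ^ (a.size + b.size + 1) := by omega
    cases o with
    | add => simp only [eval, Op.eval, size]; omega
    | sub => simp only [eval, Op.eval, size]; omega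
    | mul =>
      have h5 : a.eval x σ * b.eval x σ ≤ V ^ a.size * V ^ b.size := Nat.mul_le_mul iha ihb
      rw [← pow_add] at h5
      simp only [eval, Op.eval, size]; omega
    | div => exact (Nat.div_le_self _ _).trans h4
  | mem e _ => exact (hσ.2 _).trans (h1 _)
  | inp e _ =>
    refine le_trans ?_ (h1 _)
    rw [eval, List.getD_eq_getElem?_getD]
    cases h : x[e.eval x σ]? with
    | none => simp
    | some y => exact hx y (List.mem_of_getElem? h)

end Expr

namespace Stmt

/-- A bound for the exponents that occur in `Expr.size` for the expressions of the statement. -/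
def size : Stmt ν → ℕ
  | set _ e => e.size + 1
  | put a e => a.size + e.size + 1
  | flip _ => 1
  | skip => 1
  | seq s r => s.size + r.size
  | ite e s r => e.size + s.size + r.size
  | loop _ e s => e.size + s.size

theorem one_le_size (s : Stmt ν) : 1 ≤ s.size := by
  induction s <;> simp only [size] <;> omega

end Stmt

/-! ### Compilation -/

section Compile

variable (idx : ν → ℕ)

/-- The register of a temporary value. The variable `v` has register `3 * idx v`, and the cell `a`
of the array has register `3 * a + 2`. -/
abbrev tmp (t : ℕ) : ℕ := 3 * t + 1

/-- Code that computes the value of an expression in `tmp t`, using only `tmp t, tmp (t + 1), …`. -/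
def Expr.code : Expr ν → ℕ → List RAM.Instr
  | .var v, t => [.const (tmp t) 0, .add (tmp t) (3 * idx v) (tmp t)]
  | .lit c, t => [.const (tmp t) c]
  | .op o a b, t => a.code t ++ (b.code (t + 1) ++ [o.instr (tmp t) (tmp t) (tmp (t + 1))])
  | .mem e, t => e.code t ++ [.const (tmp (t + 1)) 3, .mul (tmp t) (tmp t) (tmp (t + 1)),
      .const (tmp (t + 1)) 2, .add (tmp t) (tmp t) (tmp (t + 1)), .load (tmp t) (tmp t)]
  | .inp e, t => e.code t ++ [.read (tmp t) (tmp t)]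

/-- The number of instructions of the code of an expression. -/
def Expr.len : Expr ν → ℕ
  | .var _ => 2
  | .lit _ => 1
  | .op _ a b => a.len + (b.len + 1)
  | .mem e => e.len + 5
  | .inp e => e.len + 1

theorem Expr.length_code (e : Expr ν) (t : ℕ) : (e.code idx t).length = e.len := by
  induction e generalizing t with
  | var v => rfl
  | lit c => rfl
  | op o a b iha ihb => simp [Expr.code, Expr.len, iha, ihb]
  | mem e ih => simp [Expr.code, Expr.len, ih]
  | inp e ih => simp [Expr.code, Expr.len, ih]

/-- The number of instructions of the code of a statement. -/
def Stmt.len : Stmt ν → ℕ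
  | .set _ e => e.len + 2
  | .put a e => a.len + (e.len + 5)
  | .flip _ => 1
  | .skip => 0
  | .seq s r => s.len + r.len
  | .ite e s r => e.len + (1 + (s.len + (2 + r.len)))
  | .loop _ e s => e.len + (5 + (s.len + 4))

/-- Code of a statement that is placed at line `o` and uses only `tmp t, tmp (t + 1), …`. -/
def Stmt.code : Stmt ν → ℕ → ℕ → List RAM.Instr
  | .set v e, _, t => e.code idx t ++ [.const (3 * idx v) 0, .add (3 * idx v) (3 * idx v) (tmp t)]
  | .put a e, _, t => a.code idx t ++ (e.code idx (t + 1) ++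
      [.const (tmp (t + 2)) 3, .mul (tmp t) (tmp t) (tmp (t + 2)),
       .const (tmp (t + 2)) 2, .add (tmp t) (tmp t) (tmp (t + 2)), .store (tmp t) (tmp (t + 1))])
  | .flip v, _, _ => [.flip (3 * idx v)]
  | .skip, _, _ => []
  | .seq s r, o, t => s.code o t ++ r.code (o + s.len) t
  | .ite e s r, o, t => e.code idx t ++
      ([.jumpZero (tmp t) (o + e.len + 1 + s.len + 2)] ++
      (s.code (o + e.len + 1) t ++
      ([.const (tmp t) 0, .jumpZero (tmp t) (o + e.len + 1 + s.len + 2 + r.len)] ++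
      r.code (o + e.len + 1 + s.len + 2) t)))
  | .loop v e s, o, t => e.code idx t ++
      ([.const (tmp (t + 1)) 0,
        .sub (tmp (t + 2)) (tmp t) (tmp (t + 1)),
        .jumpZero (tmp (t + 2)) (o + e.len + 5 + s.len + 4),
        .const (3 * idx v) 0, .add (3 * idx v) (3 * idx v) (tmp (t + 1))] ++
      (s.code (o + e.len + 5) (t + 2) ++
       [.const (tmp (t + 2)) 1, .add (tmp (t + 1)) (tmp (t + 1)) (tmp (t + 2)),
        .const (tmp (t + 2)) 0, .jumpZero (tmp (t + 2)) (o + e.len + 1)]))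

theorem Stmt.length_code (s : Stmt ν) (o t : ℕ) : (s.code idx o t).length = s.len := by
  induction s generalizing o t with
  | set v e => simp [Stmt.code, Stmt.len, Expr.length_code]
  | put a e => simp [Stmt.code, Stmt.len, Expr.length_code]
  | flip v => rfl
  | skip => rfl
  | seq s r ihs ihr => simp [Stmt.code, Stmt.len, ihs, ihr]
  | ite e s r ihs ihr => simp [Stmt.code, Stmt.len, Expr.length_code, ihs, ihr]; omega
  | loop v e s ih => simp [Stmt.code, Stmt.len, Expr.length_code, ih]; omega

end Compile

/-! ### Semantics of statements and correctness of the compilation -/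

section Semantics

/-- `Run x ω V s σ σ' T`: on input `x` with random bits `ω`, the statement `s` turns `σ` into `σ'`
within `T` machine steps, and assigns only numbers up to `V`. The step counts are those of the
compiled code; `T` is only an upper bound. -/
inductive Run [DecidableEq ν] (x : List ℕ) (ω : ℕ → Bool) (V : ℕ) :
    Stmt ν → Store ν → Store ν → ℕ → Prop
  | set {σ : Store ν} (v : ν) (e : Expr ν) {T : ℕ} : e.eval x σ ≤ V → e.len + 2 ≤ T →
      Run x ω V (.set v e) σ (σ.set v (e.eval x σ)) T
  | put {σ : Store ν} (a e : Expr ν) {T : ℕ} : e.eval x σ ≤ V → a.len + e.len + 5 ≤ T →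
      Run x ω V (.put a e) σ (σ.put (a.eval x σ) (e.eval x σ)) T
  | flip {σ : Store ν} (v : ν) {T : ℕ} : 1 ≤ T →
      Run x ω V (.flip v) σ { σ.set v (ω σ.used).toNat with used := σ.used + 1 } T
  | skip {σ : Store ν} {T : ℕ} : Run x ω V .skip σ σ T
  | seq {s r : Stmt ν} {σ σ' σ'' : Store ν} {T T' T'' : ℕ} : Run x ω V s σ σ' T →
      Run x ω V r σ' σ'' T' → T + T' ≤ T'' → Run x ω V (.seq s r) σ σ'' T''
  | iteTrue {e : Expr ν} {s r : Stmt ν} {σ σ' : Store ν} {T T' : ℕ} : e.eval x σ ≠ 0 →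
      Run x ω V s σ σ' T → T + e.len + 3 ≤ T' → Run x ω V (.ite e s r) σ σ' T'
  | iteFalse {e : Expr ν} {s r : Stmt ν} {σ σ' : Store ν} {T T' : ℕ} : e.eval x σ = 0 →
      Run x ω V r σ σ' T → T + e.len + 3 ≤ T' → Run x ω V (.ite e s r) σ σ' T'
  | loop {v : ν} {e : Expr ν} {s : Stmt ν} (τ : ℕ → Store ν) {T T' : ℕ} : e.eval x (τ 0) ≤ V →
      (∀ i < e.eval x (τ 0), Run x ω V s ((τ i).set v i) (τ (i + 1)) T) →
      e.eval x (τ 0) * (T + 8) + e.len + 3 ≤ T' →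
      Run x ω V (.loop v e s) (τ 0) (τ (e.eval x (τ 0))) T'

theorem Run.bdd [DecidableEq ν] {x : List ℕ} {ω : ℕ → Bool} {V : ℕ} (hV : 5 ≤ V) {s : Stmt ν}
    {σ σ' : Store ν} {T : ℕ} (h : Run x ω V s σ σ' T) (hσ : σ.Bdd V) : σ'.Bdd V := by
  induction h with
  | set v e h _ => exact hσ.set v h
  | put a e h _ => exact hσ.put _ h
  | @flip σ v T _ =>
    have h1 : (ω σ.used).toNat ≤ V := (Bool.toNat_le _).trans (by omega)
    exact ⟨(hσ.set v h1).1, hσ.2⟩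
  | skip => exact hσ
  | seq _ _ _ ih1 ih2 => exact ih2 (ih1 hσ)
  | iteTrue _ _ _ ih => exact ih hσ
  | iteFalse _ _ _ ih => exact ih hσ
  | @loop v e s τ T T' hN _ _ ih =>
    have : ∀ i ≤ e.eval x (τ 0), (τ i).Bdd V := by
      intro i
      induction i with
      | zero => intro _; exact hσ
      | succ i ih' => intro hi; exact ih i hi ((ih' (by omega)).set v (by omega))
    exact this _ le_rfl

/-- The instructions `L` stand in `M` from line `o` on. -/
def CodeAt (M : RAM.Program) (o : ℕ) (L : List RAM.Instr) : Prop :=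
  ∀ j < L.length, M[o + j]? = L[j]?

theorem codeAt_append {M : RAM.Program} {o : ℕ} {L L' : List RAM.Instr} :
    CodeAt M o (L ++ L') ↔ CodeAt M o L ∧ CodeAt M (o + L.length) L' := by
  constructor
  · intro h
    refine ⟨fun j hj => ?_, fun j hj => ?_⟩
    · rw [h j (by simp; omega), List.getElem?_append_left hj]
    · rw [Nat.add_assoc, h _ (by simp; omega), List.getElem?_append_right (by omega)]
      simp
  · rintro ⟨h1, h2⟩ j hj
    by_cases hj' : j < L.length
    · rw [h1 j hj', List.getElem?_append_left hj']
    · rw [List.length_append] at hj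
      have := h2 (j - L.length) (by omega)
      rw [show o + L.length + (j - L.length) = o + j by omega] at this
      rw [this, List.getElem?_append_right (by omega)]

theorem codeAt_cons {M : RAM.Program} {o : ℕ} {i : RAM.Instr} {L : List RAM.Instr} :
    CodeAt M o (i :: L) ↔ M[o]? = some i ∧ CodeAt M (o + 1) L := by
  rw [← List.singleton_append, codeAt_append]
  refine and_congr_left fun _ => ⟨fun h => by simpa using h 0 (by simp), fun h j hj => ?_⟩
  have : j = 0 := by simpa using hj
  subst this
  simpa using h

/-- `Reaches M x ω B s s' T`: the machine reaches `s'` from `s` in `T` steps, without any register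
exceeding `B`. -/
def Reaches (M : RAM.Program) (x : List ℕ) (ω : ℕ → Bool) (B : ℕ) (s s' : RAM.Cfg) (T : ℕ) :
    Prop :=
  (RAM.step M x ω)^[T] s = s' ∧ ∀ t ≤ T, ∀ i, ((RAM.step M x ω)^[t] s).reg i ≤ B

/-- The machine is about to execute line `o`, and no register exceeds `B`. -/
structure Ready (s : RAM.Cfg) (o B : ℕ) : Prop where
  pc : s.pc = o
  answer : s.answer = none
  bound : ∀ i, s.reg i ≤ B

theorem RAM.Cfg.write_reg (s : RAM.Cfg) (d v i : ℕ) :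
    (s.write d v).reg i = if i = d then v else s.reg i := by
  simp [RAM.Cfg.write, Function.update_apply]

variable {M : RAM.Program} {x : List ℕ} {ω : ℕ → Bool} {B : ℕ}

theorem Reaches.trans {s s' s'' : RAM.Cfg} {T T' : ℕ} (h : Reaches M x ω B s s' T)
    (h' : Reaches M x ω B s' s'' T') : Reaches M x ω B s s'' (T + T') := by
  refine ⟨?_, fun t ht i => ?_⟩
  · rw [Nat.add_comm, Function.iterate_add_apply, h.1, h'.1]
  · by_cases htT : t ≤ T
    · exact h.2 t htT i
    · have := h'.2 (t - T) (by omega) i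
      rw [← h.1, ← Function.iterate_add_apply, Nat.sub_add_cancel (by omega)] at this
      exact this

theorem Ready.reaches_refl {s : RAM.Cfg} {o : ℕ} (h : Ready s o B) : Reaches M x ω B s s 0 :=
  ⟨rfl, fun t ht i => by
    obtain rfl : t = 0 := by omega
    exact h.bound i⟩

theorem Ready.reaches_exec {s s' : RAM.Cfg} {o o' : ℕ} {i : RAM.Instr} (h : Ready s o B)
    (hM : M[o]? = some i) (hex : RAM.exec x ω s i = s') (h' : Ready s' o' B) :
    Reaches M x ω B s s' 1 := by
  have hstep : RAM.step M x ω s = s' := by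
    rw [RAM.step, h.answer, h.pc, hM]
    exact hex
  refine ⟨hstep, fun t ht j => ?_⟩
  rcases Nat.le_one_iff_eq_zero_or_eq_one.mp ht with rfl | rfl
  · exact h.bound j
  · rw [Function.iterate_one, hstep]
    exact h'.bound j

theorem Ready.write {s : RAM.Cfg} {o d v : ℕ} (h : Ready s o B) (hv : v ≤ B) :
    Ready (s.write d v) (o + 1) B :=
  ⟨congrArg (· + 1) h.pc, h.answer, fun i => by
    rw [RAM.Cfg.write_reg]
    split_ifs
    · exact hv
    · exact h.bound i⟩

theorem Ready.jump {s : RAM.Cfg} {o a l o' : ℕ} (h : Ready s o B)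
    (ho : (if s.reg a = 0 then l else o + 1) = o') :
    Ready { s with pc := if s.reg a = 0 then l else s.pc + 1 } o' B :=
  ⟨by rw [h.pc]; exact ho, h.answer, h.bound⟩

variable (idx : ν → ℕ)

/-- The registers of the variables and of the cells hold the values of the store. -/
structure Represents (σ : Store ν) (s : RAM.Cfg) : Prop where
  var : ∀ v, s.reg (3 * idx v) = σ.v v
  mem : ∀ a, s.reg (3 * a + 2) = σ.mem a
  used : s.used = σ.used

variable {idx}

theorem Represents.write_tmp {σ : Store ν} {s : RAM.Cfg} (h : Represents idx σ s) (t v : ℕ) :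
    Represents idx σ (s.write (tmp t) v) := by
  refine ⟨fun w => ?_, fun a => ?_, h.used⟩
  · rw [RAM.Cfg.write_reg, if_neg (by unfold tmp; omega), h.var]
  · rw [RAM.Cfg.write_reg, if_neg (by unfold tmp; omega), h.mem]

theorem Represents.write_var [DecidableEq ν] (hidx : Function.Injective idx) {σ : Store ν}
    {s : RAM.Cfg}
    (h : Represents idx σ s) (v : ν) (y : ℕ) :
    Represents idx (σ.set v y) (s.write (3 * idx v) y) := by
  refine ⟨fun w => ?_, fun a => ?_, h.used⟩
  · rw [RAM.Cfg.write_reg, Store.set_v, h.var]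
    congr 1
    rw [eq_iff_iff]
    exact ⟨fun h => hidx (by omega), fun h => by rw [h]⟩
  · rw [RAM.Cfg.write_reg, if_neg (by omega), h.mem, Store.set_mem]

theorem Represents.write_mem {σ : Store ν} {s : RAM.Cfg} (h : Represents idx σ s) (a y : ℕ) :
    Represents idx (σ.put a y) (s.write (3 * a + 2) y) := by
  refine ⟨fun w => ?_, fun b => ?_, h.used⟩
  · rw [RAM.Cfg.write_reg, if_neg (by omega), h.var, Store.put_v]
  · rw [RAM.Cfg.write_reg, Store.put_mem, h.mem]
    congr 1
    rw [eq_iff_iff]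
    omega

theorem Expr.reaches {V : ℕ} (hV : 5 ≤ V) (hx : ∀ y ∈ x, y ≤ V) {σ : Store ν} (hσ : σ.Bdd V)
    (e : Expr ν) (hB : V ^ e.size ≤ B) (hB' : V ≤ B) (o t : ℕ) (hM : CodeAt M o (e.code idx t))
    (s : RAM.Cfg) (hs : Ready s o B) (hr : Represents idx σ s) :
    ∃ s', Reaches M x ω B s s' e.len ∧ Ready s' (o + e.len) B ∧ Represents idx σ s' ∧
      s'.reg (tmp t) = e.eval x σ ∧ ∀ t' < t, s'.reg (tmp t') = s.reg (tmp t') := by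
  have hpow : ∀ {d d' : ℕ}, d ≤ d' → V ^ d ≤ V ^ d' := fun h => Nat.pow_le_pow_right (by omega) h
  induction e generalizing o t s with
  | var v =>
    simp only [Expr.code, codeAt_cons] at hM
    have h1 : Ready (s.write (tmp t) 0) (o + 1) B := hs.write (Nat.zero_le _)
    have h2 : Ready ((s.write (tmp t) 0).write (tmp t) (σ.v v)) (o + 2) B :=
      h1.write ((hσ.1 v).trans hB')
    refine ⟨_, (hs.reaches_exec hM.1 rfl h1).trans (h1.reaches_exec hM.2.1 ?_ h2), h2,
      (hr.write_tmp t 0).write_tmp t _, ?_, fun t' ht' => ?_⟩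
    · rw [RAM.exec, RAM.Cfg.write_reg, RAM.Cfg.write_reg, if_neg (by unfold tmp; omega), if_pos rfl,
        hr.var, Nat.add_zero]
    · rw [RAM.Cfg.write_reg, if_pos rfl]; rfl
    · rw [RAM.Cfg.write_reg, RAM.Cfg.write_reg, if_neg (by unfold tmp; omega),
        if_neg (by unfold tmp; omega)]
  | lit c =>
    simp only [Expr.code, codeAt_cons] at hM
    have h1 : Ready (s.write (tmp t) c) (o + 1) B :=
      hs.write (((Expr.lit c).eval_le hV hx hσ).trans hB)
    refine ⟨s.write (tmp t) c, hs.reaches_exec hM.1 rfl h1, h1, hr.write_tmp t c, ?_,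
      fun t' ht' => ?_⟩
    · rw [RAM.Cfg.write_reg, if_pos rfl]; rfl
    · rw [RAM.Cfg.write_reg, if_neg (by unfold tmp; omega)]
  | op p a b iha ihb =>
    have hval := ((Expr.op p a b).eval_le hV hx hσ).trans hB
    simp only [Expr.code, codeAt_append, codeAt_cons, Expr.length_code] at hM
    obtain ⟨hMa, hMb, hM1, -⟩ := hM
    simp only [Expr.size] at hB
    obtain ⟨s1, hreach1, hs1, hr1, hv1, ht1⟩ := iha ((hpow (by omega)).trans hB) o t hMa s hs hr
    obtain ⟨s2, hreach2, hs2, hr2, hv2, ht2⟩ :=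
      ihb ((hpow (by omega)).trans hB) (o + a.len) (t + 1) hMb s1 hs1 hr1
    have h3 : Ready (s2.write (tmp t) ((Expr.op p a b).eval x σ)) (o + a.len + b.len + 1) B :=
      hs2.write hval
    refine ⟨_, hreach1.trans (hreach2.trans (hs2.reaches_exec hM1 ?_ h3)),
      by convert h3 using 1; simp only [Expr.len]; omega, hr2.write_tmp _ _, ?_, fun t' ht' => ?_⟩
    · rw [Op.exec_instr, hv2, ht2 t (by omega), hv1]
      rfl
    · rw [RAM.Cfg.write_reg, if_pos rfl]
    · rw [RAM.Cfg.write_reg, if_neg (by unfold tmp; omega), ht2 t' (by omega), ht1 t' ht']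
  | mem e ih =>
    have hval := ((Expr.mem e).eval_le hV hx hσ).trans hB
    have heval := e.eval_le hV hx hσ
    simp only [Expr.code, codeAt_append, codeAt_cons, Expr.length_code] at hM
    obtain ⟨hMe, hM1, hM2, hM3, hM4, hM5, -⟩ := hM
    simp only [Expr.size] at hB
    obtain ⟨s0, hreach0, hs0, hr0, hv0, ht0⟩ := ih ((hpow (by omega)).trans hB) o t hMe s hs hr
    have hbig : 3 * e.eval x σ + 2 ≤ B := by
      have h1 : 1 ≤ V ^ e.size := Nat.one_le_pow _ _ (by omega)
      have h2 : V ^ e.size * 5 ≤ V ^ e.size * V := Nat.mul_le_mul_left _ hV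
      rw [pow_succ] at hB
      omega
    set y := e.eval x σ with hy
    have h1 : Ready (s0.write (tmp (t + 1)) 3) (o + e.len + 1) B := hs0.write (by omega)
    set s1 := s0.write (tmp (t + 1)) 3 with hs1
    have h2 : Ready (s1.write (tmp t) (3 * y)) (o + e.len + 2) B := h1.write (by omega)
    set s2 := s1.write (tmp t) (3 * y) with hs2
    have h3 : Ready (s2.write (tmp (t + 1)) 2) (o + e.len + 3) B := h2.write (by omega)
    set s3 := s2.write (tmp (t + 1)) 2 with hs3
    have h4 : Ready (s3.write (tmp t) (3 * y + 2)) (o + e.len + 4) B := h3.write (by omega)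
    set s4 := s3.write (tmp t) (3 * y + 2) with hs4
    have h5 : Ready (s4.write (tmp t) (σ.mem y)) (o + e.len + 5) B := h4.write hval
    have hr4 : Represents idx σ s4 :=
      (((hr0.write_tmp _ _).write_tmp _ _).write_tmp _ _).write_tmp _ _
    refine ⟨_, hreach0.trans ((((((hs0.reaches_exec hM1 rfl h1).trans
      (h1.reaches_exec hM2 ?_ h2)).trans (h2.reaches_exec hM3 rfl h3)).trans
      (h3.reaches_exec hM4 ?_ h4))).trans (h4.reaches_exec hM5 ?_ h5)),
      h5, hr4.write_tmp _ _, ?_, fun t' ht' => ?_⟩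
    · rw [RAM.exec, hs1, RAM.Cfg.write_reg, RAM.Cfg.write_reg, if_neg (by unfold tmp; omega),
        if_pos rfl, hv0, Nat.mul_comm]
    · rw [RAM.exec, hs3, RAM.Cfg.write_reg, RAM.Cfg.write_reg, if_neg (by unfold tmp; omega),
        if_pos rfl, hs2, RAM.Cfg.write_reg, if_pos rfl]
    · have hl : s4.reg (tmp t) = 3 * y + 2 := by rw [hs4, RAM.Cfg.write_reg, if_pos rfl]
      rw [RAM.exec, hl, hr4.mem]
    · rw [RAM.Cfg.write_reg, if_pos rfl]; rfl
    · simp only [hs4, hs3, hs2, hs1, RAM.Cfg.write_reg]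
      rw [if_neg (by unfold tmp; omega), if_neg (by unfold tmp; omega),
        if_neg (by unfold tmp; omega), if_neg (by unfold tmp; omega),
        if_neg (by unfold tmp; omega), ht0 t' ht']
  | inp e ih =>
    have hval := ((Expr.inp e).eval_le hV hx hσ).trans hB
    simp only [Expr.code, codeAt_append, codeAt_cons, Expr.length_code] at hM
    obtain ⟨hMe, hM1, -⟩ := hM
    simp only [Expr.size] at hB
    obtain ⟨s0, hreach0, hs0, hr0, hv0, ht0⟩ := ih ((hpow (by omega)).trans hB) o t hMe s hs hr
    have h1 : Ready (s0.write (tmp t) ((Expr.inp e).eval x σ)) (o + e.len + 1) B := hs0.write hval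
    refine ⟨_, hreach0.trans (hs0.reaches_exec hM1 ?_ h1), h1, hr0.write_tmp _ _, ?_,
      fun t' ht' => ?_⟩
    · rw [RAM.exec, hv0]; rfl
    · rw [RAM.Cfg.write_reg, if_pos rfl]
    · rw [RAM.Cfg.write_reg, if_neg (by unfold tmp; omega), ht0 t' ht']

variable [DecidableEq ν]

theorem Store.set_set (σ : Store ν) (v : ν) (y z : ℕ) : (σ.set v y).set v z = σ.set v z := by
  simp [Store.set]

theorem Ready.of_eq {s : RAM.Cfg} {o o' : ℕ} (h : Ready s o B) (ho : o = o') :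
    Ready s o' B :=
  ho ▸ h

/-- Copying a temporary value to a variable. -/
theorem reaches_copy_var (hidx : Function.Injective idx) {σ : Store ν} {s : RAM.Cfg} {o t : ℕ}
    (v : ν) (hs : Ready s o B) (hr : Represents idx σ s)
    (hM1 : M[o]? = some (.const (3 * idx v) 0))
    (hM2 : M[o + 1]? = some (.add (3 * idx v) (3 * idx v) (tmp t))) :
    ∃ s', Reaches M x ω B s s' 2 ∧ Ready s' (o + 2) B ∧
      Represents idx (σ.set v (s.reg (tmp t))) s' ∧ ∀ t', s'.reg (tmp t') = s.reg (tmp t') := by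
  have h1 : Ready (s.write (3 * idx v) 0) (o + 1) B := hs.write (Nat.zero_le _)
  have h2 : Ready ((s.write (3 * idx v) 0).write (3 * idx v) (s.reg (tmp t))) (o + 2) B :=
    h1.write (hs.bound _)
  refine ⟨_, (hs.reaches_exec hM1 rfl h1).trans (h1.reaches_exec hM2 ?_ h2), h2, ?_,
    fun t' => ?_⟩
  · rw [RAM.exec, RAM.Cfg.write_reg, RAM.Cfg.write_reg, if_pos rfl, if_neg (by unfold tmp; omega),
      Nat.zero_add]
  · have := (hr.write_var hidx v 0).write_var hidx v (s.reg (tmp t))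
    rwa [Store.set_set] at this
  · rw [RAM.Cfg.write_reg, RAM.Cfg.write_reg, if_neg (by unfold tmp; omega),
      if_neg (by unfold tmp; omega)]

/-- The machine executes the code of a statement as the semantics of the statement prescribes. -/
theorem Run.reaches {V : ℕ} (hidx : Function.Injective idx) (hV : 5 ≤ V)
    (hx : ∀ y ∈ x, y ≤ V) {s : Stmt ν} {σ σ' : Store ν} {T : ℕ} (h : Run x ω V s σ σ' T)
    (hσ : σ.Bdd V) (hB : V ^ s.size ≤ B) (o t : ℕ) (hM : CodeAt M o (s.code idx o t))
    (c : RAM.Cfg) (hc : Ready c o B) (hr : Represents idx σ c) :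
    ∃ c' T', T' ≤ T ∧ Reaches M x ω B c c' T' ∧ Ready c' (o + s.len) B ∧ Represents idx σ' c' ∧
      ∀ t' < t, c'.reg (tmp t') = c.reg (tmp t') := by
  have hpow : ∀ {d d' : ℕ}, d ≤ d' → V ^ d ≤ V ^ d' := fun h => Nat.pow_le_pow_right (by omega) h
  have hB' : V ≤ B := (Nat.le_self_pow (Nat.one_le_iff_ne_zero.mp s.one_le_size) V).trans hB
  induction h generalizing o t c with
  | @set σ v e T hv hT =>
    simp only [Stmt.code, codeAt_append, codeAt_cons, Expr.length_code] at hM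
    simp only [Stmt.size] at hB
    obtain ⟨c1, hreach1, hc1, hr1, hv1, ht1⟩ :=
      e.reaches hV hx hσ ((hpow (by omega)).trans hB) hB' o t hM.1 c hc hr
    obtain ⟨c2, hreach2, hc2, hr2, ht2⟩ :=
      reaches_copy_var hidx v hc1 hr1 hM.2.1 hM.2.2.1
    rw [hv1] at hr2
    exact ⟨c2, _, hT, hreach1.trans hreach2, hc2, hr2,
      fun t' ht' => by rw [ht2, ht1 t' ht']⟩
  | @put σ a e T hv hT =>
    simp only [Stmt.code, codeAt_append, codeAt_cons, Expr.length_code] at hM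
    obtain ⟨hMa, hMe, hM1, hM2, hM3, hM4, hM5, -⟩ := hM
    simp only [Stmt.size] at hB
    obtain ⟨c1, hreach1, hc1, hr1, hv1, ht1⟩ :=
      a.reaches hV hx hσ ((hpow (by omega)).trans hB) hB' o t hMa c hc hr
    obtain ⟨c2, hreach2, hc2, hr2, hv2, ht2⟩ :=
      e.reaches hV hx hσ ((hpow (by omega)).trans hB) hB' (o + a.len) (t + 1) hMe c1 hc1 hr1
    have hva : c2.reg (tmp t) = a.eval x σ := by rw [ht2 t (by omega), hv1]
    set y := a.eval x σ with hy
    have hbig : 3 * y + 2 ≤ B := by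
      have h0 := a.eval_le hV hx hσ
      have h1 : 1 ≤ V ^ a.size := Nat.one_le_pow _ _ (by omega)
      have h2 : V ^ a.size * 5 ≤ V ^ a.size * V := Nat.mul_le_mul_left _ hV
      have h3 := (hpow (show a.size + 1 ≤ a.size + e.size + 1 by omega)).trans hB
      rw [pow_succ] at h3
      omega
    have h3 : Ready (c2.write (tmp (t + 2)) 3) (o + a.len + e.len + 1) B := hc2.write (by omega)
    set c3 := c2.write (tmp (t + 2)) 3 with hc3
    have h4 : Ready (c3.write (tmp t) (3 * y)) (o + a.len + e.len + 2) B := h3.write (by omega)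
    set c4 := c3.write (tmp t) (3 * y) with hc4
    have h5 : Ready (c4.write (tmp (t + 2)) 2) (o + a.len + e.len + 3) B := h4.write (by omega)
    set c5 := c4.write (tmp (t + 2)) 2 with hc5
    have h6 : Ready (c5.write (tmp t) (3 * y + 2)) (o + a.len + e.len + 4) B :=
      h5.write (by omega)
    set c6 := c5.write (tmp t) (3 * y + 2) with hc6
    have h7 : Ready (c6.write (3 * y + 2) (e.eval x σ)) (o + a.len + e.len + 5) B :=
      h6.write (hv.trans hB')
    have hr6 : Represents idx σ c6 :=
      (((hr2.write_tmp _ _).write_tmp _ _).write_tmp _ _).write_tmp _ _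
    have hv6 : c6.reg (tmp (t + 1)) = e.eval x σ := by
      simp only [hc6, hc5, hc4, hc3, RAM.Cfg.write_reg]
      rw [if_neg (by unfold tmp; omega), if_neg (by unfold tmp; omega),
        if_neg (by unfold tmp; omega), if_neg (by unfold tmp; omega), hv2]
    refine ⟨c6.write (3 * y + 2) (e.eval x σ), a.len + (e.len + (1 + 1 + 1 + 1 + 1)), by omega,
      hreach1.trans (hreach2.trans
      (((((hc2.reaches_exec hM1 rfl h3).trans
      (h3.reaches_exec hM2 ?_ h4)).trans (h4.reaches_exec hM3 rfl h5)).trans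
      (h5.reaches_exec hM4 ?_ h6)).trans (h6.reaches_exec hM5 ?_ h7))),
      h7.of_eq (by simp only [Stmt.len]; omega), hr6.write_mem _ _, fun t' ht' => ?_⟩
    · rw [RAM.exec, hc3, RAM.Cfg.write_reg, RAM.Cfg.write_reg, if_neg (by unfold tmp; omega),
        if_pos rfl, hva, Nat.mul_comm]
    · rw [RAM.exec, hc5, RAM.Cfg.write_reg, RAM.Cfg.write_reg, if_neg (by unfold tmp; omega),
        if_pos rfl, hc4, RAM.Cfg.write_reg, if_pos rfl]
    · have hl : c6.reg (tmp t) = 3 * y + 2 := by rw [hc6, RAM.Cfg.write_reg, if_pos rfl]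
      rw [RAM.exec, hl, hv6]
    · simp only [hc6, hc5, hc4, hc3, RAM.Cfg.write_reg]
      rw [if_neg (by unfold tmp; omega), if_neg (by unfold tmp; omega),
        if_neg (by unfold tmp; omega), if_neg (by unfold tmp; omega),
        if_neg (by unfold tmp; omega), ht2 t' (by omega), ht1 t' ht']
  | @flip σ v T hT =>
    simp only [Stmt.code, codeAt_cons] at hM
    have h1 : Ready (c.write (3 * idx v) (ω σ.used).toNat) (o + 1) B :=
      hc.write ((Bool.toNat_le _).trans (by omega))
    have hr1 := hr.write_var hidx v (ω σ.used).toNat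
    have h2 : Ready { c.write (3 * idx v) (ω σ.used).toNat with used := c.used + 1 } (o + 1) B :=
      ⟨h1.pc, h1.answer, h1.bound⟩
    refine ⟨_, 1, hT, hc.reaches_exec hM.1 ?_ h2, h2,
      ⟨hr1.var, hr1.mem, by simp [hr.used]⟩, fun t' ht' => ?_⟩
    · rw [RAM.exec, hr.used]
    · have := RAM.Cfg.write_reg c (3 * idx v) (ω σ.used).toNat (tmp t')
      rw [if_neg (by unfold tmp; omega)] at this
      exact this
  | skip => exact ⟨c, 0, Nat.zero_le _, hc.reaches_refl, hc, hr, fun _ _ => rfl⟩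
  | @seq s r σ σ' σ'' T T' T'' h1 h2 hT ih1 ih2 =>
    simp only [Stmt.code, codeAt_append, Stmt.length_code] at hM
    simp only [Stmt.size] at hB
    obtain ⟨c1, T1, hT1, hreach1, hc1, hr1, ht1⟩ :=
      ih1 hσ ((hpow (by omega)).trans hB) o t hM.1 c hc hr
    obtain ⟨c2, T2, hT2, hreach2, hc2, hr2, ht2⟩ :=
      ih2 (h1.bdd hV hσ) ((hpow (by omega)).trans hB) _ t hM.2 c1 hc1 hr1
    exact ⟨c2, T1 + T2, by omega, hreach1.trans hreach2,
      hc2.of_eq (by simp only [Stmt.len]; omega), hr2, fun t' ht' => by rw [ht2 t' ht', ht1 t' ht']⟩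
  | @iteTrue e s r σ σ' T T' he h hT ih =>
    simp only [Stmt.code, codeAt_append, codeAt_cons, Expr.length_code, Stmt.length_code,
      List.length_cons, List.length_nil] at hM
    obtain ⟨hMe, ⟨hM1, -⟩, hMs, ⟨hM2, hM3, -⟩, -⟩ := hM
    simp only [Stmt.size] at hB
    obtain ⟨c0, hreach0, hc0, hr0, hv0, ht0⟩ :=
      e.reaches hV hx hσ ((hpow (by omega)).trans hB) hB' o t hMe c hc hr
    have h1 := hc0.jump (a := tmp t) (l := o + e.len + 1 + s.len + 2) (o' := o + e.len + 1)
      (by rw [hv0, if_neg he])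
    obtain ⟨c2, T2, hT2, hreach2, hc2, hr2, ht2⟩ :=
      ih hσ ((hpow (by omega)).trans hB) _ t hMs _ h1 ⟨hr0.var, hr0.mem, hr0.used⟩
    have h3 : Ready (c2.write (tmp t) 0) (o + e.len + 1 + s.len + 1) B := hc2.write (Nat.zero_le _)
    have h4 := h3.jump (a := tmp t) (l := o + e.len + 1 + s.len + 2 + r.len)
      (o' := o + e.len + 1 + s.len + 2 + r.len) (by rw [RAM.Cfg.write_reg, if_pos rfl, if_pos rfl])
    refine ⟨_, e.len + (1 + (T2 + (1 + 1))), by omega,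
      hreach0.trans ((hc0.reaches_exec hM1 rfl h1).trans
      (hreach2.trans ((hc2.reaches_exec hM2 rfl h3).trans (h3.reaches_exec hM3 rfl h4)))),
      h4.of_eq (by simp only [Stmt.len]; omega), ?_, fun t' ht' => ?_⟩
    · have := hr2.write_tmp t 0
      exact ⟨this.var, this.mem, this.used⟩
    · have := RAM.Cfg.write_reg c2 (tmp t) 0 (tmp t')
      rw [if_neg (by unfold tmp; omega), ht2 t' ht'] at this
      exact this.trans (ht0 t' ht')
  | @iteFalse e s r σ σ' T T' he h hT ih =>
    simp only [Stmt.code, codeAt_append, codeAt_cons, Expr.length_code, Stmt.length_code,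
      List.length_cons, List.length_nil] at hM
    obtain ⟨hMe, ⟨hM1, -⟩, -, -, hMr⟩ := hM
    simp only [Stmt.size] at hB
    obtain ⟨c0, hreach0, hc0, hr0, hv0, ht0⟩ :=
      e.reaches hV hx hσ ((hpow (by omega)).trans hB) hB' o t hMe c hc hr
    have h1 := hc0.jump (a := tmp t) (l := o + e.len + 1 + s.len + 2)
      (o' := o + e.len + 1 + s.len + 2) (by rw [hv0, if_pos he])
    obtain ⟨c2, T2, hT2, hreach2, hc2, hr2, ht2⟩ :=
      ih hσ ((hpow (by omega)).trans hB) _ t hMr _ h1 ⟨hr0.var, hr0.mem, hr0.used⟩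
    exact ⟨c2, e.len + (1 + T2), by omega,
      hreach0.trans ((hc0.reaches_exec hM1 rfl h1).trans hreach2),
      hc2.of_eq (by simp only [Stmt.len]; omega), hr2,
      fun t' ht' => (ht2 t' ht').trans (ht0 t' ht')⟩
  | @loop v e s τ T T' hN hbody hT ih =>
    have hbdd : ∀ i ≤ e.eval x (τ 0), (τ i).Bdd V := by
      intro i
      induction i with
      | zero => intro _; exact hσ
      | succ i ih' =>
        intro hi
        exact (hbody i hi).bdd hV ((ih' (by omega)).set v (by omega))
    simp only [Stmt.code, codeAt_append, codeAt_cons, Expr.length_code, Stmt.length_code,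
      List.length_cons, List.length_nil] at hM
    obtain ⟨hMe, ⟨hM1, hM2, hM3, hM4, hM5, -⟩, hMs, hM6, hM7, hM8, hM9, -⟩ := hM
    simp only [Stmt.size] at hB
    obtain ⟨c0, hreach0, hc0, hr0, hv0, ht0⟩ :=
      e.reaches hV hx hσ ((hpow (by omega)).trans hB) hB' o t hMe c hc hr
    set N := e.eval x (τ 0) with hNdef
    have h1 : Ready (c0.write (tmp (t + 1)) 0) (o + e.len + 1) B := hc0.write (Nat.zero_le _)
    -- The state of the machine at the head of the loop, before iteration `i`.
    have key : ∀ i ≤ N, ∃ c' T', T' ≤ i * (T + 8) ∧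
        Reaches M x ω B (c0.write (tmp (t + 1)) 0) c' T' ∧ Ready c' (o + e.len + 1) B ∧
        Represents idx (τ i) c' ∧ c'.reg (tmp t) = N ∧ c'.reg (tmp (t + 1)) = i ∧
        ∀ t' < t, c'.reg (tmp t') = c.reg (tmp t') := by
      intro i
      induction i with
      | zero =>
        intro _
        refine ⟨_, 0, by omega, h1.reaches_refl, h1, hr0.write_tmp _ _, ?_, ?_, fun t' ht' => ?_⟩
        · rw [RAM.Cfg.write_reg, if_neg (by unfold tmp; omega), hv0]
        · rw [RAM.Cfg.write_reg, if_pos rfl]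
        · rw [RAM.Cfg.write_reg, if_neg (by unfold tmp; omega), ht0 t' ht']
      | succ i ih' =>
        intro hi
        obtain ⟨a0, T0, hT0, hreach, ha0, hra0, hv0, hi0, ht0⟩ := ih' (by omega)
        have ha1 : Ready (a0.write (tmp (t + 2)) (N - i)) (o + e.len + 2) B :=
          ha0.write ((Nat.sub_le _ _).trans (hN.trans hB'))
        set a1 := a0.write (tmp (t + 2)) (N - i) with ha1def
        have ha2 := ha1.jump (a := tmp (t + 2)) (l := o + e.len + 5 + s.len + 4)
          (o' := o + e.len + 3) (by rw [ha1def, RAM.Cfg.write_reg, if_pos rfl, if_neg (by omega)])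
        have hra1 : Represents idx (τ i) a1 := hra0.write_tmp _ _
        set a2 : RAM.Cfg := { a1 with
          pc := if a1.reg (tmp (t + 2)) = 0 then o + e.len + 5 + s.len + 4 else a1.pc + 1 }
          with ha2def
        have hra2 : Represents idx (τ i) a2 := ⟨hra1.var, hra1.mem, hra1.used⟩
        have hreg2 : ∀ t' < t + 2, a2.reg (tmp t') = a0.reg (tmp t') := by
          intro t' ht'
          have := RAM.Cfg.write_reg a0 (tmp (t + 2)) (N - i) (tmp t')
          rwa [if_neg (by unfold tmp; omega)] at this
        obtain ⟨a3, hreach3, ha3, hra3, ht3⟩ := reaches_copy_var (x := x) (ω := ω) hidx v ha2 hra2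
          (t := t + 1) hM4 hM5
        rw [hreg2 _ (by omega), hi0] at hra3
        obtain ⟨a4, T4, hT4, hreach4, ha4, hra4, ht4⟩ :=
          ih i hi ((hbdd i (by omega)).set v (by omega)) ((hpow (by omega)).trans hB) _ (t + 2)
            hMs a3 ha3 hra3
        have hreg4 : ∀ t' < t + 2, a4.reg (tmp t') = a0.reg (tmp t') := fun t' ht' => by
          rw [ht4 t' ht', ht3, hreg2 t' ht']
        have hVB : i + 1 ≤ B := hi.trans (hN.trans hB')
        have ha5 : Ready (a4.write (tmp (t + 2)) 1) (o + e.len + 5 + s.len + 1) B :=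
          ha4.write (by omega)
        have ha6 : Ready ((a4.write (tmp (t + 2)) 1).write (tmp (t + 1)) (i + 1))
          (o + e.len + 5 + s.len + 2) B := ha5.write hVB
        have ha7 : Ready (((a4.write (tmp (t + 2)) 1).write (tmp (t + 1)) (i + 1)).write
          (tmp (t + 2)) 0) (o + e.len + 5 + s.len + 3) B := ha6.write (Nat.zero_le _)
        have ha8 := ha7.jump (a := tmp (t + 2)) (l := o + e.len + 1)
          (o' := o + e.len + 1) (by rw [RAM.Cfg.write_reg, if_pos rfl, if_pos rfl])
        have hra8 := ((hra4.write_tmp (t + 2) 1).write_tmp (t + 1) (i + 1)).write_tmp (t + 2) 0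
        refine ⟨_, T0 + (1 + (1 + (2 + (T4 + (1 + (1 + (1 + 1))))))), ?_, hreach.trans
          ((ha0.reaches_exec hM2 ?_ ha1).trans ((ha1.reaches_exec hM3 rfl ha2).trans
          (hreach3.trans (hreach4.trans ((ha4.reaches_exec hM6 rfl ha5).trans
          ((ha5.reaches_exec hM7 ?_ ha6).trans ((ha6.reaches_exec hM8 rfl ha7).trans
          (ha7.reaches_exec hM9 rfl ha8)))))))), ha8,
          ⟨hra8.var, hra8.mem, hra8.used⟩, ?_, ?_, fun t' ht' => ?_⟩
        · rw [Nat.succ_mul]; omega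
        · rw [RAM.exec, hv0, hi0]
        · rw [RAM.exec, RAM.Cfg.write_reg, RAM.Cfg.write_reg, if_neg (by unfold tmp; omega),
            if_pos rfl, hreg4 _ (by omega), hi0]
        · change (((a4.write (tmp (t + 2)) 1).write (tmp (t + 1)) (i + 1)).write
            (tmp (t + 2)) 0).reg (tmp t) = N
          simp only [RAM.Cfg.write_reg]
          rw [if_neg (by unfold tmp; omega), if_neg (by unfold tmp; omega),
            if_neg (by unfold tmp; omega), hreg4 _ (by omega), hv0]
        · change (((a4.write (tmp (t + 2)) 1).write (tmp (t + 1)) (i + 1)).write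
            (tmp (t + 2)) 0).reg (tmp (t + 1)) = i + 1
          rw [RAM.Cfg.write_reg, RAM.Cfg.write_reg, if_neg (by unfold tmp; omega), if_pos rfl]
        · change (((a4.write (tmp (t + 2)) 1).write (tmp (t + 1)) (i + 1)).write
            (tmp (t + 2)) 0).reg (tmp t') = c.reg (tmp t')
          simp only [RAM.Cfg.write_reg]
          rw [if_neg (by unfold tmp; omega), if_neg (by unfold tmp; omega),
            if_neg (by unfold tmp; omega), hreg4 _ (by omega), ht0 t' ht']
    obtain ⟨a0, T0, hT0, hreach, ha0, hra0, hv0, hi0, ht0⟩ := key N le_rfl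
    have ha1 : Ready (a0.write (tmp (t + 2)) 0) (o + e.len + 2) B := ha0.write (Nat.zero_le _)
    have ha2 := ha1.jump (a := tmp (t + 2)) (l := o + e.len + 5 + s.len + 4)
      (o' := o + e.len + 5 + s.len + 4) (by rw [RAM.Cfg.write_reg, if_pos rfl, if_pos rfl])
    have hra1 := hra0.write_tmp (t + 2) 0
    refine ⟨_, e.len + (1 + (T0 + (1 + 1))), by omega, hreach0.trans
      ((hc0.reaches_exec hM1 rfl h1).trans (hreach.trans ((ha0.reaches_exec hM2 ?_ ha1).trans
      (ha1.reaches_exec hM3 rfl ha2)))), ha2.of_eq (by simp only [Stmt.len]; omega),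
      ⟨hra1.var, hra1.mem, hra1.used⟩, fun t' ht' => ?_⟩
    · rw [RAM.exec, hv0, hi0, Nat.sub_self]
    · change (a0.write (tmp (t + 2)) 0).reg (tmp t') = c.reg (tmp t')
      rw [RAM.Cfg.write_reg, if_neg (by unfold tmp; omega), ht0 t' ht']

/-- The program that runs a statement and answers whether the variable `v` is nonzero. -/
def Stmt.toProgram (idx : ν → ℕ) (s : Stmt ν) (v : ν) : RAM.Program :=
  s.code idx 0 0 ++ [.jumpZero (3 * idx v) (s.len + 2), .halt true, .halt false]

theorem RAM.step_of_answer {s : RAM.Cfg} (h : s.answer ≠ none) : RAM.step M x ω s = s := by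
  unfold RAM.step
  cases h' : s.answer with
  | none => exact absurd h' h
  | some _ => rfl

theorem RAM.iterate_step_of_answer {s : RAM.Cfg} (h : s.answer ≠ none) (t : ℕ) :
    (RAM.step M x ω)^[t] s = s :=
  Function.iterate_fixed (RAM.step_of_answer h) t

/-- The program answers in time, and its answer is the final value of the variable. -/
theorem Run.toProgram {V : ℕ} (hidx : Function.Injective idx) (hV : 5 ≤ V)
    (hx : ∀ y ∈ x, y ≤ V) {s : Stmt ν} (v : ν) {σ' : Store ν} {T : ℕ}
    (h : Run x ω V s ⟨fun _ => 0, fun _ => 0, 0⟩ σ' T) :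
    (∀ t, T + 2 ≤ t →
      (RAM.run (s.toProgram idx v) x ω t).answer = some (decide (σ'.v v ≠ 0))) ∧
    ∀ t i, (RAM.run (s.toProgram idx v) x ω t).reg i ≤ V ^ s.size := by
  set M := s.toProgram idx v with hMdef
  have hM : CodeAt M 0 (s.code idx 0 0 ++
      [.jumpZero (3 * idx v) (s.len + 2), .halt true, .halt false]) :=
    fun j _ => by rw [Nat.zero_add]; rfl
  simp only [codeAt_append, codeAt_cons, Stmt.length_code] at hM
  obtain ⟨hMs, hM1, hM2, hM3, -⟩ := hM
  have hc : Ready RAM.init 0 (V ^ s.size) := ⟨rfl, rfl, fun _ => Nat.zero_le _⟩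
  obtain ⟨c1, T1, hT1, hreach1, hc1, hr1, -⟩ := h.reaches hidx hV hx
    ⟨fun _ => Nat.zero_le _, fun _ => Nat.zero_le _⟩ le_rfl 0 0 hMs RAM.init hc
    ⟨fun _ => rfl, fun _ => rfl, rfl⟩
  have hc2 := hc1.jump (a := 3 * idx v) (l := s.len + 2)
    (o' := if σ'.v v = 0 then 0 + s.len + 2 else 0 + s.len + 1) (by rw [hr1.var]; congr 1; omega)
  set c2 : RAM.Cfg := { c1 with
    pc := if c1.reg (3 * idx v) = 0 then s.len + 2 else c1.pc + 1 } with hc2def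
  have hreach2 : Reaches M x ω (V ^ s.size) RAM.init c2 (T1 + 1) :=
    hreach1.trans (hc1.reaches_exec hM1 rfl hc2)
  have hM' : M[c2.pc]? = some (.halt (decide (σ'.v v ≠ 0))) := by
    rw [hc2.pc]
    split_ifs with h0
    · simpa [h0] using hM3
    · simpa [h0] using hM2
  have hstep : RAM.step M x ω c2 = { c2 with answer := some (decide (σ'.v v ≠ 0)) } := by
    rw [RAM.step, hc2.answer, hM']
    rfl
  set c3 : RAM.Cfg := { c2 with answer := some (decide (σ'.v v ≠ 0)) } with hc3
  have hrun : ∀ t, T1 + 2 ≤ t → RAM.run M x ω t = c3 := by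
    intro t ht
    obtain ⟨d, rfl⟩ : ∃ d, t = d + (1 + (T1 + 1)) := ⟨t - (T1 + 2), by omega⟩
    rw [RAM.run, Function.iterate_add_apply, Function.iterate_add_apply, hreach2.1,
      Function.iterate_one, hstep]
    exact RAM.iterate_step_of_answer (by simp [hc3]) d
  refine ⟨fun t ht => by rw [hrun t (by omega)], fun t i => ?_⟩
  by_cases ht : t ≤ T1 + 1
  · exact hreach2.2 t ht i
  · rw [hrun t (by omega)]
    exact hc2.bound i

end Semantics

/-! ### Reasoning about structured programs -/

section Spec

instance : Coe ν (Expr ν) := ⟨.var⟩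
instance : Add (Expr ν) := ⟨.op .add⟩
instance : Sub (Expr ν) := ⟨.op .sub⟩
instance : Mul (Expr ν) := ⟨.op .mul⟩
instance : Div (Expr ν) := ⟨.op .div⟩
instance (c : ℕ) : OfNat (Expr ν) c := ⟨.lit c⟩

/-- The remainder of a division, expressed by the operations of the machine. -/
instance : Mod (Expr ν) := ⟨fun a b => a - a / b * b⟩

/-- An expression for the distance of two numbers, which is zero exactly if they are equal. -/
def Expr.dist (a b : Expr ν) : Expr ν := (a - b) + (b - a)

section Eval

variable (x : List ℕ) (σ : Store ν) (a b : Expr ν)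

@[simp] theorem Expr.eval_var (v : ν) : (Expr.var v).eval x σ = σ.v v := rfl
@[simp] theorem Expr.eval_lit (c : ℕ) : (ofNat(c) : Expr ν).eval x σ = ofNat(c) := rfl
@[simp] theorem Expr.eval_add : (a + b).eval x σ = a.eval x σ + b.eval x σ := rfl
@[simp] theorem Expr.eval_sub : (a - b).eval x σ = a.eval x σ - b.eval x σ := rfl
@[simp] theorem Expr.eval_mul : (a * b).eval x σ = a.eval x σ * b.eval x σ := rfl
@[simp] theorem Expr.eval_div : (a / b).eval x σ = a.eval x σ / b.eval x σ := rfl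
@[simp] theorem Expr.eval_mem : a.mem.eval x σ = σ.mem (a.eval x σ) := rfl
@[simp] theorem Expr.eval_inp : a.inp.eval x σ = x.getD (a.eval x σ) 0 := rfl

@[simp] theorem Expr.eval_mod : (a % b).eval x σ = a.eval x σ % b.eval x σ := by
  change a.eval x σ - a.eval x σ / b.eval x σ * b.eval x σ = _
  have := Nat.div_add_mod' (a.eval x σ) (b.eval x σ)
  omega

theorem Expr.eval_dist_eq_zero : (a.dist b).eval x σ = 0 ↔ a.eval x σ = b.eval x σ := by
  simp only [Expr.dist, Expr.eval_add, Expr.eval_sub]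
  omega

end Eval

variable [DecidableEq ν]

/-- The statement may assign to the variable. -/
def Stmt.writes (w : ν) : Stmt ν → Bool
  | .set v _ => decide (v = w)
  | .put _ _ => false
  | .flip v => decide (v = w)
  | .skip => false
  | .seq s r => s.writes w || r.writes w
  | .ite _ s r => s.writes w || r.writes w
  | .loop v _ s => decide (v = w) || s.writes w

/-- The statement may assign to cells of the array. -/
def Stmt.puts : Stmt ν → Bool
  | .set _ _ => false
  | .put _ _ => true
  | .flip _ => false
  | .skip => false
  | .seq s r => s.puts || r.puts
  | .ite _ s r => s.puts || r.puts
  | .loop _ _ s => s.puts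

/-- The statement may use random bits. -/
def Stmt.flips : Stmt ν → Bool
  | .set _ _ => false
  | .put _ _ => false
  | .flip _ => true
  | .skip => false
  | .seq s r => s.flips || r.flips
  | .ite _ s r => s.flips || r.flips
  | .loop _ _ s => s.flips

/-- The stores differ only in variables and cells to which the statement may assign, and the number
of random bits used so far differs only if the statement may use some. -/
structure Frame (s : Stmt ν) (σ τ : Store ν) : Prop where
  var : ∀ w, s.writes w = false → τ.v w = σ.v w
  mem : s.puts = false → τ.mem = σ.mem
  used : s.flips = false → τ.used = σ.used

variable {x : List ℕ} {ω : ℕ → Bool} {V : ℕ}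

theorem Run.frame {s : Stmt ν} {σ σ' : Store ν} {T : ℕ} (h : Run x ω V s σ σ' T) :
    Frame s σ σ' := by
  induction h with
  | set v e _ _ =>
    refine ⟨fun w hw => ?_, fun _ => rfl, fun _ => rfl⟩
    rw [Store.set_v, if_neg]
    rintro rfl
    simp [Stmt.writes] at hw
  | put a e _ _ => exact ⟨fun _ _ => rfl, fun h => by simp [Stmt.puts] at h, fun _ => rfl⟩
  | @flip σ v T _ =>
    refine ⟨fun w hw => ?_, fun _ => rfl, fun h => by simp [Stmt.flips] at h⟩
    have := Store.set_v σ v w (ω σ.used).toNat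
    rw [if_neg] at this
    · exact this
    · rintro rfl
      simp [Stmt.writes] at hw
  | skip => exact ⟨fun _ _ => rfl, fun _ => rfl, fun _ => rfl⟩
  | seq _ _ _ ih1 ih2 =>
    refine ⟨fun w hw => ?_, fun h => ?_, fun h => ?_⟩
    · simp only [Stmt.writes, Bool.or_eq_false_iff] at hw
      rw [ih2.var w hw.2, ih1.var w hw.1]
    · simp only [Stmt.puts, Bool.or_eq_false_iff] at h
      rw [ih2.mem h.2, ih1.mem h.1]
    · simp only [Stmt.flips, Bool.or_eq_false_iff] at h
      rw [ih2.used h.2, ih1.used h.1]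
  | iteTrue _ _ _ ih =>
    refine ⟨fun w hw => ?_, fun h => ?_, fun h => ?_⟩
    · simp only [Stmt.writes, Bool.or_eq_false_iff] at hw
      exact ih.var w hw.1
    · simp only [Stmt.puts, Bool.or_eq_false_iff] at h
      exact ih.mem h.1
    · simp only [Stmt.flips, Bool.or_eq_false_iff] at h
      exact ih.used h.1
  | iteFalse _ _ _ ih =>
    refine ⟨fun w hw => ?_, fun h => ?_, fun h => ?_⟩
    · simp only [Stmt.writes, Bool.or_eq_false_iff] at hw
      exact ih.var w hw.2
    · simp only [Stmt.puts, Bool.or_eq_false_iff] at h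
      exact ih.mem h.2
    · simp only [Stmt.flips, Bool.or_eq_false_iff] at h
      exact ih.used h.2
  | @loop v e s τ T T' _ _ _ ih =>
    have key : ∀ i ≤ e.eval x (τ 0), Frame (.loop v e s) (τ 0) (τ i) := by
      intro i
      induction i with
      | zero => exact fun _ => ⟨fun _ _ => rfl, fun _ => rfl, fun _ => rfl⟩
      | succ i ih' =>
        intro hi
        have h1 := ih' (by omega)
        have h2 := ih i hi
        refine ⟨fun w hw => ?_, fun h => ?_, fun h => ?_⟩
        · rw [← h1.var w hw]
          simp only [Stmt.writes, Bool.or_eq_false_iff, decide_eq_false_iff_not] at hw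
          rw [h2.var w hw.2, Store.set_v, if_neg fun h => hw.1 h.symm]
        · rw [← h1.mem h, h2.mem h]
          rfl
        · rw [← h1.used h, h2.used h]
          rfl
    exact key _ le_rfl

/-- From `σ`, the statement terminates within `T` machine steps in a store that satisfies `Q`, and
it assigns only numbers up to `V`. -/
def Spec (x : List ℕ) (ω : ℕ → Bool) (V : ℕ) (s : Stmt ν) (σ : Store ν) (T : ℕ)
    (Q : Store ν → Prop) : Prop :=
  ∃ σ', Run x ω V s σ σ' T ∧ Q σ'

theorem Run.mono {s : Stmt ν} {σ σ' : Store ν} {T T' : ℕ} (h : Run x ω V s σ σ' T)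
    (hT : T ≤ T') : Run x ω V s σ σ' T' := by
  cases h with
  | set v e h1 h2 => exact .set v e h1 (h2.trans hT)
  | put a e h1 h2 => exact .put a e h1 (h2.trans hT)
  | flip v h1 => exact .flip v (h1.trans hT)
  | skip => exact .skip
  | seq h1 h2 h3 => exact .seq h1 h2 (h3.trans hT)
  | iteTrue h1 h2 h3 => exact .iteTrue h1 h2 (h3.trans hT)
  | iteFalse h1 h2 h3 => exact .iteFalse h1 h2 (h3.trans hT)
  | loop τ h1 h2 h3 => exact .loop τ h1 h2 (h3.trans hT)

namespace Spec

variable {s r : Stmt ν} {σ : Store ν} {T T' T'' : ℕ} {Q Q' : Store ν → Prop}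

theorem mono (h : Spec x ω V s σ T Q) (hT : T ≤ T') (hQ : ∀ τ, Frame s σ τ → Q τ → Q' τ) :
    Spec x ω V s σ T' Q' := by
  obtain ⟨σ', h1, h2⟩ := h
  exact ⟨σ', h1.mono hT, hQ σ' h1.frame h2⟩

theorem set {v : ν} {e : Expr ν} (hV : e.eval x σ ≤ V) (hT : e.len + 2 ≤ T)
    (hQ : Q (σ.set v (e.eval x σ))) : Spec x ω V (.set v e) σ T Q :=
  ⟨_, .set v e hV hT, hQ⟩

theorem put {a e : Expr ν} (hV : e.eval x σ ≤ V) (hT : a.len + e.len + 5 ≤ T)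
    (hQ : Q (σ.put (a.eval x σ) (e.eval x σ))) : Spec x ω V (.put a e) σ T Q :=
  ⟨_, .put a e hV hT, hQ⟩

theorem flip {v : ν} (hT : 1 ≤ T)
    (hQ : Q { σ.set v (ω σ.used).toNat with used := σ.used + 1 }) : Spec x ω V (.flip v) σ T Q :=
  ⟨_, .flip v hT, hQ⟩

theorem skip (hQ : Q σ) : Spec x ω V .skip σ T Q :=
  ⟨_, .skip, hQ⟩

theorem seq (h : Spec x ω V s σ T Q) (h' : ∀ τ, Frame s σ τ → Q τ → Spec x ω V r τ T' Q')
    (hT : T + T' ≤ T'') : Spec x ω V (.seq s r) σ T'' Q' := by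
  obtain ⟨σ', h1, h2⟩ := h
  obtain ⟨σ'', h3, h4⟩ := h' σ' h1.frame h2
  exact ⟨σ'', .seq h1 h3 hT, h4⟩

theorem set_seq {v : ν} {e : Expr ν} (hV : e.eval x σ ≤ V)
    (h : Spec x ω V r (σ.set v (e.eval x σ)) T Q) (hT : e.len + 2 + T ≤ T') :
    Spec x ω V (.seq (.set v e) r) σ T' Q := by
  obtain ⟨σ', h1, h2⟩ := h
  exact ⟨σ', .seq (.set v e hV le_rfl) h1 hT, h2⟩

theorem ite {e : Expr ν} (h : e.eval x σ ≠ 0 → Spec x ω V s σ T Q)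
    (h' : e.eval x σ = 0 → Spec x ω V r σ T Q) (hT : T + e.len + 3 ≤ T') :
    Spec x ω V (.ite e s r) σ T' Q := by
  by_cases he : e.eval x σ = 0
  · obtain ⟨σ', h1, h2⟩ := h' he
    exact ⟨σ', .iteFalse he h1 hT, h2⟩
  · obtain ⟨σ', h1, h2⟩ := h he
    exact ⟨σ', .iteTrue he h1 hT, h2⟩

/-- The rule for loops, with an invariant. -/
theorem loop {v : ν} {e : Expr ν} (N : ℕ) (hN : e.eval x σ = N) (hV : N ≤ V)
    (Inv : ℕ → Store ν → Prop) (h0 : Inv 0 σ)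
    (hstep : ∀ i < N, ∀ τ, Frame (.loop v e s) σ τ → Inv i τ →
      Spec x ω V s (τ.set v i) T (Inv (i + 1)))
    (hT : N * (T + 8) + e.len + 3 ≤ T')
    (hQ : ∀ τ, Frame (.loop v e s) σ τ → Inv N τ → Q τ) : Spec x ω V (.loop v e s) σ T' Q := by
  have key : ∀ n ≤ N, ∃ τ : ℕ → Store ν, τ 0 = σ ∧
      (∀ i < n, Run x ω V s ((τ i).set v i) (τ (i + 1)) T) ∧ Inv n (τ n) ∧
      Frame (.loop v e s) σ (τ n) := by
    intro n
    induction n with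
    | zero =>
      exact fun _ => ⟨fun _ => σ, rfl, by simp, h0, fun _ _ => rfl, fun _ => rfl, fun _ => rfl⟩
    | succ n ih =>
      intro hn
      obtain ⟨τ, hτ0, hτ, hinv, hfr⟩ := ih (by omega)
      obtain ⟨σ', hrun, hinv'⟩ := hstep n hn (τ n) hfr hinv
      refine ⟨Function.update τ (n + 1) σ', ?_, fun i hi => ?_, ?_, ?_⟩
      · rw [Function.update_of_ne (by omega), hτ0]
      · rw [Function.update_of_ne (by omega)]
        by_cases hin : i = n
        · subst hin
          rw [Function.update_self]
          exact hrun
        · rw [Function.update_of_ne (by omega)]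
          exact hτ i (by omega)
      · rwa [Function.update_self]
      · rw [Function.update_self]
        refine ⟨fun w hw => ?_, fun h => ?_, fun h => ?_⟩
        · rw [← hfr.var w hw]
          simp only [Stmt.writes, Bool.or_eq_false_iff, decide_eq_false_iff_not] at hw
          rw [hrun.frame.var w hw.2, Store.set_v, if_neg fun h => hw.1 h.symm]
        · rw [← hfr.mem h, hrun.frame.mem h]
          rfl
        · rw [← hfr.used h, hrun.frame.used h]
          rfl
  obtain ⟨τ, rfl, hτ, hinv, hfr⟩ := key N le_rfl
  subst hN
  exact ⟨_, .loop τ hV hτ hT, hQ _ hfr hinv⟩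

end Spec

end Spec

end Language

/-! ### The program -/

/-- The variables of the program: the numbers `n, m, k, p` of the instance, `total = n + m`,
`masks = 2 ^ k`, the number `bits` of random bits of a random number, `range = 2 ^ bits`, and the
prime number `modulus`; the other variables are local to parts of the program. -/
inductive Var
  | n | m | k | p | total | masks | bits | range | modulus
  | i | j | y | d | t | b | S | a | q | z | h | w | l | c | u | acc | ans
  deriving DecidableEq

namespace Var

/-- The number of a variable. -/
def idx (v : Var) : ℕ := v.ctorIdx

theorem idx_injective : Function.Injective idx := by
  intro v v' h
  cases v <;> cases v' <;> first | rfl | exact absurd h (by decide)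

end Var

section Program

open Stmt Var

/-- Compute `masks = 2 ^ k`. -/
def computeMasks : Stmt Var :=
  seq (set masks 1) (loop i k (set masks (masks + masks)))

/-- Compute the least power `range = 2 ^ bits` of two that is at least `6 * n`. -/
def computeRange : Stmt Var :=
  seq (set range 1) (seq (set bits 0) (loop i (6 * n)
    (ite (6 * n - range) (seq (set range (range + range)) (set bits (bits + 1))) skip)))

/-- Find the largest prime number `modulus` between `range` and `2 * range`, by trial division. The
variable `d` tells whether a proper divisor of `y` has been found. -/
def findModulus : Stmt Var :=
  loop i range (seq (set y (range + 1 + i)) (seq (set d 0)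
    (seq (loop j (y - 2) (ite (y % (j + 2)) skip (set d 1)))
      (ite d skip (set modulus y)))))

/-- Fill the first cells of the array with random numbers. -/
def drawNumbers : Stmt Var :=
  loop i (2 * total * total * total) (seq (set y 0)
    (seq (loop j bits (seq (flip d) (set y (2 * y + d)))) (put i y)))

/-- The cell of the value with the digits `y, a, b, c`. -/
def digitCell (y a b c : Expr Var) : Expr Var := ((y * total + a) * total + b) * total + c

/-- The cell of the coefficient of the mask `S` in the value of the dynamic program at `a`. -/
def dpCell (a S : Expr Var) : Expr Var := 2 * total * total * total + a * masks + S

/-- Compute the coordinate `u = coef ρ q p t a b l`, where `z` tells whether `p` wins the interval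
from `a` to `b`. -/
def computeCoef : Stmt Var :=
  seq (set u 0) (seq (ite (l - t) (set y 0) (set y 1))
    (ite (Expr.dist y z) skip (loop c (t + z)
      (set u ((u + Expr.mem (digitCell 0 a b c) * Expr.mem (digitCell 1 q c l)) % modulus)))))

/-- The loop of `computeWedge` over the coordinates `l`, with `w = 2 ^ l`. The test `S / w % 2`
reads the bit `l` of the mask `S`, and `modulus - h` stands for `-h`. -/
def wedgeLoop : Stmt Var :=
  loop l k (seq (ite (S / w % 2)
    (seq computeCoef (set h ((u * Expr.mem (dpCell a (S - w)) + (modulus - h)) % modulus)))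
    skip) (set w (w + w)))

/-- Compute the coefficient `h` of the mask `S` in the product of the vector of the interval from
`a` to `b` with the value of the dynamic program at `a`. -/
def computeWedge : Stmt Var :=
  seq (set q (Expr.inp (4 + n * m + a * n + b))) (seq (ite (Expr.dist q p) (set z 0) (set z 1))
    (seq (set h 0) (seq (set w 1) wedgeLoop)))

/-- Compute the coefficient of the mask `S` in the value of the dynamic program at `b + 1`. -/
def computeEntry : Stmt Var :=
  seq (set acc 0) (seq (loop a (b + 1) (seq computeWedge (set acc ((acc + h) % modulus))))
    (put (dpCell (b + 1) S) acc))

/-- The initial value of the dynamic program. -/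
def initTable : Stmt Var :=
  seq (loop S masks (put (dpCell 0 S) 0)) (put (dpCell 0 0) 1)

/-- Compute all values of the dynamic program for `p` winning `t + 1` intervals, and set `ans` if
the test succeeds. -/
def testWins : Stmt Var :=
  seq initTable (seq (loop b n (loop S masks computeEntry))
    (ite (Expr.mem (dpCell n (masks - 1))) (set ans 1) skip))

/-- The algorithm. The variable `ans` is nonzero at the end if the answer is yes. -/
def algorithm : Stmt Var :=
  seq (set n (Expr.inp 0)) (seq (set m (Expr.inp 1)) (seq (set k (Expr.inp 2))
    (seq (set p (Expr.inp 3)) (ite (k - n) skip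
      (seq (set total (n + m)) (seq computeMasks (seq computeRange (seq findModulus
        (seq drawNumbers (loop t k testWins))))))))))

end Program

/-! ### Specifications of the parts of the program -/

/-- The variables that describe the instance have their values. -/
structure Env (n m k p r : ℕ) (σ : Store Var) : Prop where
  var_n : σ.v .n = n
  var_m : σ.v .m = m
  var_k : σ.v .k = k
  var_p : σ.v .p = p
  var_total : σ.v .total = n + m
  var_masks : σ.v .masks = 2 ^ k
  var_modulus : σ.v .modulus = r

/-- The variables of `Env`. -/
def envVars : List Var := [.n, .m, .k, .p, .total, .masks, .modulus]

theorem Env.frame {n m k p r : ℕ} {s : Stmt Var} {σ τ : Store Var} (h : Env n m k p r σ)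
    (hf : Frame s σ τ) (hw : (envVars.all fun v => !s.writes v) = true) : Env n m k p r τ := by
  have hw' : ∀ v ∈ envVars, τ.v v = σ.v v := fun v hv =>
    hf.var v (by simpa using List.all_eq_true.mp hw v hv)
  exact ⟨by rw [hw' _ (by decide), h.var_n], by rw [hw' _ (by decide), h.var_m],
    by rw [hw' _ (by decide), h.var_k], by rw [hw' _ (by decide), h.var_p],
    by rw [hw' _ (by decide), h.var_total], by rw [hw' _ (by decide), h.var_masks],
    by rw [hw' _ (by decide), h.var_modulus]⟩

theorem Env.set {n m k p r : ℕ} {σ : Store Var} (h : Env n m k p r σ) (v : Var) (y : ℕ)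
    (hv : v ∉ envVars) : Env n m k p r (σ.set v y) := by
  have hw : ∀ v' ∈ envVars, (σ.set v y).v v' = σ.v v' := fun v' hw => by
    rw [Store.set_v, if_neg]
    rintro rfl
    exact hv hw
  exact ⟨by rw [hw _ (by decide), h.var_n], by rw [hw _ (by decide), h.var_m],
    by rw [hw _ (by decide), h.var_k], by rw [hw _ (by decide), h.var_p],
    by rw [hw _ (by decide), h.var_total], by rw [hw _ (by decide), h.var_masks],
    by rw [hw _ (by decide), h.var_modulus]⟩

section Blocks

variable {x : List ℕ} {ω : ℕ → Bool} {V n m k p r t : ℕ} {q : ℕ → ℕ → ℕ} {g : ℕ → ℕ}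

/-- The relations between the parameters of an instance, and bounds for the numbers that occur. -/
structure Params (V n m k p r t : ℕ) (q : ℕ → ℕ → ℕ) : Prop where
  k_le : k ≤ n
  p_lt : p < m
  q_lt : ∀ a b, q a b < m
  t_lt : t < k
  r_two : 1 < r
  r_le : r ≤ V
  masks_le : 2 ^ k ≤ V
  total_le : 2 * (n + m) ^ 3 ≤ V

theorem Params.sum_le (hP : Params V n m k p r t q) : n + m ≤ V := by
  refine le_trans ?_ hP.total_le
  have := Nat.le_self_pow (n := 3) (by omega) (n + m)
  omega

/-- The vector of the interval from `a` to `b`, for the random numbers `g`. -/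
abbrev randomCoef (n m p r t : ℕ) (q : ℕ → ℕ → ℕ) (g : ℕ → ℕ) (a b l : ℕ) : ZMod r :=
  coef (fun y a b c => (g (digitAddr (n + m) y a b c) : ZMod r)) q p t a b l

theorem digitCell_eval (σ : Store Var) (h : σ.v .total = n + m) (y a b c : Expr Var) :
    (digitCell y a b c).eval x σ
      = digitAddr (n + m) (y.eval x σ) (a.eval x σ) (b.eval x σ) (c.eval x σ) := by
  simp [digitCell, digitAddr, h]

theorem computeCoef_spec (hP : Params V n m k p r t q) {σ : Store Var} (henv : Env n m k p r σ)
    (hg : ∀ i < 2 * (n + m) ^ 3, σ.mem i = g i) {a b l : ℕ} (ha : a < n) (hb : b < n)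
    (hl : l < k) (ht' : σ.v .t = t) (ha' : σ.v .a = a) (hb' : σ.v .b = b) (hl' : σ.v .l = l)
    (hq' : σ.v .q = q a b) (hz' : σ.v .z = if q a b = p then 1 else 0) :
    Spec x ω V computeCoef σ (300 * (n + m)) fun τ =>
      τ.v .u < r ∧ (τ.v .u : ZMod r) = randomCoef n m p r t q g a b l := by
  have := hP.k_le; have := hP.p_lt; have := hP.t_lt; have := hP.r_two; have := hP.r_le
  have := hP.q_lt a b; have := hP.sum_le
  unfold computeCoef
  refine Spec.set_seq (T := 200 * (n + m) + 50) (by simp) ?_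
    (le_trans (Nat.add_le_add_right (by decide : _ ≤ 10) _) (by omega))
  refine Spec.seq (T := 20) (T' := 200 * (n + m) + 30)
    (Q := fun τ => τ.v .y = (if l ≤ t then 1 else 0)) ?_ (fun τ hf hy => ?_) (by omega)
  · refine Spec.ite (T := 10) (fun h => ?_) (fun h => ?_) (by decide)
    · refine Spec.set (by simp) (by decide) ?_
      simp only [Expr.eval_sub, Expr.eval_var, Store.set_v, hl', ht', reduceCtorEq, if_false] at h
      simp only [Store.set_v, if_true, Expr.eval_lit]
      rw [if_neg (by omega)]
    · refine Spec.set (by simp; omega) (by decide) ?_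
      simp only [Expr.eval_sub, Expr.eval_var, Store.set_v, hl', ht', reduceCtorEq, if_false] at h
      simp only [Store.set_v, if_true, Expr.eval_lit]
      rw [if_pos (by omega)]
  · have hv : ∀ v, v ≠ .y → v ≠ .u → τ.v v = σ.v v := fun v h1 h2 => by
      rw [hf.var v (by simp [Stmt.writes, h1.symm]), Store.set_v, if_neg h2]
    have hu : τ.v .u = 0 := by rw [hf.var .u (by decide), Store.set_v, if_pos rfl, Expr.eval_lit]
    have hmem : τ.mem = σ.mem := by rw [hf.mem (by decide)]; rfl
    have hflag : (Expr.dist (.var .y) (.var .z)).eval x τ = 0 ↔ (l ≤ t ↔ q a b = p) := by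
      rw [Expr.eval_dist_eq_zero, Expr.eval_var, Expr.eval_var, hy,
        hv .z (by decide) (by decide), hz']
      by_cases h1 : l ≤ t <;> by_cases h2 : q a b = p <;> simp [h1, h2]
    refine Spec.ite (T := 200 * (n + m) + 10) (fun h => ?_) (fun h => ?_)
      (by
        rw [Nat.add_assoc]
        exact le_trans (Nat.add_le_add_left (by decide : _ ≤ 20) _) (by omega))
    · refine Spec.skip ⟨by rw [hu]; omega, ?_⟩
      rw [hu, randomCoef, coef, if_neg (mt hflag.mpr h), Nat.cast_zero]
    · rw [hflag] at h
      have hz1 : σ.v .z ≤ 1 := by rw [hz']; split_ifs <;> simp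
      have hN : ((Var.t : Expr Var) + (Var.z : Expr Var)).eval x τ
          = t + if q a b = p then 1 else 0 := by
        rw [Expr.eval_add, Expr.eval_var, Expr.eval_var, hv .t (by decide) (by decide),
          hv .z (by decide) (by decide), ht', hz']
      have hNle : (t + if q a b = p then 1 else 0) ≤ n := by rw [← hz']; omega
      refine Spec.loop (T := 150) _ hN (by omega) (fun i τ' => τ'.v .u < r ∧ (τ'.v .u : ZMod r) =
        ∑ c ∈ Finset.range i, (g (digitAddr (n + m) 0 a b c) : ZMod r) *
          (g (digitAddr (n + m) 1 (q a b) c l) : ZMod r))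
        ⟨by rw [hu]; omega, by simp [hu]⟩ ?_ ?_ ?_
      · intro i hi τ' hf' hinv
        have hv' : ∀ v, v ≠ .y → v ≠ .u → v ≠ .c → (τ'.set .c i).v v = σ.v v := by
          intro v h1 h2 h3
          rw [Store.set_v, if_neg h3, hf'.var v (by simp [Stmt.writes, h2.symm, h3.symm]),
            hv v h1 h2]
        have hmem' : (τ'.set .c i).mem = σ.mem := by
          rw [Store.set_mem, hf'.mem (by decide), hmem]
        have hsize : (τ'.set .c i).v .total = n + m := by
          rw [hv' _ (by decide) (by decide) (by decide), henv.var_total]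
        have hval : ∀ e : Expr Var, ((((Var.u : Expr Var) + e) % (Var.modulus : Expr Var)).eval x
            (τ'.set .c i)) = (τ'.v .u + e.eval x (τ'.set .c i)) % r := by
          intro e
          rw [Expr.eval_mod, Expr.eval_add, Expr.eval_var, Expr.eval_var,
            hv' .modulus (by decide) (by decide) (by decide), henv.var_modulus, Store.set_v,
            if_neg (by decide)]
        have hlt := fun y => Nat.mod_lt y (show r > 0 by omega)
        refine Spec.set ?_ (by decide) ?_
        · rw [hval]
          have := hlt (τ'.v .u + Expr.eval x (τ'.set .c i)
            (Expr.mem (digitCell 0 Var.a Var.b Var.c) * Expr.mem (digitCell 1 Var.q Var.c Var.l)))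
          omega
        · rw [hval, Store.set_v, if_pos rfl]
          refine ⟨hlt _, ?_⟩
          rw [ZMod.natCast_mod, Nat.cast_add, hinv.2, Finset.sum_range_succ]
          congr 1
          rw [Expr.eval_mul, Expr.eval_mem, Expr.eval_mem, digitCell_eval _ hsize,
            digitCell_eval _ hsize, hmem', Nat.cast_mul]
          simp only [Expr.eval_var, Expr.eval_lit, hv' .a (by decide) (by decide) (by decide),
            hv' .b (by decide) (by decide) (by decide), hv' .q (by decide) (by decide) (by decide),
            hv' .l (by decide) (by decide) (by decide), ha', hb', hq', hl', Store.set_v, if_true]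
          rw [hg _ (digitAddr_lt (by omega) (by omega) (by omega) (by omega)),
            hg _ (digitAddr_lt (by omega) (by omega) (by omega) (by omega))]
      · have : (t + if q a b = p then 1 else 0) * (150 + 8) ≤ n * 158 := Nat.mul_le_mul_right _ hNle
        refine le_trans (Nat.add_le_add_right (Nat.add_le_add_left (by decide : _ ≤ 7) _) _) ?_
        omega
      · intro τ' _ hinv
        refine ⟨hinv.1, ?_⟩
        rw [hinv.2, randomCoef, coef, if_pos h]

/-! ### The exterior product in the array -/

theorem dpCell_eval {σ : Store Var} (henv : Env n m k p r σ) (a S : Expr Var) :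
    (dpCell a S).eval x σ = 2 * (n + m) ^ 3 + a.eval x σ * 2 ^ k + S.eval x σ := by
  simp only [dpCell, Expr.eval_add, Expr.eval_mul, Expr.eval_var, Expr.eval_lit, henv.var_total,
    henv.var_masks]
  ring

/-- The cells of the dynamic program at `a` hold the values `A`. -/
def HoldsRow (n m k r : ℕ) (σ : Store Var) (a : ℕ) (A : ℕ → ZMod r) : Prop :=
  ∀ S < 2 ^ k, σ.mem (2 * (n + m) ^ 3 + a * 2 ^ k + S) < r ∧
    (σ.mem (2 * (n + m) ^ 3 + a * 2 ^ k + S) : ZMod r) = A S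

/-- After `i` iterations, `h` is the product truncated to the coordinates below `i`. -/
theorem wedgeLoop_spec (hP : Params V n m k p r t q) {σ : Store Var} (henv : Env n m k p r σ)
    (hg : ∀ i < 2 * (n + m) ^ 3, σ.mem i = g i) {a b S : ℕ} (ha : a < n) (hb : b < n)
    (hS : S < 2 ^ k) {A : ℕ → ZMod r} (hA : HoldsRow n m k r σ a A)
    (ht' : σ.v .t = t) (ha' : σ.v .a = a) (hb' : σ.v .b = b) (hS' : σ.v .S = S)
    (hq' : σ.v .q = q a b) (hz' : σ.v .z = if q a b = p then 1 else 0)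
    (hh : σ.v .h = 0) (hw : σ.v .w = 1) :
    Spec x ω V wedgeLoop σ (600 * (n + m) ^ 2) fun τ =>
      τ.v .h < r ∧ (τ.v .h : ZMod r) = wedge (randomCoef n m p r t q g a b) A k S := by
  have hkn := hP.k_le; have := hP.p_lt; have := hP.t_lt; have hr2 := hP.r_two
  have hrV := hP.r_le; have := hP.sum_le
  unfold wedgeLoop
  refine Spec.loop (T := 300 * (n + m) + 200) k (by rw [Expr.eval_var, henv.var_k]) (by omega)
    (fun i τ => τ.v .w = 2 ^ i ∧ τ.v .h < r ∧
      (τ.v .h : ZMod r) = wedge (randomCoef n m p r t q g a b) A i S)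
    ⟨by rw [hw, pow_zero], by omega, by rw [hh]; simp [wedge]⟩ ?_ ?_ ?_
  · intro i hi τ hf hinv
    have hv : ∀ v, v ≠ .l → (Stmt.writes v wedgeLoop) = false → (τ.set .l i).v v = σ.v v := by
      intro v h1 h2
      rw [Store.set_v, if_neg h1, hf.var v h2]
    have hmem : (τ.set .l i).mem = σ.mem := by rw [Store.set_mem, hf.mem (by decide)]
    have henv' : Env n m k p r (τ.set .l i) := (henv.frame hf (by decide)).set _ _ (by decide)
    have hw1 : (τ.set .l i).v .w = 2 ^ i := by rw [Store.set_v, if_neg (by decide), hinv.1]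
    have hh1 : (τ.set .l i).v .h = τ.v .h := by rw [Store.set_v, if_neg (by decide)]
    have hl1 : (τ.set .l i).v .l = i := by rw [Store.set_v, if_pos rfl]
    have hS1 : (τ.set .l i).v .S = S := by rw [hv _ (by decide) (by decide), hS']
    have ha1 : (τ.set .l i).v .a = a := by rw [hv _ (by decide) (by decide), ha']
    have hcoef := computeCoef_spec (x := x) (ω := ω) hP henv' (by rw [hmem]; exact hg) ha hb hi
      (by rw [hv _ (by decide) (by decide), ht']) ha1 (by rw [hv _ (by decide) (by decide), hb'])
      hl1 (by rw [hv _ (by decide) (by decide), hq']) (by rw [hv _ (by decide) (by decide), hz'])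
    set σ1 := τ.set .l i with hσ1
    have hbit : ((Var.S : Expr Var) / (Var.w : Expr Var) % 2).eval x σ1 = 0 ↔
        ¬ S.testBit i = true := by
      simp only [Expr.eval_mod, Expr.eval_div, Expr.eval_var, Expr.eval_lit, hS1, hw1,
        Nat.testBit_eq_decide_div_mod_eq, decide_eq_true_eq]
      omega
    refine Spec.seq (T := 300 * (n + m) + 120) (T' := 20)
      (Q := fun τ' => τ'.v .h < r ∧
        (τ'.v .h : ZMod r) = wedge (randomCoef n m p r t q g a b) A (i + 1) S)
      (Spec.ite (T := 300 * (n + m) + 90) (fun h => ?_) (fun h => ?_)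
        (le_trans (Nat.add_le_add_right (Nat.add_le_add_left (by decide : _ ≤ 20) _) _)
          (by omega))) (fun τ' hf' hQ => ?_) (by omega)
    · have hbit' : S.testBit i = true := by
        by_contra hc
        exact h (hbit.mpr hc)
      have hle : 2 ^ i ≤ S := Nat.ge_two_pow_of_testBit hbit'
      refine Spec.seq (T' := 90) hcoef (fun τ' hf' hQ => ?_) le_rfl
      have henv2 := henv'.frame hf' (by decide)
      have hcell := hA (S - 2 ^ i) (by omega)
      have hval : ((((Var.u : Expr Var) * Expr.mem (dpCell (Var.a : Expr Var)
          ((Var.S : Expr Var) - (Var.w : Expr Var))) +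
          ((Var.modulus : Expr Var) - (Var.h : Expr Var))) % (Var.modulus : Expr Var)).eval x τ')
          = (τ'.v .u * σ.mem (2 * (n + m) ^ 3 + a * 2 ^ k + (S - 2 ^ i)) + (r - τ.v .h)) % r := by
        simp only [Expr.eval_mod, Expr.eval_add, Expr.eval_mul, Expr.eval_mem, Expr.eval_sub,
          Expr.eval_var, dpCell_eval henv2, henv2.var_modulus, hf'.var .a (by decide), ha1,
          hf'.var .S (by decide), hS1, hf'.var .w (by decide), hw1, hf'.var .h (by decide), hh1,
          hf'.mem (by decide), hmem]
      have hlt := Nat.mod_lt (τ'.v .u * σ.mem (2 * (n + m) ^ 3 + a * 2 ^ k + (S - 2 ^ i)) +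
        (r - τ.v .h)) (show r > 0 by omega)
      refine Spec.set (by rw [hval]; omega) (by decide) ?_
      rw [hval, Store.set_v, if_pos rfl]
      refine ⟨hlt, ?_⟩
      rw [ZMod.natCast_mod, Nat.cast_add, Nat.cast_mul, Nat.cast_sub hinv.2.1.le,
        ZMod.natCast_self, hQ.2, hcell.2, hinv.2.2, wedge, if_pos hbit']
      ring
    · refine Spec.skip ?_
      rw [hh1, wedge, if_neg (hbit.mp h)]
      exact hinv.2
    · have hw2 : τ'.v .w = 2 ^ i := by rw [hf'.var .w (by decide), hw1]
      have hpow : (2 : ℕ) ^ (i + 1) ≤ 2 ^ k := Nat.pow_le_pow_right (by omega) hi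
      have hmasks := hP.masks_le
      have hval : ((Var.w : Expr Var) + (Var.w : Expr Var)).eval x τ' = 2 ^ (i + 1) := by
        rw [Expr.eval_add, Expr.eval_var, hw2, pow_succ]
        omega
      refine Spec.set (by rw [hval]; omega) (by decide) ?_
      rw [hval]
      refine ⟨by rw [Store.set_v, if_pos rfl], ?_⟩
      rw [Store.set_v, if_neg (by decide)]
      exact hQ
  · have hlen : (Var.k : Expr Var).len = 2 := rfl
    rw [hlen]
    have h1 : k * (300 * (n + m) + 200 + 8) ≤ (n + m) * (300 * (n + m) + 200 + 8) :=
      Nat.mul_le_mul_right _ (by omega)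
    nlinarith
  · intro τ _ hinv
    exact hinv.2

theorem computeWedge_spec (hP : Params V n m k p r t q) {σ : Store Var} (henv : Env n m k p r σ)
    (hg : ∀ i < 2 * (n + m) ^ 3, σ.mem i = g i) {a b S : ℕ} (ha : a < n) (hb : b < n)
    (hS : S < 2 ^ k) {A : ℕ → ZMod r} (hA : HoldsRow n m k r σ a A)
    (hx : x.getD (4 + n * m + a * n + b) 0 = q a b)
    (ht' : σ.v .t = t) (ha' : σ.v .a = a) (hb' : σ.v .b = b) (hS' : σ.v .S = S) :
    Spec x ω V computeWedge σ (700 * (n + m) ^ 2) fun τ =>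
      τ.v .h < r ∧ (τ.v .h : ZMod r) = wedge (randomCoef n m p r t q g a b) A k S := by
  have := hP.p_lt
  have hsum := hP.sum_le
  have := hP.q_lt a b
  have hN : 1 ≤ (n + m) ^ 2 := Nat.one_le_pow _ _ (by omega)
  have hNN : 4 ≤ (n + m) ^ 2 := by nlinarith
  unfold computeWedge
  have hval : (Expr.inp (4 + (Var.n : Expr Var) * (Var.m : Expr Var) +
      (Var.a : Expr Var) * (Var.n : Expr Var) + (Var.b : Expr Var))).eval x σ = q a b := by
    simp only [Expr.eval_inp, Expr.eval_add, Expr.eval_mul, Expr.eval_var, Expr.eval_lit,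
      henv.var_n, henv.var_m, ha', hb', hx]
  refine Spec.set_seq (T := 600 * (n + m) ^ 2 + 50) (by rw [hval]; omega) ?_
    (le_trans (Nat.add_le_add_right (by decide : _ ≤ 30) _) (by omega))
  rw [hval]
  have henv1 : Env n m k p r (σ.set .q (q a b)) := henv.set _ _ (by decide)
  have hq1 : (σ.set .q (q a b)).v .q = q a b := by rw [Store.set_v, if_pos rfl]
  have hv1 : ∀ v, v ≠ .q → (σ.set .q (q a b)).v v = σ.v v := fun v h => by
    rw [Store.set_v, if_neg h]
  have hmem1 : (σ.set .q (q a b)).mem = σ.mem := rfl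
  set σ1 := σ.set .q (q a b)
  have hdist : (Expr.dist (Var.q : Expr Var) (Var.p : Expr Var)).eval x σ1 = 0 ↔ q a b = p := by
    rw [Expr.eval_dist_eq_zero, Expr.eval_var, Expr.eval_var, henv1.var_p, hq1]
  refine Spec.seq (T := 30) (T' := 600 * (n + m) ^ 2 + 20)
    (Q := fun τ => τ.v .z = if q a b = p then 1 else 0)
    (Spec.ite (T := 10) (fun h => ?_) (fun h => ?_) (by decide)) (fun τ hf hz => ?_) (by omega)
  · refine Spec.set (by simp) (by decide) ?_
    rw [Store.set_v, if_pos rfl, if_neg (mt hdist.mpr h), Expr.eval_lit]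
  · refine Spec.set (by simp; omega) (by decide) ?_
    rw [Store.set_v, if_pos rfl, if_pos (hdist.mp h), Expr.eval_lit]
  · refine Spec.set_seq (T := 600 * (n + m) ^ 2 + 10) (by simp) ?_
      (le_trans (Nat.add_le_add_right (by decide : _ ≤ 10) _) (by omega))
    refine Spec.set_seq (T := 600 * (n + m) ^ 2) (by simp; omega) ?_
      (le_trans (Nat.add_le_add_right (by decide : _ ≤ 10) _) (by omega))
    have hv2 : ∀ v, v ≠ .q → v ≠ .z → v ≠ .h → v ≠ .w →
        ((τ.set .h 0).set .w 1).v v = σ.v v := fun v h1 h2 h3 h4 => by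
      rw [Store.set_v, if_neg h4, Store.set_v, if_neg h3,
        hf.var v (by simp [Stmt.writes, h2.symm]), hv1 v h1]
    have hmem2 : ((τ.set .h 0).set .w 1).mem = σ.mem := by
      rw [Store.set_mem, Store.set_mem, hf.mem (by decide), hmem1]
    have henv2 : Env n m k p r ((τ.set .h 0).set .w 1) :=
      ((henv1.frame hf (by decide)).set _ _ (by decide)).set _ _ (by decide)
    exact wedgeLoop_spec hP henv2 (by rw [hmem2]; exact hg) ha hb hS
      (by unfold HoldsRow; rw [hmem2]; exact hA)
      (by rw [hv2 _ (by decide) (by decide) (by decide) (by decide), ht'])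
      (by rw [hv2 _ (by decide) (by decide) (by decide) (by decide), ha'])
      (by rw [hv2 _ (by decide) (by decide) (by decide) (by decide), hb'])
      (by rw [hv2 _ (by decide) (by decide) (by decide) (by decide), hS'])
      (by rw [Store.set_v, if_neg (by decide), Store.set_v, if_neg (by decide),
        hf.var .q (by decide), hq1])
      (by rw [Store.set_v, if_neg (by decide), Store.set_v, if_neg (by decide), hz])
      (by rw [Store.set_v, if_neg (by decide), Store.set_v, if_pos rfl])
      (by rw [Store.set_v, if_pos rfl])

/-! ### The table of the dynamic program -/

/-- The entries of row `b + 1` depend only on earlier rows. -/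
theorem computeEntry_spec (hP : Params V n m k p r t q) {σ : Store Var} (henv : Env n m k p r σ)
    (hx : ∀ a < n, ∀ b < n, x.getD (4 + n * m + a * n + b) 0 = q a b)
    (hg : ∀ i < 2 * (n + m) ^ 3, σ.mem i = g i) {b S : ℕ} (hb : b < n) (hS : S < 2 ^ k)
    (hA : ∀ a ≤ b, HoldsRow n m k r σ a (dp (randomCoef n m p r t q g) k a))
    (ht' : σ.v .t = t) (hb' : σ.v .b = b) (hS' : σ.v .S = S) :
    Spec x ω V computeEntry σ (800 * (n + m) ^ 3) fun τ =>
      ∃ y, y < r ∧ (y : ZMod r) = dp (randomCoef n m p r t q g) k (b + 1) S ∧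
        τ.mem = Function.update σ.mem (2 * (n + m) ^ 3 + (b + 1) * 2 ^ k + S) y := by
  have := hP.p_lt
  have hsum := hP.sum_le
  have hr2 := hP.r_two
  have hrV := hP.r_le
  have h4 : 4 ≤ (n + m) ^ 2 := by
    calc 4 = 2 ^ 2 := rfl
      _ ≤ _ := Nat.pow_le_pow_left (by omega) 2
  have h8 : 8 ≤ (n + m) ^ 3 := by
    calc 8 = 2 ^ 3 := rfl
      _ ≤ _ := Nat.pow_le_pow_left (by omega) 3
  unfold computeEntry
  refine Spec.set_seq (T := 710 * (n + m) ^ 3 + 100) (by simp) ?_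
    (le_trans (Nat.add_le_add_right (by decide : _ ≤ 10) _) (by omega))
  set σ1 := σ.set .acc ((0 : Expr Var).eval x σ) with hσ1
  have henv1 : Env n m k p r σ1 := henv.set _ _ (by decide)
  have hv1 : ∀ v, v ≠ .acc → σ1.v v = σ.v v := fun v h => by
    rw [hσ1, Store.set_v, if_neg h]
  have hmem1 : σ1.mem = σ.mem := rfl
  have hacc1 : σ1.v .acc = 0 := by rw [hσ1, Store.set_v, if_pos rfl, Expr.eval_lit]
  have hN : ((Var.b : Expr Var) + 1).eval x σ1 = b + 1 := by
    rw [Expr.eval_add, Expr.eval_var, Expr.eval_lit, hv1 _ (by decide), hb']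
  refine Spec.seq (T := 710 * (n + m) ^ 3 + 20) (T' := 70)
    (Q := fun τ => τ.v .acc < r ∧
      (τ.v .acc : ZMod r) = dp (randomCoef n m p r t q g) k (b + 1) S)
    (Spec.loop (T := 700 * (n + m) ^ 2 + 30) (b + 1) hN (by omega)
      (fun i τ => τ.v .acc < r ∧ (τ.v .acc : ZMod r) = ∑ j ∈ Finset.range i,
        wedge (randomCoef n m p r t q g j b) (dp (randomCoef n m p r t q g) k j) k S)
      ⟨by rw [hacc1]; omega, by simp [hacc1]⟩ ?_ ?_ ?_) (fun τ hf hQ => ?_) (by omega)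
  · intro a ha τ hf hinv
    have hmem : (τ.set .a a).mem = σ.mem := by rw [Store.set_mem, hf.mem (by decide), hmem1]
    have henv2 : Env n m k p r (τ.set .a a) := (henv1.frame hf (by decide)).set _ _ (by decide)
    have hacc2 : (τ.set .a a).v .acc = τ.v .acc := by rw [Store.set_v, if_neg (by decide)]
    have ha2 : (τ.set .a a).v .a = a := by rw [Store.set_v, if_pos rfl]
    have ht2 : (τ.set .a a).v .t = t := by
      rw [Store.set_v, if_neg (by decide), hf.var .t (by decide), hv1 _ (by decide), ht']
    have hb2 : (τ.set .a a).v .b = b := by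
      rw [Store.set_v, if_neg (by decide), hf.var .b (by decide), hv1 _ (by decide), hb']
    have hS2 : (τ.set .a a).v .S = S := by
      rw [Store.set_v, if_neg (by decide), hf.var .S (by decide), hv1 _ (by decide), hS']
    set σ2 := τ.set .a a
    refine Spec.seq (T' := 30) (computeWedge_spec hP henv2 (by rw [hmem]; exact hg)
      (by omega : a < n) hb hS (by unfold HoldsRow; rw [hmem]; exact hA a (by omega))
      (hx a (by omega) b hb) ht2 ha2 hb2 hS2) (fun τ' hf' hQ' => ?_) le_rfl
    have henv3 := henv2.frame hf' (by decide)
    have hval : ((((Var.acc : Expr Var) + (Var.h : Expr Var)) % (Var.modulus : Expr Var)).eval x τ')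
        = (τ.v .acc + τ'.v .h) % r := by
      rw [Expr.eval_mod, Expr.eval_add, Expr.eval_var, Expr.eval_var, Expr.eval_var,
        henv3.var_modulus, hf'.var .acc (by decide), hacc2]
    have hlt := Nat.mod_lt (τ.v .acc + τ'.v .h) (show r > 0 by omega)
    refine Spec.set (by rw [hval]; omega) (by decide) ?_
    rw [hval, Store.set_v, if_pos rfl]
    refine ⟨hlt, ?_⟩
    rw [ZMod.natCast_mod, Nat.cast_add, hinv.2, hQ'.2, Finset.sum_range_succ]
  · have hlen : ((Var.b : Expr Var) + 1).len = 4 := rfl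
    rw [hlen]
    have h1 : (b + 1) * (700 * (n + m) ^ 2 + 30 + 8) ≤ (n + m) * (700 * (n + m) ^ 2 + 30 + 8) :=
      Nat.mul_le_mul_right _ (by omega)
    have h2 : (n + m) * (700 * (n + m) ^ 2 + 30 + 8) = 700 * (n + m) ^ 3 + 38 * (n + m) := by ring
    have h3 : 4 * (n + m) ≤ (n + m) ^ 3 := by
      calc 4 * (n + m) ≤ (n + m) ^ 2 * (n + m) := Nat.mul_le_mul_right _ h4
        _ = _ := by ring
    omega
  · intro τ _ hinv
    rw [dp_succ]
    exact hinv
  · have henv2 := henv1.frame hf (by decide)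
    have hval : (Expr.var Var.acc).eval x τ = τ.v .acc := rfl
    refine Spec.put (by rw [hval]; omega) (by decide) ?_
    refine ⟨τ.v .acc, hQ.1, hQ.2, ?_⟩
    rw [hval, dpCell_eval henv2, Expr.eval_add, Expr.eval_var, Expr.eval_lit, Expr.eval_var,
      hf.var .b (by decide), hf.var .S (by decide), hv1 _ (by decide), hv1 _ (by decide), hb', hS']
    funext z
    rw [Store.put_mem, hf.mem (by decide), hmem1, Function.update_apply]

/-- Writing to a cell of another row leaves a row unchanged. -/
theorem HoldsRow.update {σ τ : Store Var} {a b S y : ℕ} {A : ℕ → ZMod r}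
    (h : HoldsRow n m k r σ a A) (hab : a ≠ b) (hS : S < 2 ^ k)
    (hτ : τ.mem = Function.update σ.mem (2 * (n + m) ^ 3 + b * 2 ^ k + S) y) :
    HoldsRow n m k r τ a A := by
  intro S' hS'
  rw [hτ, Function.update_of_ne]
  · exact h S' hS'
  · intro heq
    have h1 : (a * 2 ^ k + S') / 2 ^ k = (b * 2 ^ k + S) / 2 ^ k := by congr 1; omega
    rw [Nat.mul_comm, Nat.mul_add_div (Nat.two_pow_pos k), Nat.mul_comm b,
      Nat.mul_add_div (Nat.two_pow_pos k), Nat.div_eq_of_lt hS, Nat.div_eq_of_lt hS'] at h1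
    omega

/-- The state of the dynamic program before it treats the voter `b`: the random numbers and all
rows up to `b` are in place. -/
def HoldsTable (n m k p r t : ℕ) (q : ℕ → ℕ → ℕ) (g : ℕ → ℕ) (σ : Store Var) (b : ℕ) : Prop :=
  (∀ i < 2 * (n + m) ^ 3, σ.mem i = g i) ∧
    ∀ a ≤ b, HoldsRow n m k r σ a (dp (randomCoef n m p r t q g) k a)

theorem computeRow_spec (hP : Params V n m k p r t q) {σ : Store Var} (henv : Env n m k p r σ)
    (hx : ∀ a < n, ∀ b < n, x.getD (4 + n * m + a * n + b) 0 = q a b) {b : ℕ} (hb : b < n)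
    (hA : HoldsTable n m k p r t q g σ b) (ht' : σ.v .t = t) (hb' : σ.v .b = b) :
    Spec x ω V (.loop .S (Var.masks : Expr Var) computeEntry) σ (2 ^ k * (900 * (n + m) ^ 3))
      fun τ => HoldsTable n m k p r t q g τ (b + 1) := by
  have := hP.p_lt
  have h8 : 8 ≤ (n + m) ^ 3 := by
    calc 8 = 2 ^ 3 := rfl
      _ ≤ _ := Nat.pow_le_pow_left (by omega) 3
  refine Spec.loop (T := 800 * (n + m) ^ 3) (2 ^ k) (by rw [Expr.eval_var, henv.var_masks])
    hP.masks_le (fun S τ => HoldsTable n m k p r t q g τ b ∧ ∀ S' < S,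
      τ.mem (2 * (n + m) ^ 3 + (b + 1) * 2 ^ k + S') < r ∧
      (τ.mem (2 * (n + m) ^ 3 + (b + 1) * 2 ^ k + S') : ZMod r)
        = dp (randomCoef n m p r t q g) k (b + 1) S') ⟨hA, by simp⟩ ?_ ?_ ?_
  · intro S hS τ hf hinv
    have henv1 : Env n m k p r (τ.set .S S) := (henv.frame hf (by decide)).set _ _ (by decide)
    refine (computeEntry_spec hP henv1 hx hinv.1.1 hb hS hinv.1.2
      (by rw [Store.set_v, if_neg (by decide), hf.var .t (by decide), ht'])
      (by rw [Store.set_v, if_neg (by decide), hf.var .b (by decide), hb'])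
      (by rw [Store.set_v, if_pos rfl])).mono le_rfl ?_
    rintro τ' - ⟨y, hy, hyd, hmem⟩
    rw [Store.set_mem] at hmem
    refine ⟨⟨fun i hi => ?_, fun a ha => ?_⟩, fun S' hS' => ?_⟩
    · rw [hmem, Function.update_of_ne (by omega)]
      exact hinv.1.1 i hi
    · exact (hinv.1.2 a ha).update (by omega) hS hmem
    · by_cases h : S' = S
      · subst h
        rw [hmem, Function.update_self]
        exact ⟨hy, hyd⟩
      · rw [hmem, Function.update_of_ne (by omega)]
        exact hinv.2 S' (by omega)
  · have hlen : (Var.masks : Expr Var).len = 2 := rfl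
    rw [hlen]
    have h1 : 1 ≤ 2 ^ k := Nat.one_le_two_pow
    have h2 : 2 ^ k * (800 * (n + m) ^ 3 + 8 + 5) ≤ 2 ^ k * (900 * (n + m) ^ 3) :=
      Nat.mul_le_mul_left _ (by omega)
    have h3 : 2 ^ k * (800 * (n + m) ^ 3 + 8 + 5)
      = 2 ^ k * (800 * (n + m) ^ 3 + 8) + 5 * 2 ^ k := by ring
    omega
  · rintro τ - ⟨h1, h2⟩
    refine ⟨h1.1, fun a ha => ?_⟩
    rcases Nat.lt_or_ge a (b + 1) with h | h
    · exact h1.2 a (by omega)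
    · obtain rfl : a = b + 1 := by omega
      exact h2

theorem initTable_spec (hP : Params V n m k p r t q) {σ : Store Var} (henv : Env n m k p r σ)
    (hg : ∀ i < 2 * (n + m) ^ 3, σ.mem i = g i) :
    Spec x ω V initTable σ (2 ^ k * 200) fun τ => HoldsTable n m k p r t q g τ 0 := by
  have := hP.p_lt
  have hr2 := hP.r_two
  have hrV := hP.r_le
  have h1 : 1 ≤ 2 ^ k := Nat.one_le_two_pow
  unfold initTable
  refine Spec.seq (T := 2 ^ k * 60 + 10) (T' := 60)
    (Q := fun τ => (∀ i < 2 * (n + m) ^ 3, τ.mem i = g i) ∧ ∀ S' < 2 ^ k,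
      τ.mem (2 * (n + m) ^ 3 + S') = 0)
    (Spec.loop (T := 50) (2 ^ k) (by rw [Expr.eval_var, henv.var_masks])
    hP.masks_le (fun S τ => (∀ i < 2 * (n + m) ^ 3, τ.mem i = g i) ∧ ∀ S' < S,
      τ.mem (2 * (n + m) ^ 3 + S') = 0) ⟨hg, by simp⟩ ?_ ?_ ?_) (fun τ hf hQ => ?_) (by omega)
  · intro S hS τ hf hinv
    have henv1 : Env n m k p r (τ.set .S S) := (henv.frame hf (by decide)).set _ _ (by decide)
    refine Spec.put (by simp) (by decide) ?_
    have hmem : ((τ.set .S S).put ((dpCell 0 (Var.S : Expr Var)).eval x (τ.set .S S))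
        ((0 : Expr Var).eval x (τ.set .S S))).mem
          = Function.update τ.mem (2 * (n + m) ^ 3 + S) 0 := by
      rw [dpCell_eval henv1, Expr.eval_lit, Expr.eval_var, Store.set_v, if_pos rfl]
      funext z
      rw [Store.put_mem, Store.set_mem, Function.update_apply, zero_mul, add_zero]
    rw [hmem]
    refine ⟨fun i hi => ?_, fun S' hS' => ?_⟩
    · rw [Function.update_of_ne (by omega)]
      exact hinv.1 i hi
    · by_cases h : S' = S
      · rw [h, Function.update_self]
      · rw [Function.update_of_ne (by omega)]
        exact hinv.2 S' (by omega)
  · have hlen : (Var.masks : Expr Var).len = 2 := rfl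
    rw [hlen]
    omega
  · exact fun τ _ h => h
  · have henv1 := henv.frame hf (by decide)
    refine Spec.put (by rw [Expr.eval_lit]; omega) (by decide) ?_
    have hmem : (τ.put ((dpCell 0 0).eval x τ) ((1 : Expr Var).eval x τ)).mem
          = Function.update τ.mem (2 * (n + m) ^ 3) 1 := by
      rw [dpCell_eval henv1, Expr.eval_lit, Expr.eval_lit]
      funext z
      rw [Store.put_mem, Function.update_apply, zero_mul, add_zero, add_zero]
    unfold HoldsTable HoldsRow
    rw [hmem]
    refine ⟨fun i hi => ?_, fun a ha S hS => ?_⟩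
    · rw [Function.update_of_ne (by omega)]
      exact hQ.1 i hi
    · obtain rfl : a = 0 := by omega
      rw [dp_zero, zero_mul, add_zero]
      by_cases h : S = 0
      · rw [h, add_zero, Function.update_self, if_pos rfl]
        exact ⟨by omega, Nat.cast_one⟩
      · rw [Function.update_of_ne (by omega), if_neg h, hQ.2 S hS]
        exact ⟨by omega, Nat.cast_zero⟩

/-- The cell of the full mask holds a reduced residue, so it is zero only if the test value is. -/
theorem testWins_spec (hP : Params V n m k p r t q) {σ : Store Var} (henv : Env n m k p r σ)
    (hx : ∀ a < n, ∀ b < n, x.getD (4 + n * m + a * n + b) 0 = q a b)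
    (hg : ∀ i < 2 * (n + m) ^ 3, σ.mem i = g i) (ht' : σ.v .t = t) :
    Spec x ω V testWins σ (2 ^ k * (1200 * (n + m) ^ 4)) fun τ =>
      (∀ i < 2 * (n + m) ^ 3, τ.mem i = g i) ∧
        (τ.v .ans ≠ 0 ↔ σ.v .ans ≠ 0 ∨
          testValue q p k n (n + m) t (fun i => (g i : ZMod r)) ≠ 0) := by
  have := hP.p_lt
  have := hP.t_lt
  have := hP.k_le
  have hsum := hP.sum_le
  have hr2 := hP.r_two
  have hrV := hP.r_le
  have h1 : 1 ≤ 2 ^ k := Nat.one_le_two_pow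
  have h16 : 16 ≤ (n + m) ^ 4 := by
    calc 16 = 2 ^ 4 := rfl
      _ ≤ _ := Nat.pow_le_pow_left (by omega) 4
  have h2k : 2 ^ k * 16 ≤ 2 ^ k * (n + m) ^ 4 := Nat.mul_le_mul_left _ h16
  have h3 : ∀ c, 2 ^ k * (c * (n + m) ^ 4) = c * (2 ^ k * (n + m) ^ 4) := fun c => by ring
  rw [h3]
  unfold testWins
  refine Spec.seq (T' := 1100 * (2 ^ k * (n + m) ^ 4)) (initTable_spec hP henv hg)
    (fun τ hf hQ => ?_) (by omega)
  have henv1 := henv.frame hf (by decide)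
  have ht1 : τ.v .t = t := by rw [hf.var .t (by decide), ht']
  have hans1 : τ.v .ans = σ.v .ans := hf.var .ans (by decide)
  refine Spec.seq (T := 1000 * (2 ^ k * (n + m) ^ 4)) (T' := 60)
    (Q := fun τ' => HoldsTable n m k p r t q g τ' n)
    (Spec.loop (T := 2 ^ k * (900 * (n + m) ^ 3)) n
    (by rw [Expr.eval_var, henv1.var_n]) (by omega)
    (fun b τ' => HoldsTable n m k p r t q g τ' b) hQ ?_ ?_ ?_) (fun τ' hf' hQ' => ?_) (by omega)
  · intro b hb τ' hf' hinv
    exact computeRow_spec hP ((henv1.frame hf' (by decide)).set _ _ (by decide)) hx hb hinv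
      (by rw [Store.set_v, if_neg (by decide), hf'.var .t (by decide), ht1])
      (by rw [Store.set_v, if_pos rfl])
  · have hlen : (Var.n : Expr Var).len = 2 := rfl
    rw [hlen]
    have h4 : n * (2 ^ k * (900 * (n + m) ^ 3) + 8)
        ≤ (n + m) * (2 ^ k * (900 * (n + m) ^ 3) + 8) := Nat.mul_le_mul_right _ (by omega)
    have h5 : (n + m) * (2 ^ k * (900 * (n + m) ^ 3) + 8)
      = 900 * (2 ^ k * (n + m) ^ 4) + 8 * (n + m) := by ring
    have h6 : 1 * (n + m) ≤ 2 ^ k * (n + m) ^ 4 :=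
      Nat.mul_le_mul h1 (Nat.le_self_pow (by omega) _)
    omega
  · exact fun τ' _ h => h
  · have henv2 := henv1.frame hf' (by decide)
    have hcell := hQ'.2 n le_rfl (2 ^ k - 1) (by omega)
    have hval : (Expr.mem (dpCell (Var.n : Expr Var) ((Var.masks : Expr Var) - 1))).eval x τ'
        = τ'.mem (2 * (n + m) ^ 3 + n * 2 ^ k + (2 ^ k - 1)) := by
      rw [Expr.eval_mem, dpCell_eval henv2, Expr.eval_sub, Expr.eval_var, Expr.eval_var,
        Expr.eval_lit, henv2.var_n, henv2.var_masks]
    have hans2 : τ'.v .ans = σ.v .ans := by rw [hf'.var .ans (by decide), hans1]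
    have hne : (τ'.mem (2 * (n + m) ^ 3 + n * 2 ^ k + (2 ^ k - 1)) ≠ 0 ↔
        testValue q p k n (n + m) t (fun i => (g i : ZMod r)) ≠ 0) := by
      rw [testValue, ← hcell.2, Ne, Ne, not_iff_not, ZMod.natCast_eq_zero_iff]
      exact ⟨fun h => by rw [h]; exact dvd_zero _,
        fun h => Nat.eq_zero_of_dvd_of_lt h hcell.1⟩
    refine Spec.ite (T := 5) (fun h => ?_) (fun h => ?_) (by decide)
    · rw [hval, hne] at h
      refine Spec.set (by rw [Expr.eval_lit]; omega) (by decide) ⟨hQ'.1, ?_⟩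
      rw [Store.set_v, if_pos rfl, Expr.eval_lit]
      simp [h]
    · refine Spec.skip ⟨hQ'.1, ?_⟩
      rw [hval] at h
      rw [hans2]
      have : ¬ testValue q p k n (n + m) t (fun i => (g i : ZMod r)) ≠ 0 :=
        fun h' => (hne.mpr h') h
      simp [this]

/-! ### Random numbers and the prime number -/

theorem computeMasks_spec {σ : Store Var} (hk : σ.v .k = k) (hkV : k ≤ V) (hV : 2 ^ k ≤ V) :
    Spec x ω V computeMasks σ (50 * (k + 1)) fun τ => τ.v .masks = 2 ^ k := by
  have h1 : 1 ≤ 2 ^ k := Nat.one_le_two_pow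
  unfold computeMasks
  refine Spec.set_seq (T := 18 * k + 10) (by rw [Expr.eval_lit]; omega) ?_
    (le_trans (Nat.add_le_add_right (by decide : _ ≤ 10) _) (by omega))
  refine Spec.loop (T := 10) k (by rw [Expr.eval_var, Store.set_v, if_neg (by decide), hk]) hkV
    (fun i τ => τ.v .masks = 2 ^ i)
    (by rw [Store.set_v, if_pos rfl, Expr.eval_lit, pow_zero]) (fun i hi τ hf hinv => ?_)
    (by have : (Var.k : Expr Var).len = 2 := rfl
        omega) (fun τ _ h => h)
  have hpow : (2 : ℕ) ^ (i + 1) ≤ 2 ^ k := Nat.pow_le_pow_right (by omega) hi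
  have hval : ((Var.masks : Expr Var) + (Var.masks : Expr Var)).eval x (τ.set .i i)
      = 2 ^ (i + 1) := by
    rw [Expr.eval_add, Expr.eval_var, Store.set_v, if_neg (by decide), hinv, pow_succ]
    omega
  refine Spec.set (by rw [hval]; omega) (by decide) ?_
  rw [hval, Store.set_v, if_pos rfl]

/-- The number of random bits for one random number: the least `s` with `6 * n ≤ 2 ^ s`. -/
def rangeBits (n : ℕ) : ℕ := Nat.clog 2 (6 * n)

theorem six_mul_le_two_pow_rangeBits (n : ℕ) : 6 * n ≤ 2 ^ rangeBits n :=
  Nat.le_pow_clog (by omega) _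

theorem two_pow_rangeBits_le (hn : 0 < n) : 2 ^ rangeBits n ≤ 12 * n := by
  have h1 := Nat.pow_pred_clog_lt_self (b := 2) (by omega) (x := 6 * n) (by omega)
  have h2 : 0 < rangeBits n := (Nat.lt_clog_iff_pow_lt (by omega)).mpr (by omega)
  obtain ⟨s, hs⟩ := Nat.exists_eq_succ_of_ne_zero h2.ne'
  rw [← rangeBits, hs, Nat.pred_succ] at h1
  rw [hs, pow_succ]
  omega

theorem rangeBits_le (n : ℕ) : rangeBits n ≤ 6 * n :=
  Nat.clog_le_of_le_pow (Nat.lt_two_pow_self).le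

theorem computeRange_spec {σ : Store Var} (hn : σ.v .n = n) (hn0 : 0 < n) (hV : 12 * n ≤ V) :
    Spec x ω V computeRange σ (500 * n) fun τ =>
      τ.v .range = 2 ^ rangeBits n ∧ τ.v .bits = rangeBits n := by
  unfold computeRange
  refine Spec.set_seq (T := 420 * n + 30) (by rw [Expr.eval_lit]; omega) ?_
    (le_trans (Nat.add_le_add_right (by decide : _ ≤ 10) _) (by omega))
  refine Spec.set_seq (T := 420 * n + 20) (by rw [Expr.eval_lit]; omega) ?_
    (le_trans (Nat.add_le_add_right (by decide : _ ≤ 10) _) (by omega))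
  set σ1 := (σ.set .range ((1 : Expr Var).eval x σ)).set .bits
    ((0 : Expr Var).eval x (σ.set .range ((1 : Expr Var).eval x σ))) with hσ1
  have hn1 : σ1.v .n = n := by
    rw [hσ1, Store.set_v, if_neg (by decide), Store.set_v, if_neg (by decide), hn]
  have hr1 : σ1.v .range = 1 := by
    rw [hσ1, Store.set_v, if_neg (by decide), Store.set_v, if_pos rfl, Expr.eval_lit]
  have hb1 : σ1.v .bits = 0 := by
    rw [hσ1, Store.set_v, if_pos rfl, Expr.eval_lit]
  refine Spec.loop (T := 60) (6 * n) (by rw [Expr.eval_mul, Expr.eval_var, Expr.eval_lit, hn1])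
    (by omega)
    (fun i τ => τ.v .bits = min i (rangeBits n) ∧ τ.v .range = 2 ^ τ.v .bits)
    ⟨by rw [hb1, Nat.zero_min], by rw [hr1, hb1, pow_zero]⟩ (fun i hi τ hf hinv => ?_) ?_
    (fun τ _ h => ?_)
  · have hv : ∀ v, v ≠ .i → (τ.set .i i).v v = τ.v v := fun v h => by
      rw [Store.set_v, if_neg h]
    have hcond : ((6 : Expr Var) * (Var.n : Expr Var) - (Var.range : Expr Var)).eval x (τ.set .i i)
        = 0 ↔ ¬ i < rangeBits n := by
      rw [Expr.eval_sub, Expr.eval_mul, Expr.eval_var, Expr.eval_lit, Expr.eval_var,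
        hv _ (by decide), hv _ (by decide), hf.var .n (by decide), hn1, hinv.2]
      have h1 : 2 ^ τ.v .bits < 6 * n ↔ τ.v .bits < rangeBits n :=
        (Nat.lt_clog_iff_pow_lt (by omega)).symm
      omega
    refine Spec.ite (T := 40) (fun h => ?_) (fun h => ?_) (by decide)
    · have hlt : i < rangeBits n := by
        by_contra hc
        exact h (hcond.mpr hc)
      have hbi : τ.v .bits = i := by omega
      have hpow : (2 : ℕ) ^ (i + 1) ≤ 2 ^ rangeBits n := Nat.pow_le_pow_right (by omega) hlt
      have hle := two_pow_rangeBits_le hn0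
      have hval : ((Var.range : Expr Var) + (Var.range : Expr Var)).eval x (τ.set .i i)
          = 2 ^ (i + 1) := by
        rw [Expr.eval_add, Expr.eval_var, hv _ (by decide), hinv.2, hbi, pow_succ]
        omega
      refine Spec.set_seq (T := 20) (by rw [hval]; omega) ?_ (by decide)
      rw [hval]
      have hval' : ((Var.bits : Expr Var) + 1).eval x ((τ.set .i i).set .range (2 ^ (i + 1)))
          = i + 1 := by
        rw [Expr.eval_add, Expr.eval_var, Store.set_v, if_neg (by decide), hv _ (by decide), hbi,
          Expr.eval_lit]
      refine Spec.set (by rw [hval']; omega) (by decide) ?_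
      rw [hval']
      refine ⟨by rw [Store.set_v, if_pos rfl]; omega, ?_⟩
      rw [Store.set_v, if_neg (by decide), Store.set_v, if_pos rfl, Store.set_v, if_pos rfl]
    · rw [hcond] at h
      refine Spec.skip ?_
      rw [hv _ (by decide), hv _ (by decide)]
      exact ⟨by omega, hinv.2⟩
  · have hlen : ((6 : Expr Var) * (Var.n : Expr Var)).len = 4 := rfl
    rw [hlen]
    omega
  · have h2 := rangeBits_le n
    have h3 : τ.v .bits = rangeBits n := by omega
    exact ⟨by rw [h.2, h3], h3⟩

/-- The largest prime number up to `2 * Q`. It exceeds `Q` by Bertrand's postulate. -/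
def primeUpTo (Q : ℕ) : ℕ := Nat.findGreatest Nat.Prime (2 * Q)

theorem primeUpTo_prime {Q : ℕ} (hQ : Q ≠ 0) : (primeUpTo Q).Prime := by
  obtain ⟨r, hr, -, hle⟩ := Nat.exists_prime_lt_and_le_two_mul Q hQ
  exact Nat.findGreatest_spec hle hr

theorem lt_primeUpTo {Q : ℕ} (hQ : Q ≠ 0) : Q < primeUpTo Q := by
  obtain ⟨r, hr, hlt, hle⟩ := Nat.exists_prime_lt_and_le_two_mul Q hQ
  exact hlt.trans_le (Nat.le_findGreatest hle hr)

theorem primeUpTo_le (Q : ℕ) : primeUpTo Q ≤ 2 * Q := Nat.findGreatest_le _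

theorem findModulus_spec {σ : Store Var} {Q : ℕ} (hQ : σ.v .range = Q) (hQ0 : Q ≠ 0)
    (hV : 2 * Q ≤ V) :
    Spec x ω V findModulus σ (200 * Q ^ 2 + 5) fun τ => τ.v .modulus = primeUpTo Q := by
  unfold findModulus
  refine Spec.loop (T := 80 * Q + 90) Q (by rw [Expr.eval_var, hQ]) (by omega)
    -- Nothing is claimed as long as no prime number has been met.
    (fun i τ => (∃ s, s.Prime ∧ Q < s ∧ s ≤ Q + i) →
      τ.v .modulus = Nat.findGreatest Nat.Prime (Q + i))
    (by rintro ⟨s, -, h1, h2⟩; omega) (fun i hi τ hf hinv => ?_) ?_ (fun τ _ h => ?_)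
  · have hval : ((Var.range : Expr Var) + 1 + (Var.i : Expr Var)).eval x (τ.set .i i)
        = Q + 1 + i := by
      rw [Expr.eval_add, Expr.eval_add, Expr.eval_var, Expr.eval_var, Expr.eval_lit, Store.set_v,
        if_neg (by decide), Store.set_v, if_pos rfl, hf.var .range (by decide), hQ]
    refine Spec.set_seq (T := 80 * Q + 70) (by rw [hval]; omega) ?_
      (le_trans (Nat.add_le_add_right (by decide : _ ≤ 20) _) (by omega))
    rw [hval]
    refine Spec.set_seq (T := 80 * Q + 60) (by rw [Expr.eval_lit]; omega) ?_
      (le_trans (Nat.add_le_add_right (by decide : _ ≤ 10) _) (by omega))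
    rw [Expr.eval_lit]
    set σ1 := ((τ.set .i i).set .y (Q + 1 + i)).set .d 0 with hσ1
    have hy1 : σ1.v .y = Q + 1 + i := by
      rw [hσ1, Store.set_v, if_neg (by decide), Store.set_v, if_pos rfl]
    have hd1 : σ1.v .d = 0 := by rw [hσ1, Store.set_v, if_pos rfl]
    have hm1 : σ1.v .modulus = τ.v .modulus := by
      rw [hσ1, Store.set_v, if_neg (by decide), Store.set_v, if_neg (by decide), Store.set_v,
        if_neg (by decide)]
    refine Spec.seq (T := 80 * Q + 20) (T' := 30)
      (Q := fun τ' => τ'.v .d = 0 ↔ (Q + 1 + i).Prime)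
      (Spec.loop (T := 30) (Q + 1 + i - 2)
        (by rw [Expr.eval_sub, Expr.eval_var, Expr.eval_lit, hy1]) (by omega)
        (fun j τ' => τ'.v .d = 0 ↔ ∀ s < j, ¬ s + 2 ∣ Q + 1 + i) (by simp [hd1])
        (fun j hj τ' hf' hinv' => ?_) ?_ (fun τ' _ h => ?_)) (fun τ' hf' h => ?_) (by omega)
    · have hval' : ((Var.y : Expr Var) % ((Var.j : Expr Var) + 2)).eval x (τ'.set .j j)
          = (Q + 1 + i) % (j + 2) := by
        rw [Expr.eval_mod, Expr.eval_add, Expr.eval_var, Expr.eval_var, Expr.eval_lit, Store.set_v,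
          if_neg (by decide), Store.set_v, if_pos rfl, hf'.var .y (by decide), hy1]
      refine Spec.ite (T := 10) (fun h => ?_) (fun h => ?_) (by decide)
      · rw [hval', Ne, ← Nat.dvd_iff_mod_eq_zero] at h
        refine Spec.skip ?_
        rw [Store.set_v, if_neg (by decide), hinv']
        refine ⟨fun h1 s hs => ?_, fun h1 s hs => h1 s (by omega)⟩
        rcases Nat.lt_succ_iff_lt_or_eq.mp hs with hs | rfl
        · exact h1 s hs
        · exact h
      · rw [hval', ← Nat.dvd_iff_mod_eq_zero] at h
        refine Spec.set (by rw [Expr.eval_lit]; omega) (by decide) ?_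
        rw [Store.set_v, if_pos rfl, Expr.eval_lit]
        exact ⟨fun h1 => absurd h1 one_ne_zero, fun h1 => absurd h (h1 j (by omega))⟩
    · have hlen : ((Var.y : Expr Var) - 2).len = 4 := rfl
      rw [hlen]
      omega
    · rw [h, Nat.prime_def_lt']
      refine ⟨fun h1 => ⟨by omega, fun s hs hs' => ?_⟩, fun h1 s hs => h1.2 _ (by omega) (by omega)⟩
      have := h1 (s - 2) (by omega)
      rwa [Nat.sub_add_cancel hs] at this
    · have hm2 : τ'.v .modulus = τ.v .modulus := by rw [hf'.var .modulus (by decide), hm1]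
      have hy2 : τ'.v .y = Q + 1 + i := by rw [hf'.var .y (by decide), hy1]
      have hsucc : Q + (i + 1) = (Q + i) + 1 := by ring
      have hsucc' : Q + 1 + i = (Q + i) + 1 := by ring
      refine Spec.ite (T := 10) (fun hd => ?_) (fun hd => ?_) (by decide)
      · rw [Expr.eval_var, Ne, h, hsucc'] at hd
        refine Spec.skip ?_
        rw [hm2, hsucc, Nat.findGreatest_succ, if_neg hd]
        rintro ⟨s, hs, h1, h2⟩
        refine hinv ⟨s, hs, h1, ?_⟩
        rcases Nat.lt_or_ge s (Q + i + 1) with h3 | h3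
        · omega
        · exact absurd ((by omega : s = Q + i + 1) ▸ hs) hd
      · rw [Expr.eval_var, h, hsucc'] at hd
        refine Spec.set (by rw [Expr.eval_var, hy2]; omega) (by decide) fun _ => ?_
        rw [Store.set_v, if_pos rfl, Expr.eval_var, hy2, hsucc, Nat.findGreatest_succ, if_pos hd]
        omega
  · have hlen : (Var.range : Expr Var).len = 2 := rfl
    rw [hlen]
    have : 1 ≤ Q := by omega
    nlinarith
  · obtain ⟨s, hs, hlt, hle⟩ := Nat.exists_prime_lt_and_le_two_mul Q hQ0
    rw [h ⟨s, hs, hlt, by omega⟩, primeUpTo]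
    congr 1
    ring

theorem drawNumbers_spec {σ : Store Var} {N s : ℕ} (hN : σ.v .total = N) (hs : σ.v .bits = s)
    (hused : σ.used = 0) (hV : 2 * N ^ 3 ≤ V) (hVs : 2 ^ s ≤ V) :
    Spec x ω V drawNumbers σ (2 * N ^ 3 * (30 * s + 60) + 20) fun τ =>
      ∀ i < 2 * N ^ 3, τ.mem i = bitsValue ω (i * s) s := by
  unfold drawNumbers
  have h1 : 1 ≤ 2 ^ s := Nat.one_le_two_pow
  refine Spec.loop (T := 30 * s + 50) (2 * N ^ 3) (by
      simp only [Expr.eval_mul, Expr.eval_var, Expr.eval_lit, hN]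
      ring) hV
    (fun i τ => τ.used = i * s ∧ ∀ i' < i, τ.mem i' = bitsValue ω (i' * s) s)
    ⟨by rw [hused, zero_mul], by simp⟩ (fun i hi τ hf hinv => ?_) ?_ (fun τ _ h => h.2)
  · refine Spec.set_seq (T := 30 * s + 40) (by rw [Expr.eval_lit]; omega) ?_
      (le_trans (Nat.add_le_add_right (by decide : _ ≤ 10) _) (by omega))
    rw [Expr.eval_lit]
    set σ1 := (τ.set .i i).set .y 0 with hσ1
    have hi1 : σ1.v .i = i := by
      rw [hσ1, Store.set_v, if_neg (by decide), Store.set_v, if_pos rfl]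
    have hs1 : σ1.v .bits = s := by
      rw [hσ1, Store.set_v, if_neg (by decide), Store.set_v, if_neg (by decide),
        hf.var .bits (by decide), hs]
    have hused1 : σ1.used = i * s := hinv.1
    have hmem1 : σ1.mem = τ.mem := rfl
    have hy1 : σ1.v .y = 0 := by rw [hσ1, Store.set_v, if_pos rfl]
    refine Spec.seq (T := 30 * s + 10) (T' := 20)
      (Q := fun τ' => τ'.used = i * s + s ∧ τ'.v .y = bitsValue ω (i * s) s)
      (Spec.loop (T := 20) s (by rw [Expr.eval_var, hs1])
        (Nat.lt_two_pow_self.le.trans hVs)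
        (fun j τ' => τ'.used = i * s + j ∧ τ'.v .y = bitsValue ω (i * s) j)
        ⟨hused1, hy1⟩ (fun j hj τ' hf' hinv' => ?_) ?_ (fun τ' _ h => h))
      (fun τ' hf' h => ?_) (by omega)
    · have hlt := bitsValue_lt ω (i * s) (j + 1)
      have hpow : (2 : ℕ) ^ (j + 1) ≤ 2 ^ s := Nat.pow_le_pow_right (by omega) hj
      refine Spec.seq (T := 1) (T' := 15) (Q := fun τ'' => τ''.used = i * s + (j + 1) ∧
        τ''.v .y = bitsValue ω (i * s) j ∧ τ''.v .d = (ω (i * s + j)).toNat)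
        (Spec.flip le_rfl ⟨?_, ?_, ?_⟩) (fun τ'' _ h => ?_) (by omega)
      · change τ'.used + 1 = _
        rw [hinv'.1]
        ring
      · change ((τ'.set .j j).set .d (ω (τ'.set .j j).used).toNat).v .y = _
        rw [Store.set_v, if_neg (by decide), Store.set_v, if_neg (by decide), hinv'.2]
      · change ((τ'.set .j j).set .d (ω (τ'.set .j j).used).toNat).v .d = _
        rw [Store.set_used, hinv'.1, Store.set_v, if_pos rfl]
      · have hval : ((2 : Expr Var) * (Var.y : Expr Var) + (Var.d : Expr Var)).eval x τ''
            = bitsValue ω (i * s) (j + 1) := by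
          rw [Expr.eval_add, Expr.eval_mul, Expr.eval_var, Expr.eval_var, Expr.eval_lit, h.2.1,
            h.2.2, bitsValue]
        refine Spec.set (by rw [hval]; omega) (by decide) ?_
        rw [hval, Store.set_v, if_pos rfl]
        exact ⟨h.1, rfl⟩
    · have hlen : (Var.bits : Expr Var).len = 2 := rfl
      rw [hlen]
      omega
    · have hlt := bitsValue_lt ω (i * s) s
      have hi2 : τ'.v .i = i := by rw [hf'.var .i (by decide), hi1]
      have hmem2 : τ'.mem = τ.mem := by rw [hf'.mem (by decide), hmem1]
      refine Spec.put (by rw [Expr.eval_var, h.2]; omega) (by decide) ⟨?_, fun i' hi' => ?_⟩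
      · rw [Store.put_used, h.1]
        ring
      · rw [Store.put_mem, Expr.eval_var, Expr.eval_var, hi2, h.2, hmem2]
        by_cases hii : i' = i
        · rw [if_pos hii, hii]
        · rw [if_neg hii]
          exact hinv.2 i' (by omega)
  · refine le_trans (Nat.add_le_add_right (Nat.add_le_add_left (by decide : _ ≤ 15) _) _) ?_
    have : 2 * N ^ 3 * (30 * s + 50 + 8) ≤ 2 * N ^ 3 * (30 * s + 60) :=
      Nat.mul_le_mul_left _ (by omega)
    omega

/-! ### The complete algorithm -/

/-- The test value of the algorithm for `p` winning `t + 1` intervals, with random bits `ω`. -/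
def randomTestValue (q : ℕ → ℕ → ℕ) (p k n N t : ℕ) (ω : ℕ → Bool) :
    ZMod (primeUpTo (2 ^ rangeBits n)) :=
  testValue q p k n N t fun i => (bitsValue ω (i * rangeBits n) (rangeBits n) : ZMod _)

/-- The final value of `ans` tells whether some test value is nonzero. The case
`k > n`, in which the answer is no, is treated separately, because the addresses of the random
numbers rely on `k ≤ n`. -/
theorem algorithm_spec (hx0 : x.getD 0 0 = n) (hx1 : x.getD 1 0 = m) (hx2 : x.getD 2 0 = k)
    (hx3 : x.getD 3 0 = p)
    (hx : ∀ a < n, ∀ b < n, x.getD (4 + n * m + a * n + b) 0 = q a b)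
    (hp : p < m) (hk : 0 < k) (hq : ∀ a b, q a b < m) (hkV : 2 ^ k ≤ V)
    (hNV : 24 * (n + m) ^ 3 ≤ V) :
    Spec x ω V algorithm ⟨fun _ => 0, fun _ => 0, 0⟩ (2 ^ k * (50000 * (n + m) ^ 5)) fun τ =>
      (τ.v .ans ≠ 0 ↔ k ≤ n ∧ ∃ t < k, randomTestValue q p k n (n + m) t ω ≠ 0) := by
  have h2k : 1 ≤ 2 ^ k := Nat.one_le_two_pow
  have hN3 : n + m ≤ (n + m) ^ 3 := Nat.le_self_pow (by omega) _
  have hNV1 : n + m ≤ V := by omega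
  have hkV1 : k ≤ V := Nat.lt_two_pow_self.le.trans hkV
  have hN5 : n + m ≤ (n + m) ^ 5 := Nat.le_self_pow (by omega) _
  have hT : ∀ c, 2 ^ k * (c * (n + m) ^ 5) = c * (2 ^ k * (n + m) ^ 5) := fun c => by ring
  have hM5 : (n + m) ^ 5 ≤ 2 ^ k * (n + m) ^ 5 := Nat.le_mul_of_pos_left _ h2k
  rw [hT]
  unfold algorithm
  refine Spec.set_seq (T := 49000 * (2 ^ k * (n + m) ^ 5) + 50)
    (by rw [Expr.eval_inp, Expr.eval_lit, hx0]; omega) ?_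
    (le_trans (Nat.add_le_add_right (by decide : _ ≤ 10) _) (by omega))
  refine Spec.set_seq (T := 49000 * (2 ^ k * (n + m) ^ 5) + 40)
    (by rw [Expr.eval_inp, Expr.eval_lit, hx1]; omega) ?_
    (le_trans (Nat.add_le_add_right (by decide : _ ≤ 10) _) (by omega))
  refine Spec.set_seq (T := 49000 * (2 ^ k * (n + m) ^ 5) + 30)
    (by rw [Expr.eval_inp, Expr.eval_lit, hx2]; omega) ?_
    (le_trans (Nat.add_le_add_right (by decide : _ ≤ 10) _) (by omega))
  refine Spec.set_seq (T := 49000 * (2 ^ k * (n + m) ^ 5) + 20)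
    (by rw [Expr.eval_inp, Expr.eval_lit, hx3]; omega) ?_
    (le_trans (Nat.add_le_add_right (by decide : _ ≤ 10) _) (by omega))
  simp only [Expr.eval_inp, Expr.eval_lit, hx0, hx1, hx2, hx3]
  set σ1 := (((Store.set ⟨fun _ => 0, fun _ => 0, 0⟩ Var.n n).set .m m).set .k k).set .p p
    with hσ1
  have hn1 : σ1.v .n = n := by simp [hσ1, Store.set_v]
  have hm1 : σ1.v .m = m := by simp [hσ1, Store.set_v]
  have hk1 : σ1.v .k = k := by simp [hσ1, Store.set_v]
  have hp1 : σ1.v .p = p := by simp [hσ1, Store.set_v]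
  have hans1 : σ1.v .ans = 0 := by simp [hσ1, Store.set_v]
  have hused1 : σ1.used = 0 := rfl
  clear_value σ1
  have hcond : ((Var.k : Expr Var) - (Var.n : Expr Var)).eval x σ1 = k - n := by
    rw [Expr.eval_sub, Expr.eval_var, Expr.eval_var, hk1, hn1]
  refine Spec.ite (T := 49000 * (2 ^ k * (n + m) ^ 5)) (fun h => ?_) (fun h => ?_)
    (by rw [Nat.add_assoc]; exact Nat.add_le_add_left (by decide) _)
  · rw [hcond] at h
    refine Spec.skip ?_
    rw [hans1]
    simp only [ne_eq, not_true, false_iff]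
    omega
  rw [hcond] at h
  have hn0 : 0 < n := by omega
  have hP : ∀ t < k, Params V n m k p (primeUpTo (2 ^ rangeBits n)) t q := fun t ht =>
    ⟨by omega, hp, hq, ht, (primeUpTo_prime (by positivity)).one_lt,
      (primeUpTo_le _).trans (by have := two_pow_rangeBits_le hn0; omega), hkV, by omega⟩
  set Q := 2 ^ rangeBits n with hQ
  have hQn : Q ≤ 12 * n := two_pow_rangeBits_le hn0
  have hQ0 : Q ≠ 0 := by positivity
  have hval : ((Var.n : Expr Var) + (Var.m : Expr Var)).eval x σ1 = n + m := by
    rw [Expr.eval_add, Expr.eval_var, Expr.eval_var, hn1, hm1]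
  refine Spec.set_seq (T := 48000 * (2 ^ k * (n + m) ^ 5)) (by rw [hval]; omega) ?_
    (le_trans (Nat.add_le_add_right (by decide : _ ≤ 10) _) (by omega))
  rw [hval]
  set σ2 := σ1.set .total (n + m) with hσ2
  have hv2 : ∀ v, v ≠ .total → σ2.v v = σ1.v v := fun v h => by rw [hσ2, Store.set_v, if_neg h]
  have htotal2 : σ2.v .total = n + m := by rw [hσ2, Store.set_v, if_pos rfl]
  have hused2 : σ2.used = 0 := hused1
  clear_value σ2
  refine Spec.seq (T' := 47000 * (2 ^ k * (n + m) ^ 5)) (computeMasks_spec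
    (by rw [hv2 _ (by decide), hk1]) hkV1 hkV) (fun σ3 hf3 hmasks3 => ?_) (by omega)
  refine Spec.seq (T' := 46000 * (2 ^ k * (n + m) ^ 5)) (computeRange_spec
    (by rw [hf3.var .n (by decide), hv2 _ (by decide), hn1]) hn0 (by omega))
    (fun σ4 hf4 hrange4 => ?_) (by omega)
  rw [← hQ] at hrange4
  have hN2 : (n + m) ^ 2 ≤ (n + m) ^ 5 := Nat.pow_le_pow_right (by omega) (by omega)
  have hN4 : (n + m) ^ 4 ≤ (n + m) ^ 5 := Nat.pow_le_pow_right (by omega) (by omega)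
  have hN3' : (n + m) ^ 3 ≤ (n + m) ^ 5 := Nat.pow_le_pow_right (by omega) (by omega)
  have hQ2 : Q ^ 2 ≤ 144 * (n + m) ^ 5 := by
    calc Q ^ 2 ≤ (12 * (n + m)) ^ 2 := Nat.pow_le_pow_left (by omega) 2
      _ = 144 * (n + m) ^ 2 := by ring
      _ ≤ _ := Nat.mul_le_mul_left _ hN2
  refine Spec.seq (T' := 4000 * (2 ^ k * (n + m) ^ 5)) (findModulus_spec hrange4.1 hQ0
    (by omega)) (fun σ5 hf5 hmod5 => ?_) (by omega)
  have htotal5 : σ5.v .total = n + m := by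
    rw [hf5.var .total (by decide), hf4.var .total (by decide), hf3.var .total (by decide), htotal2]
  have hdraw : 2 * (n + m) ^ 3 * (30 * rangeBits n + 60) + 20 ≤ 2000 * (2 ^ k * (n + m) ^ 5) := by
    have h1 := rangeBits_le n
    calc 2 * (n + m) ^ 3 * (30 * rangeBits n + 60) + 20
        ≤ 2 * (n + m) ^ 3 * (30 * (6 * (n + m)) + 60) + 20 := by gcongr; omega
      _ = 360 * (n + m) ^ 4 + 120 * (n + m) ^ 3 + 20 := by ring
      _ ≤ _ := by omega
  refine Spec.seq (T' := 2000 * (2 ^ k * (n + m) ^ 5)) (drawNumbers_spec htotal5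
    (by rw [hf5.var .bits (by decide), hrange4.2])
    (by rw [hf5.used (by decide), hf4.used (by decide), hf3.used (by decide), hused2])
    (by omega) (by omega)) (fun σ6 hf6 hmem6 => ?_) (by omega)
  have henv : Env n m k p (primeUpTo Q) σ6 :=
    ⟨by rw [hf6.var .n (by decide), hf5.var .n (by decide), hf4.var .n (by decide),
        hf3.var .n (by decide), hv2 _ (by decide), hn1],
      by rw [hf6.var .m (by decide), hf5.var .m (by decide), hf4.var .m (by decide),
        hf3.var .m (by decide), hv2 _ (by decide), hm1],
      by rw [hf6.var .k (by decide), hf5.var .k (by decide), hf4.var .k (by decide),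
        hf3.var .k (by decide), hv2 _ (by decide), hk1],
      by rw [hf6.var .p (by decide), hf5.var .p (by decide), hf4.var .p (by decide),
        hf3.var .p (by decide), hv2 _ (by decide), hp1],
      by rw [hf6.var .total (by decide), htotal5],
      by rw [hf6.var .masks (by decide), hf5.var .masks (by decide), hf4.var .masks (by decide),
        hmasks3],
      by rw [hf6.var .modulus (by decide), hmod5]⟩
  have hans6 : σ6.v .ans = 0 := by
    rw [hf6.var .ans (by decide), hf5.var .ans (by decide), hf4.var .ans (by decide),
      hf3.var .ans (by decide), hv2 _ (by decide), hans1]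
  refine Spec.loop (T := 2 ^ k * (1200 * (n + m) ^ 4)) k (by rw [Expr.eval_var, henv.var_k]) hkV1
    (fun i τ => (∀ i' < 2 * (n + m) ^ 3, τ.mem i' = bitsValue ω (i' * rangeBits n) (rangeBits n)) ∧
      (τ.v .ans ≠ 0 ↔ ∃ t < i, randomTestValue q p k n (n + m) t ω ≠ 0))
    ⟨hmem6, by simp [hans6]⟩ (fun t ht τ hf hinv => ?_) ?_ (fun τ _ hinv => ?_)
  · refine (testWins_spec (hP t ht) ((henv.frame hf (by decide)).set .t t (by decide)) hx hinv.1
      (by rw [Store.set_v, if_pos rfl])).mono le_rfl fun τ' _ hQ' => ⟨hQ'.1, ?_⟩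
    rw [hQ'.2, Store.set_v, if_neg (by decide), hinv.2]
    constructor
    · rintro (⟨s, hs, h1⟩ | h1)
      · exact ⟨s, by omega, h1⟩
      · exact ⟨t, by omega, h1⟩
    · rintro ⟨s, hs, h1⟩
      rcases Nat.lt_succ_iff_lt_or_eq.mp hs with hs | rfl
      · exact Or.inl ⟨s, hs, h1⟩
      · exact Or.inr h1
  · have hlen : (Var.k : Expr Var).len = 2 := rfl
    rw [hlen]
    have h1 : k * (2 ^ k * (1200 * (n + m) ^ 4) + 8)
        ≤ (n + m) * (2 ^ k * (1200 * (n + m) ^ 4) + 8) := Nat.mul_le_mul_right _ (by omega)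
    have h2 : (n + m) * (2 ^ k * (1200 * (n + m) ^ 4) + 8)
      = 1200 * (2 ^ k * (n + m) ^ 5) + 8 * (n + m) := by ring
    omega
  · rw [hinv.2]
    exact ⟨fun h1 => ⟨by omega, h1⟩, fun h1 => h1.2⟩

end Blocks

/-! ### Encoding of instances -/

namespace WGM

variable (I : WGM) (η : Finset (Fin I.n) → Fin I.m)

theorem encodePath_getD_winner {a b : ℕ} (ha : a < I.n) (hb : b < I.n) :
    (I.encodePath η).getD (4 + I.n * I.m + a * I.n + b) 0 = I.intervalWinner η a b := by
  have hlt : a * I.n + b < I.n * I.n :=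
    calc a * I.n + b < a * I.n + I.n := by omega
      _ = (a + 1) * I.n := by ring
      _ ≤ I.n * I.n := Nat.mul_le_mul_right _ ha
  have hsub : 4 + I.n * I.m + a * I.n + b - (4 + I.n * I.m) = a * I.n + b := by omega
  unfold encodePath
  rw [List.getD_append_right _ _ _ _ (by simp; omega)]
  simp only [List.length_append, List.length_ofFn, List.length_cons, List.length_nil, hsub]
  rw [List.getD_eq_getElem _ _ (by simpa using hlt), List.getElem_ofFn, intervalWinner,
    dif_pos ⟨ha, hb⟩]
  have hdiv : (a * I.n + b) / I.n = a := by
    rw [Nat.mul_comm, Nat.mul_add_div (by omega), Nat.div_eq_of_lt hb, add_zero]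
  have hmod : (a * I.n + b) % I.n = b := by
    rw [Nat.mul_comm, Nat.mul_add_mod, Nat.mod_eq_of_lt hb]
  congr 4
  · exact Fin.ext hdiv
  · exact Fin.ext hmod

theorem le_maxWeight (v : Fin I.n) (q : Fin I.m) : I.w v q ≤ I.maxWeight :=
  (Finset.le_sup (f := fun q => I.w v q) (Finset.mem_univ q)).trans
    (Finset.le_sup (f := fun v => Finset.univ.sup fun q => I.w v q) (Finset.mem_univ v))

theorem le_of_mem_encodePath {V : ℕ} (hk : I.k ≤ V) (hn : I.n + I.m ≤ V) (hw : I.maxWeight ≤ V) :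
    ∀ y ∈ I.encodePath η, y ≤ V := by
  have hp := I.p.2
  intro y hy
  simp only [encodePath, List.mem_append, List.mem_cons, List.not_mem_nil, or_false,
    List.mem_ofFn] at hy
  rcases hy with ((rfl | rfl | rfl | rfl) | ⟨x, rfl⟩) | ⟨x, rfl⟩
  · omega
  · omega
  · exact hk
  · omega
  · exact (I.le_maxWeight _ _).trans hw
  · have := (η (Finset.uIcc x.divNat x.modNat)).2
    omega

end WGM

/-! ### Correctness of the algorithm -/

section Correctness

variable (I : WGM) (η : Finset (Fin I.n) → Fin I.m)

/-- The algorithm has no false positives. -/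
theorem isYes_of_randomTestValue_ne_zero (hG : I.G = SimpleGraph.pathGraph I.n) {t : ℕ}
    {ω : ℕ → Bool} (ht : t < I.k)
    (h : randomTestValue (I.intervalWinner η) I.p I.k I.n (I.n + I.m) t ω ≠ 0) : I.IsYes η := by
  have : Fact (primeUpTo (2 ^ rangeBits I.n)).Prime := ⟨primeUpTo_prime (by positivity)⟩
  obtain ⟨C, hC, hlen, hp, hother⟩ := exists_segmentation_of_dp_ne_zero ht h
  exact I.isYes_of_segmentation η hG hC hlen hp hother

theorem WGM.IsYes.k_le {I : WGM} {η : Finset (Fin I.n) → Fin I.m} (h : I.IsYes η) :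
    I.k ≤ I.n := by
  obtain ⟨P, hk, -⟩ := h
  rw [← hk]
  simpa using P.card_parts_le_card

/-- On a yes-instance, the algorithm errs for at most a third of the random bits. -/
theorem coins_forall_randomTestValue_eq_zero_le (hG : I.G = SimpleGraph.pathGraph I.n)
    (h : I.IsYes η) : RAM.coins {ω | ∀ t < I.k,
      randomTestValue (I.intervalWinner η) I.p I.k I.n (I.n + I.m) t ω = 0} ≤ 1 / 3 := by
  have hprime : (primeUpTo (2 ^ rangeBits I.n)).Prime := primeUpTo_prime (by positivity)
  have : Fact (primeUpTo (2 ^ rangeBits I.n)).Prime := ⟨hprime⟩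
  have hkn := h.k_le
  obtain ⟨t, ht, ρ, hρ⟩ := I.exists_dp_ne_zero (ZMod (primeUpTo (2 ^ rangeBits I.n))) η hG h
  have hq : ∀ a b, I.intervalWinner η a b < I.n + I.m := fun a b =>
    (I.intervalWinner_lt η a b).trans_le (by omega)
  refine le_trans (MeasureTheory.measure_mono fun ω hω => ?_)
    (coins_randomNumbers_mem_le _ (three_mul_card_testValue_eq_zero_le (N := I.n + I.m)
      (lt_primeUpTo (Q := 2 ^ rangeBits I.n) (by positivity)).le
      (six_mul_le_two_pow_rangeBits I.n) (by positivity) (by omega) (by omega) ht hq hρ))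
  rw [Set.mem_ofPred_eq, Finset.mem_filter]
  refine ⟨Finset.mem_univ _, ?_⟩
  rw [← hω t ht, randomTestValue, testValue, testValue]
  refine dp_congr (fun a b hab hb l hl => coef_congr (N := I.n + I.m)
    (fun y hy a ha b hb c hc => ?_) (by omega) (by omega) (by omega) (by omega) (hq a b)) _ le_rfl _
  rw [dif_pos (digitAddr_lt hy ha hb hc)]
  rfl

end Correctness

theorem theorem3 :
    ∃ (M : RAM.Program) (c : ℕ),
      ∀ (I : WGM) (η : Finset (Fin I.n) → Fin I.m),
        I.G = SimpleGraph.pathGraph I.n → I.IsTieBreaking η →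
          RAM.RunsWithin M (I.encodePath η)
              (c * (2 ^ I.k * (I.n + I.m) ^ c))
              (c * (2 ^ I.k * (I.n + I.m) * (I.maxWeight + 1)) ^ c) ∧
          (¬ I.IsYes η → ∀ ω, RAM.Answers M (I.encodePath η) ω false) ∧
          (I.IsYes η →
            RAM.coins {ω | RAM.Answers M (I.encodePath η) ω false} ≤ 1 / 3) := by
  obtain ⟨D, hD⟩ : ∃ D, algorithm.size = D := ⟨_, rfl⟩
  refine ⟨algorithm.toProgram Var.idx .ans, 24 ^ D + 3 * D + 50002, fun I η hG _ => ?_⟩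
  obtain ⟨c, hc⟩ : ∃ c, 24 ^ D + 3 * D + 50002 = c := ⟨_, rfl⟩
  rw [hc]
  have hcD : 24 ^ D ≤ c := by
    rw [← hc, Nat.add_assoc]
    exact Nat.le_add_right _ _
  have hcD' : 3 * D + 50002 ≤ c := by
    rw [← hc, Nat.add_assoc]
    exact Nat.le_add_left _ _
  clear hc
  have hm : 0 < I.m := lt_of_le_of_lt (Nat.zero_le _) I.p.2
  have h2k : 2 ≤ 2 ^ I.k := Nat.le_self_pow I.k_pos.ne' 2
  set X := 2 ^ I.k * (I.n + I.m) * (I.maxWeight + 1) with hX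
  have hkX : 2 ^ I.k ≤ X := by
    rw [hX, Nat.mul_assoc]
    exact Nat.le_mul_of_pos_right _ (by positivity)
  have hNX : I.n + I.m ≤ X := by
    rw [hX, Nat.mul_right_comm]
    exact Nat.le_mul_of_pos_left _ (by positivity)
  have hWX : I.maxWeight + 1 ≤ X := Nat.le_mul_of_pos_left _ (by positivity)
  have hX3 : X ≤ X ^ 3 := Nat.le_self_pow (by omega) X
  have hNX3 : (I.n + I.m) ^ 3 ≤ X ^ 3 := Nat.pow_le_pow_left hNX 3
  have hkk : I.k < 2 ^ I.k := Nat.lt_two_pow_self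
  -- The bound `24 * X ^ 3` covers the inputs, the `2 ^ k` masks, the `2 * (n + m) ^ 3` random
  -- numbers, and the prime number, which is at most `24 * n`.
  -- For all random bits, the program computes whether some test value is nonzero.
  have key : ∀ ω, ∃ b : Bool, (b = true ↔ I.k ≤ I.n ∧ ∃ t < I.k,
      randomTestValue (I.intervalWinner η) I.p I.k I.n (I.n + I.m) t ω ≠ 0) ∧
      (∀ t, 2 ^ I.k * (50000 * (I.n + I.m) ^ 5) + 2 ≤ t →
        (RAM.run (algorithm.toProgram Var.idx .ans) (I.encodePath η) ω t).answer = some b) ∧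
      ∀ t i, (RAM.run (algorithm.toProgram Var.idx .ans) (I.encodePath η) ω t).reg i
        ≤ (24 * X ^ 3) ^ D := by
    intro ω
    obtain ⟨τ, hrun, hτ⟩ := algorithm_spec (x := I.encodePath η) (ω := ω) (V := 24 * X ^ 3)
      (n := I.n) (m := I.m) (k := I.k) (p := I.p) rfl rfl rfl rfl
      (fun a ha b hb => I.encodePath_getD_winner η ha hb) I.p.2 I.k_pos
      (I.intervalWinner_lt η) (by omega) (by omega)
    have h := hrun.toProgram Var.idx_injective (by omega)
      (I.le_of_mem_encodePath η (by omega) (by omega) (by omega)) .ans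
    rw [hD] at h
    exact ⟨_, by rw [decide_eq_true_eq]; exact hτ, h.1, h.2⟩
  have hno : ∀ ω, RAM.Answers (algorithm.toProgram Var.idx .ans) (I.encodePath η) ω false →
      I.k ≤ I.n → ∀ t < I.k,
        randomTestValue (I.intervalWinner η) I.p I.k I.n (I.n + I.m) t ω = 0 := by
    rintro ω ⟨s, hs⟩ hkn t ht
    obtain ⟨b, hb, hans, -⟩ := key ω
    have h1 := hans (2 ^ I.k * (50000 * (I.n + I.m) ^ 5) + 2 + s) (by omega)
    have h2 : RAM.run (algorithm.toProgram Var.idx .ans) (I.encodePath η) ω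
        (2 ^ I.k * (50000 * (I.n + I.m) ^ 5) + 2 + s)
        = RAM.run (algorithm.toProgram Var.idx .ans) (I.encodePath η) ω s := by
      rw [RAM.run, Function.iterate_add_apply]
      exact RAM.iterate_step_of_answer (by rw [← RAM.run, hs]; simp) _
    rw [h2, hs] at h1
    obtain rfl : false = b := Option.some.inj h1
    by_contra hne
    exact absurd (hb.mpr ⟨hkn, t, ht, hne⟩) Bool.false_ne_true
  refine ⟨fun ω => ?_, fun hI ω => ?_, fun hI => ?_⟩
  · obtain ⟨b, -, hans, hreg⟩ := key ω
    refine ⟨?_, fun t i => (hreg t i).trans ?_⟩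
    · rw [hans _ ?_]
      · rfl
      · have h1 : (I.n + I.m) ^ 5 ≤ (I.n + I.m) ^ c := Nat.pow_le_pow_right (by omega) (by omega)
        have h2 : 2 ^ I.k * (I.n + I.m) ^ 5 ≤ 2 ^ I.k * (I.n + I.m) ^ c :=
          Nat.mul_le_mul_left _ h1
        have h3 : 50002 * (2 ^ I.k * (I.n + I.m) ^ c) ≤ c * (2 ^ I.k * (I.n + I.m) ^ c) :=
          Nat.mul_le_mul_right _ (by omega)
        have h4 : 2 ^ I.k * (50000 * (I.n + I.m) ^ 5) = 50000 * (2 ^ I.k * (I.n + I.m) ^ 5) := by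
          ring
        have h5 : 1 ≤ 2 ^ I.k * (I.n + I.m) ^ 5 := Nat.one_le_iff_ne_zero.mpr (by positivity)
        omega
    · calc (24 * X ^ 3) ^ D = 24 ^ D * X ^ (3 * D) := by rw [mul_pow, pow_mul]
        _ ≤ c * X ^ c := Nat.mul_le_mul hcD (Nat.pow_le_pow_right (by omega) (by omega))
  · obtain ⟨b, hb, hans, -⟩ := key ω
    refine ⟨_, (hans _ le_rfl).trans ?_⟩
    cases b
    · rfl
    · obtain ⟨-, t, ht, h⟩ := hb.mp rfl
      exact absurd (isYes_of_randomTestValue_ne_zero I η hG ht h) hI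
  · exact (MeasureTheory.measure_mono fun ω hω => hno ω hω hI.k_le).trans
      (coins_forall_randomTestValue_eq_zero_le I η hG hI)
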